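/- Let $0<q<1$, let $N_1,N_2$ be positive integers, $q_1=q^{1/N_1}$, $q_2=q^{1/N_2}$, let $p\in\mathbf Z$ and $Q>0$ with $Q\sqrt{q_1q_2}<1$. For a partition $\lambda$ let $s_\lambda(q_i^\rho)$ be the Schur function at $(q_i^{1/2},q_i^{3/2},q_i^{5/2},\dots)$, and put $$\Phi_k(\lambda,p)=\sum_{i\ge1}\bigl(q^{k(p+\lambda_i-i+1)}-q^{k(p-i+1)}\bigr)+q^k\frac{1-q^{pk}}{1-q^k},$$ $$Z(\mathbf t,Q,p;q_1,q_2)=\sum_\lambda s_\lambda(q_1^\rho)\,s_\lambda(q_2^\rho)\,Q^{|\lambda|+p(p+1)/2}\exp\Bigl(\sum_{k\ge1}t_k\Phi_k(\lambda,p)\Bigr),$$ a formal power series in $\mathbf t=(t_1,t_2,\dots)$ with real coefficients (each coefficient is an absolutely convergent sum). Let $\psi_n,\psi^*_n$ ($n\in\mathbf Z$) be the fermion modes, $\{\psi_m,\psi_n^*\}=\delta_{m+n,0}$, $\{\psi_m,\psi_n\}=\{\psi^*_m,\psi^*_n\}=0$, on the Fock space with charge $p$ ground states, $\psi_n|p\rangle=0$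 for $n\ge-p$, $\psi^*_n|p\rangle=0$ for $n\ge p+1$; let ${:}\psi_m\psi^*_n{:}=\psi_m\psi_n^*-\langle0|\psi_m\psi_n^*|0\rangle$ and $$J_m=\sum_n{:}\psi_{m-n}\psi^*_n{:},\quad L_0=\sum_n n\,{:}\psi_{-n}\psi^*_n{:},\quad W_0=\sum_n n^2{:}\psi_{-n}\psi^*_n{:},\quad G_\pm(x)=\exp\Bigl(\sum_{k\ge1}\frac{x^{k/2}}{k(1-x^k)}J_{\pm k}\Bigr).$$ Then $$g=q_1^{W_0/2}G_-(q_1)G_+(q_1)\,Q^{L_0}\,G_-(q_2)G_+(q_2)\,q_2^{W_0/2}$$ is a well-defined element of $GL(\infty)$ (a product of exponentials of fermion bilinears in which all sums for the matrix elements converge), and, as formal power series in $\mathbf t$, $$Z(\mathbf t,Q,p;q_1,q_2)=(q_1q_2)^{-p(p+1)(2p+1)/12}\exp\Bigl(\sum_{k\ge1}\frac{q^kt_k}{1-q^k}\Bigr)\langle p|\exp\Bigl(\sum_{k\ge1}(-1)^{N_1k}t_kJ_{N_1k}\Bigr)g|p\rangle$$ and $$Z(\mathbf t,Q,p;q_1,q_2)=(q_1q_2)^{-p(p+1)(2p+1)/12}\exp\Bigl(\sum_{k\ge1}\frac{q^kt_k}{1-q^k}\Bigr)\langle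 p|g\exp\Bigl(\sum_{k\ge1}(-1)^{N_2k}t_kJ_{-N_2k}\Bigr)|p\rangle .$$ Consequently, with the Toda tau function $\tau(\mathbf T,\bar{\mathbf T},p)=\langle p|\exp(\sum_{k\ge1}T_kJ_k)\,g\,\exp(-\sum_{k\ge1}\bar T_kJ_{-k})|p\rangle$, $Z$ equals the same prefactor times $\tau(\mathbf T,0,p)$ where $T_{N_1k}=(-1)^{N_1k}t_k$ and all other $T_j=0$, and also the same prefactor times $\tau(0,\bar{\mathbf T},p)$ where $\bar T_{N_2k}=-(-1)^{N_2k}t_k$ and all other $\bar T_j=0$. -/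

import Mathlib

open scoped MvPowerSeries.WithPiTopology

namespace MeltingCrystal

noncomputable section

open scoped Classical

/-! ### Fermionic Fock space -/

/-- A Maya diagram: a set of occupied integer levels that differs from `{n | n ≤ 0}` by finitely
many elements.  Maya diagrams label the standard basis of the (full) fermionic Fock space; the
excited state of charge `p` labelled by a partition `lam` is the Maya diagram
`{p + lam_i - i + 1 | i = 1, 2, ...}`. -/
@[ext]
structure Maya where
  occ : Set ℤ
  finite_particles : {n : ℤ | 0 < n ∧ n ∈ occ}.Finite
  finite_holes : {n : ℤ | n ≤ 0 ∧ n ∉ occ}.Finite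

/-- The ground state of charge `p`: exactly the levels `n ≤ p` are occupied. -/
def vac (p : ℤ) : Maya where
  occ := {n | n ≤ p}
  finite_particles := (Set.finite_Icc 0 p).subset fun _ h => ⟨h.1.le, h.2⟩
  finite_holes := (Set.finite_Icc p 0).subset fun _ h => ⟨(not_le.mp h.2).le, h.1⟩

/-- Occupy the level `a`. -/
def Maya.fill (S : Maya) (a : ℤ) : Maya where
  occ := insert a S.occ
  finite_particles := (S.finite_particles.insert a).subset fun n h => by
    rcases h.2 with rfl | h'
    · exact Set.mem_insert _ _
    · exact Set.mem_insert_of_mem _ ⟨h.1, h'⟩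
  finite_holes := S.finite_holes.subset fun _ h => ⟨h.1, fun h' => h.2 (Set.mem_insert_of_mem _ h')⟩

/-- Empty the level `a`. -/
def Maya.empty (S : Maya) (a : ℤ) : Maya where
  occ := S.occ \ {a}
  finite_particles := S.finite_particles.subset fun _ h => ⟨h.1, h.2.1⟩
  finite_holes := (S.finite_holes.insert a).subset fun n h => by
    by_cases hn : n = a
    · exact hn ▸ Set.mem_insert _ _
    · exact Set.mem_insert_of_mem _ ⟨h.1, fun h' => h.2 ⟨h', hn⟩⟩

/-- The fermionic sign: `-1` to the number of occupied levels above `a`. -/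
def Maya.sign (S : Maya) (a : ℤ) : ℝ := (-1) ^ {b : ℤ | b ∈ S.occ ∧ a < b}.ncard

/-- The Fock space: finite linear combinations of the basis states. -/
abbrev Fock : Type := Maya →₀ ℝ

/-- The fermion mode `ψ_n`; it creates a particle at the level `-n`. -/
def psi (n : ℤ) : Fock →ₗ[ℝ] Fock :=
  Finsupp.linearCombination ℝ fun S : Maya =>
    if -n ∈ S.occ then (0 : Fock) else Finsupp.single (S.fill (-n)) (S.sign (-n))

/-- The fermion mode `ψ*_n`; it annihilates a particle at the level `n`. -/
def psiStar (n : ℤ) : Fock →ₗ[ℝ] Fock :=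
  Finsupp.linearCombination ℝ fun S : Maya =>
    if n ∈ S.occ then Finsupp.single (S.empty n) (S.sign n) else (0 : Fock)

/-- The matrix element `⟨S| A |T⟩` in the orthonormal basis of states. -/
def matEl (A : Fock →ₗ[ℝ] Fock) (S T : Maya) : ℝ := A (Finsupp.single T 1) S

/-- The normal ordered product `:ψ_m ψ*_n: = ψ_m ψ*_n - ⟨0| ψ_m ψ*_n |0⟩`. -/
def normalOrd (m n : ℤ) : Fock →ₗ[ℝ] Fock :=
  psi m ∘ₗ psiStar n - matEl (psi m ∘ₗ psiStar n) (vac 0) (vac 0) • LinearMap.id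

/-! ### Operators given by their matrix elements

Operators such as `exp (∑ c_k J_{-k})` map a basis state to an infinite linear combination of basis
states.  They are represented by their (infinite) matrices, with entries in a topological ring `R`;
products are given by convergent sums over intermediate states. -/

/-- An infinite matrix `⟨S| A |T⟩` indexed by the basis states. -/
abbrev Op (R : Type*) : Type _ := Maya → Maya → R

section Op

variable {R : Type*} [CommRing R] [TopologicalSpace R]

/-- The identity operator. -/
def Op.one : Op R := fun S T => if S = T then 1 else 0

/-- The product of two operators, `⟨S| A B |T⟩ = ∑_U ⟨S| A |U⟩ ⟨U| B |T⟩`. -/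
def Op.mul (A B : Op R) : Op R := fun S T => ∑' U : Maya, A S U * B U T

/-- All sums over intermediate states in the product `A B` converge (unconditionally). -/
def Op.Composable (A B : Op R) : Prop := ∀ S T : Maya, Summable fun U : Maya => A S U * B U T

/-- Powers of an operator. -/
def Op.pow (A : Op R) : ℕ → Op R
  | 0 => Op.one
  | n + 1 => Op.mul (Op.pow A n) A

/-- The exponential `exp A = ∑_n A^n / n!` of an operator. -/
def Op.exp [Algebra ℝ R] (A : Op R) : Op R :=
  fun S T => ∑' n : ℕ, ((n.factorial : ℝ)⁻¹) • Op.pow A n S T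

/-- All powers of `A`, and the exponential series, converge. -/
def Op.ExpConverges [Algebra ℝ R] (A : Op R) : Prop :=
  (∀ n : ℕ, Op.Composable (Op.pow A n) A) ∧
    ∀ S T : Maya, Summable fun n : ℕ => ((n.factorial : ℝ)⁻¹) • Op.pow A n S T

end Op

infixl:70 " ⊚ " => Op.mul

/-- Regard an operator with real matrix elements as an operator over an `ℝ`-algebra. -/
def Op.const (R : Type*) [CommRing R] [Algebra ℝ R] (A : Op ℝ) : Op R :=
  fun S T => algebraMap ℝ R (A S T)

/-- The expectation value `⟨p| A |p⟩` in the ground state of charge `p`. -/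
def vev {R : Type*} (p : ℤ) (A : Op R) : R := A (vac p) (vac p)

/-! ### Fermion bilinears (each of the sums below has finitely many nonzero terms) -/

/-- The general fermion bilinear `∑_{m,n} a_{mn} :ψ_m ψ*_n:`. -/
def bilin (a : ℤ → ℤ → ℝ) : Op ℝ :=
  fun S T => ∑' mn : ℤ × ℤ, a mn.1 mn.2 * matEl (normalOrd mn.1 mn.2) S T

/-- `J_m = ∑_n :ψ_{m-n} ψ*_n:`. -/
def J (m : ℤ) : Op ℝ := fun S T => ∑' n : ℤ, matEl (normalOrd (m - n) n) S T

/-- `L_0 = ∑_n n :ψ_{-n} ψ*_n:`. -/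
def L0 : Op ℝ := fun S T => ∑' n : ℤ, (n : ℝ) * matEl (normalOrd (-n) n) S T

/-- `W_0 = ∑_n n² :ψ_{-n} ψ*_n:`. -/
def W0 : Op ℝ := fun S T => ∑' n : ℤ, (n : ℝ) ^ 2 * matEl (normalOrd (-n) n) S T

/-- The linear combination `∑_{k ≥ 1} c_k J_{i(k)}`. -/
def currentSum {R : Type*} [CommRing R] [TopologicalSpace R] [Algebra ℝ R]
    (i : ℕ+ → ℤ) (c : ℕ+ → R) : Op R :=
  fun S T => ∑' k : ℕ+, J (i k) S T • c k

/-- The coefficients `q^{k/2} / (k (1 - q^k))`. -/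
def gCoeff (q : ℝ) (k : ℕ+) : ℝ :=
  q ^ (((k : ℕ) : ℝ) / 2) / (((k : ℕ) : ℝ) * (1 - q ^ (k : ℕ)))

/-- `G₊(q) = exp (∑_{k ≥ 1} q^{k/2} / (k (1 - q^k)) J_k)`. -/
def Gplus (q : ℝ) : Op ℝ := Op.exp (currentSum (fun k => ((k : ℕ) : ℤ)) (gCoeff q))

/-- `G₋(q) = exp (∑_{k ≥ 1} q^{k/2} / (k (1 - q^k)) J_{-k})`. -/
def Gminus (q : ℝ) : Op ℝ := Op.exp (currentSum (fun k => -((k : ℕ) : ℤ)) (gCoeff q))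

/-- `q^{W_0/2} = exp ((log q / 2) W_0)` for `q > 0`. -/
def qW0half (q : ℝ) : Op ℝ := Op.exp (fun S T => Real.log q / 2 * W0 S T)

/-- `Q^{L_0} = exp ((log Q) L_0)` for `Q > 0`. -/
def QL0 (Q : ℝ) : Op ℝ := Op.exp (fun S T => Real.log Q * L0 S T)

/-- `g = q₁^{W_0/2} G₋(q₁) G₊(q₁) Q^{L_0} G₋(q₂) G₊(q₂) q₂^{W_0/2}`. -/
def gOp (q₁ q₂ Q : ℝ) : Op ℝ :=
  qW0half q₁ ⊚ Gminus q₁ ⊚ Gplus q₁ ⊚ QL0 Q ⊚ Gminus q₂ ⊚ Gplus q₂ ⊚ qW0half q₂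

/-- The group `GL(∞)`: products `e^{X₁} e^{X₂} ⋯ e^{X_r}` of exponentials of fermion bilinears, all
the exponentials and all the products being convergent. -/
inductive IsGLInf : Op ℝ → Prop
  | exp (a : ℤ → ℤ → ℝ) (h : Op.ExpConverges (bilin a)) : IsGLInf (Op.exp (bilin a))
  | mul_exp (g : Op ℝ) (a : ℤ → ℤ → ℝ) (hg : IsGLInf g) (h : Op.ExpConverges (bilin a))
      (hc : Op.Composable g (Op.exp (bilin a))) : IsGLInf (g ⊚ Op.exp (bilin a))

/-- The Toda tau function
`τ(T, T̄, p) = ⟨p| exp (∑ T_k J_k) g exp (- ∑ T̄_k J_{-k}) |p⟩` of `g`, where the times may be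
specialised to formal power series. -/
def todaTau {σ : Type*} (g : Op ℝ) (T Tbar : ℕ+ → MvPowerSeries σ ℝ) (p : ℤ) :
    MvPowerSeries σ ℝ :=
  vev p (Op.exp (currentSum (fun k => ((k : ℕ) : ℤ)) T) ⊚ Op.const (MvPowerSeries σ ℝ) g ⊚
    Op.exp (currentSum (fun k => -((k : ℕ) : ℤ)) fun k => -Tbar k))

/-! ### The partition function -/

/-- The weight `q^T = ∏_{(i,j) ∈ lam} q^{T_{ij} + 1/2}` of a semi-standard tableau with entries in
`{0, 1, 2, ...}`. -/
def tableauWeight (q : ℝ) {lam : YoungDiagram} (T : SemistandardYoungTableau lam) : ℝ :=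
  ∏ c ∈ lam.cells, q ^ ((T c.1 c.2 : ℝ) + 1 / 2)

/-- The special value `s_lam(q^ρ)`, `q^ρ = (q^{1/2}, q^{3/2}, ...)`, of the Schur function. -/
def schurRho (q : ℝ) (lam : YoungDiagram) : ℝ :=
  ∑' T : SemistandardYoungTableau lam, tableauWeight q T

/-- The potential
`Φ_k(lam, p) = ∑_{i ≥ 1} (q^{k(p + lam_i - i + 1)} - q^{k(p - i + 1)}) + q^k (1 - q^{pk}) / (1 - q^k)`
(a finite sum; the index `i` below starts from `0`). -/
def Phi (q : ℝ) (k : ℕ+) (lam : YoungDiagram) (p : ℤ) : ℝ :=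
  (∑' i : ℕ, (q ^ (((k : ℕ) : ℤ) * (p + (lam.rowLen i : ℤ) - (i : ℤ)))
      - q ^ (((k : ℕ) : ℤ) * (p - (i : ℤ)))))
    + q ^ (k : ℕ) * (1 - q ^ (p * ((k : ℕ) : ℤ))) / (1 - q ^ (k : ℕ))

/-- Formal power series in the coupling constants `t_1, t_2, ...`, with the topology of
coefficientwise convergence. -/
abbrev Series : Type := MvPowerSeries ℕ+ ℝ

/-- The coupling constant `t_k`. -/
def t (k : ℕ+) : Series := MvPowerSeries.X k

/-- `Φ(t, lam, p) = ∑_{k ≥ 1} t_k Φ_k(lam, p)`. -/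
def PhiT (q : ℝ) (lam : YoungDiagram) (p : ℤ) : Series := ∑' k : ℕ+, Phi q k lam p • t k

/-- The summand
`s_lam(q₁^ρ) s_lam(q₂^ρ) Q^{|lam| + p(p+1)/2} e^{Φ(t, lam, p)}` of the partition function. -/
def Zterm (q q₁ q₂ Q : ℝ) (p : ℤ) (lam : YoungDiagram) : Series :=
  (schurRho q₁ lam * schurRho q₂ lam * Q ^ ((lam.card : ℝ) + (p : ℝ) * ((p : ℝ) + 1) / 2)) •
    NormedSpace.exp (PhiT q lam p)

/-- The partition function `Z(t, Q, p; q₁, q₂)`. -/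
def Z (q q₁ q₂ Q : ℝ) (p : ℤ) : Series := ∑' lam : YoungDiagram, Zterm q q₁ q₂ Q p lam

/-- The simple factor
`(q₁ q₂)^{-p(p+1)(2p+1)/12} exp (∑_{k ≥ 1} q^k t_k / (1 - q^k))`. -/
def prefactor (q q₁ q₂ : ℝ) (p : ℤ) : Series :=
  (q₁ * q₂) ^ (-((p : ℝ) * ((p : ℝ) + 1) * (2 * (p : ℝ) + 1)) / 12) •
    NormedSpace.exp (∑' k : ℕ+, (q ^ (k : ℕ) / (1 - q ^ (k : ℕ))) • t k)

/-- The exponent `∑_{k ≥ 1} (-1)^{Nk} t_k J_{Nk}`. -/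
def flowPlus (N : ℕ+) : Op Series :=
  currentSum (fun k => (((N * k : ℕ+) : ℕ) : ℤ)) fun k => (-1) ^ ((N * k : ℕ+) : ℕ) * t k

/-- The exponent `∑_{k ≥ 1} (-1)^{Nk} t_k J_{-Nk}`. -/
def flowMinus (N : ℕ+) : Op Series :=
  currentSum (fun k => -(((N * k : ℕ+) : ℕ) : ℤ)) fun k => (-1) ^ ((N * k : ℕ+) : ℕ) * t k

/-- The times `T_{Nk} = (-1)^{Nk} t_k` (`k ≥ 1`), and `T_j = 0` if `N` does not divide `j`. -/
def restrictedTimes (N : ℕ+) (j : ℕ+) : Series :=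
  ∑' k : ℕ+, if N * k = j then (-1) ^ (j : ℕ) * t k else 0

end

end MeltingCrystal

open MeltingCrystal

/-!
The operators `J_k`, `G_±(q)`, `q^{W_0/2}` and `Q^{L_0}` are realised on the Fock space, and
everything follows from the intertwining relation (`ip_intertwine`, `sum_cur_gramEl`)

`J_K q^{W_0/2} G₋(q) G₊(q) = (-1)^K q^{W_0/2} G₋(q) G₊(q) D_K`,

where `D_K = ∑ n, q^{K n} ψ_{-n} ψ*_n` is diagonal, with a regularisation of the divergent sum over
the Dirac sea.  Since `q₁^{N₁ k} = q^k`, the eigenvalue of `D_{N₁ k}` (for `q₁`) on the state labelled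
by `lam` is `Φ_k(lam, p)` up to the constant `q^k / (1 - q^k)`, which makes the prefactor.  The signs
`(-1)^{N₁ k}` of the times cancel those of the relation, so moving `exp (∑ (-1)^{N₁ k} t_k J_{N₁ k})`
through the first three factors of `g` yields the weights `e^Φ` of the partition function, while
`⟨p| G₊(q) |lam⟩ = s_lam(q^ρ)` yields the Schur functions (`hasSum_Zterm`).  The second formula is the
transpose of the first, because transposing `g` exchanges `q₁` and `q₂` (`gOp_comm`).

The intertwining relation rests on a shift symmetry (`vertexOp_oneBody`).  A one-body operator
`V_m = ∑ n, u^n ψ_{m-n} ψ*_n` satisfies `[J_k, V_m] = (1 - u^{-k}) V_{m+k}` (`cur_oneBody`), so for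
`u = q^K` conjugation by `G₊(q)` multiplies the symbol `∑ V_m z^{-m}` by a polynomial of degree `K`,
the quotient of `∏_{i ≥ 0} (1 - q^{i+1/2} z)⁻¹` and its dilation by `q^{-K}`.  That polynomial is
self-reciprocal up to a dilation, which makes conjugation by `G₋(q) G₊(q)` take `V_K` to a multiple
of `V_0`, and conjugation by `q^{W_0/2}` takes `J_K` to a multiple of `V_K`.  Identities between vertex operators
`exp (∑ c_k J_k)` are proved by uniqueness for the differential equation in the grading parameter
(`energyOp_vertexOp`, `eq_zero_of_energyOp_left`, `eq_zero_of_energyOp_right`).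

The Schur functions are obtained by writing `G₊(q)` as a limit of products of vertex operators with
symbols `1 / (1 - x z)`, each of which removes horizontal strips (`vertexOp_stripCoeff`), just as the
branching rule of tableaux does (`schurPoly_succ`).  The same factorisation shows that the matrix
elements of `G₊(q)` are nonnegative and bounds its row sums, whence the convergence of the sums over
intermediate states in `g` when `Q √(q₁ q₂) < 1` (`summable_cauchy`).  Over formal power series in
`t`, the flows are graded: each coefficient involves finitely many intermediate states, so products
converge and are associative (`IsGraded.composable`, `IsGraded.mul_assoc`).
-/

namespace MeltingCrystal

noncomputable section

open scoped Classical

/-! ### Basis states and fermion modes -/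

lemma Maya.mem_fill {S : Maya} {a n : ℤ} : n ∈ (S.fill a).occ ↔ n = a ∨ n ∈ S.occ := Iff.rfl

lemma Maya.mem_empty {S : Maya} {a n : ℤ} : n ∈ (S.empty a).occ ↔ n ∈ S.occ ∧ n ≠ a := Iff.rfl

lemma Maya.empty_fill {S : Maya} {a : ℤ} (h : a ∉ S.occ) : (S.fill a).empty a = S := by
  ext n
  simp only [Maya.mem_empty, Maya.mem_fill]
  constructor
  · rintro ⟨rfl | h, h'⟩
    · exact absurd rfl h'
    · exact h
  · intro hn
    exact ⟨Or.inr hn, fun e => h (e ▸ hn)⟩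

lemma Maya.fill_empty {S : Maya} {a : ℤ} (h : a ∈ S.occ) : (S.empty a).fill a = S := by
  ext n
  simp only [Maya.mem_empty, Maya.mem_fill]
  constructor
  · rintro (rfl | h')
    · exact h
    · exact h'.1
  · intro hn
    by_cases e : n = a
    · exact Or.inl e
    · exact Or.inr ⟨hn, e⟩

lemma Maya.fill_fill_comm (S : Maya) (a b : ℤ) : (S.fill a).fill b = (S.fill b).fill a := by
  ext n
  simp only [Maya.mem_fill]
  tauto

lemma Maya.fill_empty_comm (S : Maya) {a b : ℤ} (h : a ≠ b) :
    (S.fill a).empty b = (S.empty b).fill a := by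
  ext n
  simp only [Maya.mem_fill, Maya.mem_empty]
  constructor
  · rintro ⟨h1 | h1, h2⟩
    · exact Or.inl h1
    · exact Or.inr ⟨h1, h2⟩
  · rintro (h1 | h1)
    · exact ⟨Or.inl h1, h1 ▸ h⟩
    · exact ⟨Or.inr h1.1, h1.2⟩

lemma Maya.finite_above (S : Maya) (a : ℤ) : {b : ℤ | b ∈ S.occ ∧ a < b}.Finite := by
  refine (S.finite_particles.union (Set.finite_Icc a 0)).subset ?_
  rintro b ⟨hb, hab⟩
  rcases lt_or_ge 0 b with h | h
  · exact Or.inl ⟨h, hb⟩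
  · exact Or.inr ⟨hab.le, h⟩

lemma Maya.sign_mul_self (S : Maya) (a : ℤ) : S.sign a * S.sign a = 1 := by
  unfold Maya.sign
  rw [← mul_pow]
  norm_num

lemma Maya.sign_fill {S : Maya} {x : ℤ} (hx : x ∉ S.occ) (y : ℤ) :
    (S.fill x).sign y = if y < x then -S.sign y else S.sign y := by
  unfold Maya.sign
  split_ifs with h
  · have : {b : ℤ | b ∈ (S.fill x).occ ∧ y < b} = insert x {b : ℤ | b ∈ S.occ ∧ y < b} := by
      ext b
      simp only [Set.mem_ofPred_eq, Set.mem_insert_iff, Maya.mem_fill]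
      constructor
      · rintro ⟨h1 | h1, h2⟩
        · exact Or.inl h1
        · exact Or.inr ⟨h1, h2⟩
      · rintro (h1 | h1)
        · exact ⟨Or.inl h1, h1 ▸ h⟩
        · exact ⟨Or.inr h1.1, h1.2⟩
    rw [this, Set.ncard_insert_of_notMem (fun h => hx h.1) (S.finite_above y), pow_succ]
    ring
  · congr 2
    ext b
    simp only [Set.mem_ofPred_eq, Maya.mem_fill]
    constructor
    · rintro ⟨h1 | h1, h2⟩
      · exact absurd (h1 ▸ h2) h
      · exact ⟨h1, h2⟩
    · rintro ⟨h1, h2⟩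
      exact ⟨Or.inr h1, h2⟩

lemma Maya.sign_empty {S : Maya} {x : ℤ} (hx : x ∈ S.occ) (y : ℤ) :
    (S.empty x).sign y = if y < x then -S.sign y else S.sign y := by
  have h : x ∉ (S.empty x).occ := fun h => h.2 rfl
  have := Maya.sign_fill h y
  rw [Maya.fill_empty hx] at this
  rw [this]
  split_ifs <;> simp

lemma psi_single (a : ℤ) (S : Maya) (r : ℝ) : psi a (Finsupp.single S r) =
    if -a ∈ S.occ then 0 else Finsupp.single (S.fill (-a)) (r * S.sign (-a)) := by
  unfold psi
  rw [Finsupp.linearCombination_single]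
  split_ifs <;> simp

lemma psiStar_single (a : ℤ) (S : Maya) (r : ℝ) : psiStar a (Finsupp.single S r) =
    if a ∈ S.occ then Finsupp.single (S.empty a) (r * S.sign a) else 0 := by
  unfold psiStar
  rw [Finsupp.linearCombination_single]
  split_ifs <;> simp

lemma psi_anticomm (a b : ℤ) (v : Fock) : psi a (psi b v) = -psi b (psi a v) := by
  suffices h : psi a ∘ₗ psi b = -(psi b ∘ₗ psi a) from LinearMap.congr_fun h v
  refine Finsupp.lhom_ext fun S r => ?_
  simp only [LinearMap.comp_apply, LinearMap.neg_apply, psi_single]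
  by_cases ha : -a ∈ S.occ <;> by_cases hb : -b ∈ S.occ <;>
    simp only [ha, hb, if_true, if_false, map_zero, neg_zero, psi_single, Maya.mem_fill,
      or_true, or_false]
  by_cases hab : -a = -b
  · simp [hab]
  · rw [if_neg hab, if_neg (Ne.symm hab), Maya.sign_fill ha, Maya.sign_fill hb,
      Maya.fill_fill_comm, ← Finsupp.single_neg]
    congr 1
    rcases lt_or_gt_of_ne hab with h | h
    · rw [if_pos h, if_neg (not_lt.2 h.le)]; ring
    · rw [if_pos h, if_neg (not_lt.2 h.le)]; ring

lemma psiStar_psi (a b : ℤ) (v : Fock) :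
    psiStar b (psi a v) = (if b = -a then v else 0) - psi a (psiStar b v) := by
  suffices h : psiStar b ∘ₗ psi a = (if b = -a then LinearMap.id else 0) - psi a ∘ₗ psiStar b by
    have := LinearMap.congr_fun h v
    simp only [LinearMap.comp_apply, LinearMap.sub_apply] at this
    rw [this]
    split_ifs <;> simp
  refine Finsupp.lhom_ext fun S r => ?_
  simp only [LinearMap.comp_apply, LinearMap.sub_apply, psi_single, psiStar_single]
  by_cases hab : b = -a
  · subst hab
    by_cases ha : -a ∈ S.occ
    · rw [if_pos ha, if_pos ha, if_pos rfl, map_zero, psi_single,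
        if_neg (fun h => h.2 rfl), Maya.fill_empty ha, Maya.sign_empty ha, if_neg (lt_irrefl _),
        mul_assoc, Maya.sign_mul_self, mul_one]
      simp
    · rw [if_neg ha, if_neg ha, if_pos rfl, map_zero, psiStar_single,
        if_pos (Maya.mem_fill.2 (Or.inl rfl)), Maya.empty_fill ha, Maya.sign_fill ha, if_neg (lt_irrefl _),
        mul_assoc, Maya.sign_mul_self, mul_one]
      simp
  · by_cases ha : -a ∈ S.occ <;> by_cases hb : b ∈ S.occ <;>
      simp only [ha, hb, hab, if_true, if_false, map_zero, psi_single, psiStar_single,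
        Maya.mem_fill, Maya.mem_empty, Ne, or_false, or_true, LinearMap.zero_apply, sub_zero,
        zero_sub, false_and, true_and]
    · rw [if_pos (Ne.symm hab), neg_zero]
    · rw [Maya.sign_fill ha, Maya.sign_empty hb, Maya.fill_empty_comm _ (Ne.symm hab),
        ← Finsupp.single_neg]
      congr 1
      rcases lt_or_gt_of_ne hab with h | h
      · rw [if_pos h, if_neg (not_lt.2 h.le)]; ring
      · rw [if_pos h, if_neg (not_lt.2 h.le)]; ring

lemma matEl_psi (a : ℤ) (S T : Maya) : matEl (psi a) S T = matEl (psiStar (-a)) T S := by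
  unfold matEl
  rw [psi_single, psiStar_single]
  by_cases h1 : -a ∈ T.occ
  · rw [if_pos h1]
    split_ifs with h2
    · rw [Finsupp.single_apply, if_neg]
      · rfl
      · rintro rfl
        exact h1.2 rfl
    · rfl
  · rw [if_neg h1]
    split_ifs with h2
    · rw [Finsupp.single_apply, Finsupp.single_apply]
      by_cases h3 : T.fill (-a) = S
      · subst h3
        rw [if_pos rfl, if_pos (Maya.empty_fill h1), Maya.sign_fill h1, if_neg (lt_irrefl _)]
      · rw [if_neg h3, if_neg]
        rintro rfl
        exact h3 (Maya.fill_empty h2)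
    · rw [Finsupp.single_apply, if_neg]
      · rfl
      · rintro rfl
        exact h2 (Or.inl rfl)

/-! ### Additive charges and the energy -/

/-- The occupation number of the level `n`, normal ordered with respect to the state `vac 0`. -/
def occNum (S : Maya) (n : ℤ) : ℝ := (if n ∈ S.occ then 1 else 0) - (if n ≤ 0 then 1 else 0)

/-- The levels at which a state differs from `vac 0`. -/
def excited (S : Maya) : Finset ℤ :=
  S.finite_particles.toFinset ∪ S.finite_holes.toFinset

lemma mem_excited {S : Maya} {n : ℤ} : n ∈ excited S ↔ (n ∈ S.occ ↔ 0 < n) := by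
  simp only [excited, Finset.mem_union, Set.Finite.mem_toFinset, Set.mem_ofPred_eq]
  rcases lt_or_ge 0 n with h | h
  · simp [h, not_le.2 h]
  · simp [h, not_lt.2 h]

lemma occNum_eq_zero {S : Maya} {n : ℤ} (h : n ∉ excited S) : occNum S n = 0 := by
  rw [mem_excited] at h
  unfold occNum
  rcases lt_or_ge 0 n with h0 | h0
  · have : n ∉ S.occ := fun h' => h (by simp [h', h0])
    simp [this, not_le.2 h0]
  · have : n ∈ S.occ := by
      by_contra h'
      exact h (by simp [h', not_lt.2 h0])
    simp [this, h0]

/-- The eigenvalue on the state `S` of `∑ n, f n :ψ_{-n} ψ*_n:`, that is the sum of `f` over the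
particles minus the sum of `f` over the holes. -/
def chargeSum (f : ℤ → ℝ) (S : Maya) : ℝ := ∑' n, f n * occNum S n

lemma chargeSum_eq_sum (f : ℤ → ℝ) {S : Maya} {A : Finset ℤ} (hA : excited S ⊆ A) :
    chargeSum f S = ∑ n ∈ A, f n * occNum S n :=
  tsum_eq_sum fun n hn => by rw [occNum_eq_zero fun h => hn (hA h), mul_zero]

lemma chargeSum_fill (f : ℤ → ℝ) {S : Maya} {a : ℤ} (ha : a ∉ S.occ) :
    chargeSum f (S.fill a) = chargeSum f S + f a := by
  have h1 : excited (S.fill a) ⊆ insert a (excited S ∪ excited (S.fill a)) := fun x hx => by simp [hx]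
  have h2 : excited S ⊆ insert a (excited S ∪ excited (S.fill a)) := fun x hx => by simp [hx]
  rw [chargeSum_eq_sum f h1, chargeSum_eq_sum f h2, ← sub_eq_iff_eq_add', ← Finset.sum_sub_distrib,
    Finset.sum_eq_single a]
  · simp only [occNum, Maya.mem_fill, ha, true_or, if_true, if_false]
    ring
  · intro b _ hb
    simp [occNum, Maya.mem_fill, hb]
  · intro h
    exact absurd (Finset.mem_insert_self _ _) h

lemma chargeSum_empty (f : ℤ → ℝ) {S : Maya} {a : ℤ} (ha : a ∈ S.occ) :
    chargeSum f (S.empty a) = chargeSum f S - f a := by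
  have h : a ∉ (S.empty a).occ := fun h => h.2 rfl
  have := chargeSum_fill f h
  rw [Maya.fill_empty ha] at this
  rw [this]
  ring

/-- The energy of a state, the eigenvalue of `L_0`, as a natural number. -/
def energy (S : Maya) : ℕ := ∑ n ∈ excited S, n.natAbs

lemma energy_eq_chargeSum (S : Maya) : (energy S : ℝ) = chargeSum (fun n => (n : ℝ)) S := by
  rw [chargeSum_eq_sum _ subset_rfl, energy, Nat.cast_sum]
  refine Finset.sum_congr rfl fun n hn => ?_
  rw [mem_excited] at hn
  unfold occNum
  rw [Nat.cast_natAbs, Int.cast_abs]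
  rcases lt_or_ge 0 n with h | h
  · have h' : (0 : ℝ) < n := by exact_mod_cast h
    rw [if_pos (hn.2 h), if_neg (not_le.2 h), abs_of_pos h']
    ring
  · have h' : (n : ℝ) ≤ 0 := by exact_mod_cast h
    rw [if_neg (fun h' => not_lt.2 h (hn.1 h')), if_pos h, abs_of_nonpos h']
    ring

lemma energy_fill {S : Maya} {a : ℤ} (ha : a ∉ S.occ) : (energy (S.fill a) : ℤ) = energy S + a := by
  have : (energy (S.fill a) : ℝ) = energy S + a := by
    rw [energy_eq_chargeSum, energy_eq_chargeSum, chargeSum_fill _ ha]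
  exact_mod_cast this

lemma energy_empty {S : Maya} {a : ℤ} (ha : a ∈ S.occ) :
    (energy (S.empty a) : ℤ) = energy S - a := by
  have : (energy (S.empty a) : ℝ) = energy S - a := by
    rw [energy_eq_chargeSum, energy_eq_chargeSum, chargeSum_empty _ ha]
  exact_mod_cast this

lemma excited_injective : Function.Injective excited := by
  intro S T h
  ext n
  have h1 := @mem_excited S n
  have h2 := @mem_excited T n
  rw [h] at h1
  tauto

lemma finite_energy_le (e : ℕ) : {S : Maya | energy S ≤ e}.Finite := by
  refine Set.Finite.of_finite_image (f := excited) ?_ excited_injective.injOn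
  refine ((Finset.Icc (-(e : ℤ)) e).powerset.finite_toSet).subset ?_
  rintro _ ⟨S, hS, rfl⟩
  simp only [Finset.coe_powerset, Set.mem_preimage, Set.mem_powerset_iff, Finset.coe_subset]
  intro n hn
  have h1 : n.natAbs ≤ energy S := Finset.single_le_sum (f := Int.natAbs) (fun _ _ => Nat.zero_le _) hn
  have h2 : n.natAbs ≤ e := h1.trans hS
  rw [Finset.mem_Icc]
  omega

/-- The finite set of the states of energy at most `e`. -/
def lowStates (e : ℕ) : Finset Maya := (finite_energy_le e).toFinset

lemma mem_lowStates {e : ℕ} {S : Maya} : S ∈ lowStates e ↔ energy S ≤ e := by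
  simp [lowStates]

/-! ### The inner product of the Fock space -/

/-- The basis vector of the Fock space labelled by `S`. -/
abbrev ket (S : Maya) : Fock := Finsupp.single S 1

/-- The inner product of the Fock space, for which the basis states are orthonormal. -/
def ip : Fock →ₗ[ℝ] Fock →ₗ[ℝ] ℝ :=
  Finsupp.linearCombination ℝ fun S : Maya => (Finsupp.lapply S : Fock →ₗ[ℝ] ℝ)

lemma ip_ket_left (S : Maya) (w : Fock) : ip (ket S) w = w S := by
  simp [ip, ket]

lemma ip_comm (v w : Fock) : ip v w = ip w v := by
  suffices h : ip = ip.flip from congrArg (fun B => B v w) h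
  ext S T
  simp [ip, Finsupp.single_apply, eq_comm]

lemma ip_ket_right (v : Fock) (S : Maya) : ip v (ket S) = v S := by
  rw [ip_comm, ip_ket_left]

lemma matEl_eq_ip (A : Fock →ₗ[ℝ] Fock) (S T : Maya) : matEl A S T = ip (ket S) (A (ket T)) := by
  rw [ip_ket_left]; rfl

lemma linearMap_eq_of_matEl {A B : Fock →ₗ[ℝ] Fock} (h : ∀ S T, matEl A S T = matEl B S T) :
    A = B := by
  refine Finsupp.lhom_ext' fun T => LinearMap.ext_ring ?_
  ext S
  exact h S T

/-- Operators with transposed matrices are adjoint to each other. -/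
lemma ip_adjoint {A B : Fock →ₗ[ℝ] Fock} (h : ∀ S T, matEl A S T = matEl B T S) (v w : Fock) :
    ip v (A w) = ip (B v) w := by
  suffices h : ip.compl₂ A = ip ∘ₗ B from congrArg (fun F => F v w) h
  ext S T
  have h1 := ip_ket_left S (A (ket T))
  have h2 := ip_ket_right (B (ket S)) T
  simp only [LinearMap.comp_apply, Finsupp.lsingle_apply, LinearMap.compl₂_apply]
  rw [h1, h2]
  exact h S T

lemma matEl_psi_psiStar (a b : ℤ) (S T : Maya) :
    matEl (psi a ∘ₗ psiStar b) S T = matEl (psi (-b) ∘ₗ psiStar (-a)) T S := by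
  rw [matEl_eq_ip, matEl_eq_ip, LinearMap.comp_apply, LinearMap.comp_apply,
    ip_adjoint (matEl_psi a), ip_adjoint (A := psiStar b) (B := psi (-b)) (fun S T => by
      rw [matEl_psi, neg_neg]), ip_comm]

/-- The diagonal operator with eigenvalues `f S`. -/
def diag (f : Maya → ℝ) : Module.End ℝ Fock :=
  Finsupp.linearCombination ℝ fun S : Maya => Finsupp.single S (f S)

lemma diag_single (f : Maya → ℝ) (S : Maya) (r : ℝ) :
    diag f (Finsupp.single S r) = f S • Finsupp.single S r := by
  simp [diag, mul_comm]

lemma diag_apply (f : Maya → ℝ) (v : Fock) (S : Maya) : diag f v S = f S * v S := by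
  induction v using Finsupp.induction_linear with
  | zero => simp
  | add v w hv hw => simp [hv, hw, mul_add]
  | single T r =>
    rw [diag_single, Finsupp.smul_apply, smul_eq_mul, Finsupp.single_apply]
    split_ifs with h
    · rw [h]
    · simp

/-! ### One-body operators -/

lemma psiStar_anticomm (a b : ℤ) (v : Fock) :
    psiStar a (psiStar b v) = -psiStar b (psiStar a v) := by
  have adj : ∀ (c : ℤ) (S T : Maya), matEl (psiStar c) S T = matEl (psi (-c)) T S := fun c S T => by
    rw [matEl_psi, neg_neg]
  suffices h : psiStar a ∘ₗ psiStar b = -(psiStar b ∘ₗ psiStar a) from LinearMap.congr_fun h v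
  refine linearMap_eq_of_matEl fun S T => ?_
  rw [matEl_eq_ip, matEl_eq_ip, LinearMap.neg_apply, map_neg, LinearMap.comp_apply,
    LinearMap.comp_apply, ip_adjoint (adj a), ip_adjoint (adj b), ip_adjoint (adj b),
    ip_adjoint (adj a), psi_anticomm, map_neg, LinearMap.neg_apply]

/-- The occupied levels of `T` from which a particle can be moved down by `m` levels. -/
def hops (m : ℤ) (T : Maya) : Finset ℤ :=
  {n ∈ excited T ∪ (excited T).image (· + m) ∪ Finset.Ioc m 0 | n ∈ T.occ ∧ n - m ∉ T.occ}

lemma mem_hops {m n : ℤ} {T : Maya} : n ∈ hops m T ↔ n ∈ T.occ ∧ n - m ∉ T.occ := by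
  simp only [hops, Finset.mem_filter, Finset.mem_union, Finset.mem_image, Finset.mem_Ioc,
    and_iff_right_iff_imp]
  rintro ⟨h1, h2⟩
  by_cases h3 : n ∈ excited T
  · exact Or.inl (Or.inl h3)
  by_cases h4 : n - m ∈ excited T
  · exact Or.inl (Or.inr ⟨n - m, h4, by ring⟩)
  rw [mem_excited] at h3 h4
  right
  constructor
  · by_contra h
    exact h4 (by simp [h2]; omega)
  · by_contra h
    exact h3 (by simp [h1]; omega)

lemma psi_psiStar_ket_eq_zero {m n : ℤ} {T : Maya} (hm : m ≠ 0) (h : n ∉ hops m T) :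
    psi (m - n) (psiStar n (ket T)) = 0 := by
  rw [mem_hops] at h
  rw [psiStar_single]
  split_ifs with h1
  · have h2 : n - m ∈ T.occ := by
      by_contra h2
      exact h ⟨h1, h2⟩
    rw [psi_single, if_pos]
    rw [neg_sub, Maya.mem_empty]
    exact ⟨h2, by omega⟩
  · simp

lemma psi_psiStar_ket {m n : ℤ} {T : Maya} (h : n ∈ hops m T) :
    psi (m - n) (psiStar n (ket T)) = Finsupp.single ((T.empty n).fill (n - m))
      (T.sign n * (T.empty n).sign (n - m)) := by
  rw [mem_hops] at h
  rw [psiStar_single, if_pos h.1, psi_single, if_neg, neg_sub, one_mul]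
  rw [neg_sub]
  exact fun h' => h.2 h'.1

lemma psi_psiStar_ket_self (n : ℤ) (T : Maya) :
    psi (-n) (psiStar n (ket T)) = (if n ∈ T.occ then (1 : ℝ) else 0) • ket T := by
  rw [psiStar_single]
  split_ifs with h
  · rw [psi_single, neg_neg, if_neg fun h => h.2 rfl, Maya.fill_empty h, Maya.sign_empty h,
      if_neg (lt_irrefl _), one_mul, Maya.sign_mul_self, one_smul]
  · simp

/-- The second quantisation `∑ n, u ^ n ψ_{m-n} ψ*_n` of the one-particle operator which sends the
level `n` to `u ^ n` times the level `n - m`.  For `m = 0` the divergent part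
`∑_{n ≤ 0} u ^ n` is replaced by the value `u / (u - 1)` of the geometric series.  With this choice
the commutators with the currents have no central terms, see `cur_oneBody`. -/
def oneBody (u : ℝ) (m : ℤ) : Module.End ℝ Fock :=
  if m = 0 then diag fun T => chargeSum (fun n => u ^ n) T + u / (u - 1)
  else Finsupp.linearCombination ℝ fun T : Maya =>
    ∑ n ∈ hops m T, u ^ n • psi (m - n) (psiStar n (ket T))

/-- The current `J_k`, `k ≠ 0`, as a linear map of the Fock space. -/
abbrev cur (k : ℤ) : Module.End ℝ Fock := oneBody 1 k

lemma oneBody_ket {u : ℝ} {m : ℤ} (hm : m ≠ 0) (T : Maya) :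
    oneBody u m (ket T) = ∑ n ∈ hops m T, u ^ n • psi (m - n) (psiStar n (ket T)) := by
  rw [oneBody, if_neg hm, Finsupp.linearCombination_single, one_smul]

lemma oneBody_zero_ket (u : ℝ) (T : Maya) :
    oneBody u 0 (ket T) = (chargeSum (fun n => u ^ n) T + u / (u - 1)) • ket T := by
  rw [oneBody, if_pos rfl, diag_single]

lemma sum_Icc_neg_zero (u : ℝ) (hu : u ≠ 0) (hu1 : u ≠ 1) (N : ℕ) :
    ∑ n ∈ Finset.Icc (-(N : ℤ)) N, u ^ n * (if n ≤ 0 then (1 : ℝ) else 0) =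
      (u - u ^ (-(N : ℤ))) / (u - 1) := by
  have h1 : u - 1 ≠ 0 := sub_ne_zero.2 hu1
  have key : ∀ N : ℕ, ∑ n ∈ Finset.Icc (-(N : ℤ)) 0, u ^ n = (u - u ^ (-(N : ℤ))) / (u - 1) := by
    intro N
    induction N with
    | zero => simp [h1]
    | succ N ih =>
      have : Finset.Icc (-((N + 1 : ℕ) : ℤ)) 0 = insert (-((N + 1 : ℕ) : ℤ)) (Finset.Icc (-(N : ℤ)) 0) := by
        ext x
        simp only [Finset.mem_Icc, Finset.mem_insert]
        push_cast
        omega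
      rw [this, Finset.sum_insert (by simp), ih]
      have h2 : u ^ (-(N : ℤ)) = u ^ (-((N + 1 : ℕ) : ℤ)) * u := by
        rw [← zpow_add_one₀ hu]
        congr 1
        push_cast
        ring
      rw [h2]
      field_simp
      ring
  rw [← key]
  simp only [mul_ite, mul_one, mul_zero]
  rw [← Finset.sum_filter]
  refine Finset.sum_congr ?_ fun _ _ => rfl
  ext x
  simp only [Finset.mem_Icc, Finset.mem_filter]
  omega

open Filter in
lemma eventually_subset_Icc (A : Finset ℤ) : ∀ᶠ N : ℕ in atTop, A ⊆ Finset.Icc (-(N : ℤ)) N := by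
  rw [eventually_atTop]
  refine ⟨A.sup Int.natAbs, fun N hN n hn => ?_⟩
  have := (Finset.le_sup (f := Int.natAbs) hn).trans hN
  rw [Finset.mem_Icc]
  omega

open Filter in
/-- On every vector, a one-body operator is given by a finite sum; for `m = 0` the scalar
`u ^ (-N) / (u - 1)` is the regularised sum of `u ^ n` over the levels `n < -N`. -/
lemma oneBody_eventually {u : ℝ} {m : ℤ} (hu : u ≠ 0) (h : m ≠ 0 ∨ u ≠ 1) (v : Fock) :
    ∀ᶠ N : ℕ in atTop, oneBody u m v =
      ∑ n ∈ Finset.Icc (-(N : ℤ)) N, u ^ n • psi (m - n) (psiStar n v) +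
        (if m = 0 then u ^ (-(N : ℤ)) / (u - 1) else 0) • v := by
  induction v using Finsupp.induction_linear with
  | zero => simp
  | add v w hv hw =>
    filter_upwards [hv, hw] with N h1 h2
    simp only [map_add, smul_add, Finset.sum_add_distrib, h1, h2]
    abel
  | single T r =>
    have hT : (Finsupp.single T r : Fock) = r • ket T := by simp
    suffices h : ∀ᶠ N : ℕ in atTop, oneBody u m (ket T) =
        ∑ n ∈ Finset.Icc (-(N : ℤ)) N, u ^ n • psi (m - n) (psiStar n (ket T)) +
          (if m = 0 then u ^ (-(N : ℤ)) / (u - 1) else 0) • ket T by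
      filter_upwards [h] with N h1
      rw [hT]
      simp only [map_smul]
      rw [h1, smul_add, Finset.smul_sum, smul_comm r (ite _ _ _)]
      congr 1
      exact Finset.sum_congr rfl fun n _ => smul_comm _ _ _
    by_cases hm : m = 0
    · subst hm
      have hu1 : u ≠ 1 := h.resolve_left (by simp)
      have h1 : u - 1 ≠ 0 := sub_ne_zero.2 hu1
      filter_upwards [eventually_subset_Icc (excited T)] with N hN
      rw [oneBody_zero_ket, chargeSum_eq_sum _ hN, if_pos rfl]
      simp only [zero_sub, psi_psiStar_ket_self, smul_smul]
      rw [← Finset.sum_smul, ← add_smul]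
      congr 1
      simp only [occNum, mul_sub, Finset.sum_sub_distrib]
      rw [sum_Icc_neg_zero u hu hu1]
      field_simp
      ring
    · filter_upwards [eventually_subset_Icc (hops m T)] with N hN
      rw [oneBody_ket hm, if_neg hm, zero_smul, add_zero]
      exact Finset.sum_subset hN fun n _ hn => by rw [psi_psiStar_ket_eq_zero hm hn, smul_zero]

lemma cur_psi {k : ℤ} (hk : k ≠ 0) (a : ℤ) (v : Fock) :
    cur k (psi a v) = psi a (cur k v) + psi (a + k) v := by
  obtain ⟨N, h1, h2, h3⟩ := ((oneBody_eventually one_ne_zero (.inl hk) (psi a v)).and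
    ((oneBody_eventually one_ne_zero (.inl hk) v).and (eventually_subset_Icc {-a}))).exists
  rw [h1, h2]
  simp only [one_zpow, one_smul, if_neg hk, zero_smul, add_zero, map_sum]
  rw [← sub_eq_iff_eq_add', ← Finset.sum_sub_distrib, Finset.sum_eq_single (-a)]
  · rw [psiStar_psi, if_pos rfl, map_sub, psi_anticomm _ a, sub_neg_eq_add, add_sub_cancel_right]
    congr 2
    ring
  · intro n _ hn
    rw [psiStar_psi, if_neg hn, map_sub, psi_anticomm _ a, map_zero, zero_sub, neg_neg, sub_self]
  · intro h
    exact absurd (h3 (Finset.mem_singleton_self _)) h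

lemma cur_psiStar {k : ℤ} (hk : k ≠ 0) (a : ℤ) (v : Fock) :
    cur k (psiStar a v) = psiStar a (cur k v) - psiStar (a + k) v := by
  obtain ⟨N, h1, h2, h3⟩ := ((oneBody_eventually one_ne_zero (.inl hk) (psiStar a v)).and
    ((oneBody_eventually one_ne_zero (.inl hk) v).and (eventually_subset_Icc {a + k}))).exists
  rw [h1, h2, eq_sub_iff_add_eq', ← eq_sub_iff_add_eq]
  simp only [one_zpow, one_smul, if_neg hk, zero_smul, add_zero, map_sum]
  rw [← Finset.sum_sub_distrib, Finset.sum_eq_single (a + k)]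
  · rw [psiStar_psi, if_pos (by ring), psiStar_anticomm _ a, map_neg]
    abel
  · intro n _ hn
    rw [psiStar_psi, if_neg (by omega), psiStar_anticomm _ a, map_neg]
    abel
  · intro h
    exact absurd (h3 (Finset.mem_singleton_self _)) h

open Filter in
lemma psiStar_eventually_atTop (v : Fock) : ∀ᶠ n : ℤ in atTop, psiStar n v = 0 := by
  induction v using Finsupp.induction_linear with
  | zero => simp
  | add v w hv hw =>
    filter_upwards [hv, hw] with N h1 h2
    rw [map_add, h1, h2, add_zero]
  | single T r =>
    obtain ⟨N, hN⟩ := (eventually_subset_Icc (excited T)).exists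
    filter_upwards [eventually_gt_atTop (N : ℤ)] with n hn
    rw [psiStar_single, if_neg]
    intro h
    have := hN (mem_excited.2 (iff_of_true h (by omega)))
    rw [Finset.mem_Icc] at this
    omega

open Filter in
lemma psi_psiStar_eventually_atBot (m : ℤ) (v : Fock) :
    ∀ᶠ n : ℤ in atBot, psi (m - n) (psiStar n v) = if m = 0 then v else 0 := by
  induction v using Finsupp.induction_linear with
  | zero => simp
  | add v w hv hw =>
    filter_upwards [hv, hw] with N h1 h2
    rw [map_add, map_add, h1, h2]
    split_ifs <;> simp
  | single T r =>
    obtain ⟨N, hN⟩ := (eventually_subset_Icc (excited T)).exists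
    have occ : ∀ n : ℤ, n < -N → n ∈ T.occ := by
      intro n hn
      by_contra h
      have := hN (mem_excited.2 (iff_of_false h (by omega)))
      rw [Finset.mem_Icc] at this
      omega
    have hT : (Finsupp.single T r : Fock) = r • ket T := by simp
    filter_upwards [eventually_lt_atBot (-(N : ℤ)), eventually_lt_atBot (-(N : ℤ) + m)] with n h1 h2
    rw [hT, map_smul, map_smul]
    split_ifs with hm
    · rw [hm, zero_sub, psi_psiStar_ket_self, if_pos (occ n h1), one_smul]
    · rw [psi_psiStar_ket_eq_zero hm, smul_zero]
      rw [mem_hops]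
      exact fun h => h.2 (occ _ (by omega))

lemma sum_zpow_Ico {u : ℝ} (hu : u ≠ 0) (hu1 : u ≠ 1) (a : ℤ) (k : ℕ) :
    ∑ n ∈ Finset.Ico a (a + k), u ^ n = (u ^ k - 1) * (u ^ a / (u - 1)) := by
  have h1 : u - 1 ≠ 0 := sub_ne_zero.2 hu1
  induction k with
  | zero => simp
  | succ k ih =>
    have : Finset.Ico a (a + (k + 1 : ℕ)) = insert (a + k) (Finset.Ico a (a + k)) := by
      ext x
      simp only [Finset.mem_Ico, Finset.mem_insert]
      push_cast
      omega
    rw [this, Finset.sum_insert (by simp), ih, zpow_add₀ hu, zpow_natCast]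
    field_simp
    ring

/-- The commutation relation of a positive current with a one-body operator. -/
lemma cur_oneBody {u : ℝ} (hu : u ≠ 0) {k : ℕ} (hk : k ≠ 0) {m : ℤ}
    (h : u ≠ 1 ∨ (m ≠ 0 ∧ m + k ≠ 0)) (v : Fock) :
    cur k (oneBody u m v) = oneBody u m (cur k v) +
      (1 - u ^ (-(k : ℤ))) • oneBody u (m + k) v := by
  have hk' : (k : ℤ) ≠ 0 := by exact_mod_cast hk
  have hm1 : m ≠ 0 ∨ u ≠ 1 := by tauto
  have hm2 : m + k ≠ 0 ∨ u ≠ 1 := by tauto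
  obtain ⟨b, hb⟩ := Filter.eventually_atBot.1 (psi_psiStar_eventually_atBot (m + k) v)
  obtain ⟨B, hB⟩ := Filter.eventually_atTop.1 (psiStar_eventually_atTop v)
  obtain ⟨N, ⟨h1, h2⟩, h3, h5⟩ := (((oneBody_eventually hu hm1 v).and
    (oneBody_eventually hu hm1 (cur k v))).and ((oneBody_eventually hu hm2 v).and
    (eventually_subset_Icc {b - k, B}))).exists
  have h4 := h5 (Finset.mem_insert_of_mem (Finset.mem_singleton_self _))
  have h5' := h5 (Finset.mem_insert_self _ _)
  rw [Finset.mem_Icc] at h4 h5'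
  rw [h1, h2, h3]
  set F : ℤ → Fock := fun n => u ^ n • psi (m + k - n) (psiStar n v) with hF
  have e1 : cur k (∑ n ∈ Finset.Icc (-(N : ℤ)) N, u ^ n • psi (m - n) (psiStar n v)) =
      ∑ n ∈ Finset.Icc (-(N : ℤ)) N, u ^ n • psi (m - n) (psiStar n (cur k v)) +
      (∑ n ∈ Finset.Icc (-(N : ℤ)) N, F n -
        u ^ (-(k : ℤ)) • ∑ n ∈ Finset.Icc (-(N : ℤ)) N, F (n + k)) := by
    rw [map_sum, Finset.smul_sum, ← Finset.sum_sub_distrib, ← Finset.sum_add_distrib]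
    refine Finset.sum_congr rfl fun n _ => ?_
    rw [map_smul, cur_psi hk', cur_psiStar hk', map_sub, hF]
    simp only [smul_smul]
    rw [← zpow_add₀ hu, show m - n + (k : ℤ) = m + k - n by ring,
      show m + k - (n + k) = m - n by ring, show -(k : ℤ) + (n + k) = n by ring,
      smul_add, smul_sub]
    abel
  -- The shifted sum differs only by boundary terms at the bottom, where all levels are occupied.
  have e2 : ∑ n ∈ Finset.Icc (-(N : ℤ)) N, F (n + k) =
      ∑ n ∈ Finset.Icc (-(N : ℤ)) N, F n - ∑ n ∈ Finset.Ico (-(N : ℤ)) (-(N : ℤ) + k), F n := by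
    have s1 : ∑ n ∈ Finset.Icc (-(N : ℤ)) N, F (n + k) =
        ∑ n ∈ Finset.Icc (-(N : ℤ) + k) (N + k), F n := by
      rw [← Finset.image_add_right_Icc, Finset.sum_image]
      intro x _ y _ h
      simpa using h
    have s2 : Finset.Icc (-(N : ℤ)) (N + k) =
        Finset.Ico (-(N : ℤ)) (-(N : ℤ) + k) ∪ Finset.Icc (-(N : ℤ) + k) (N + k) := by
      ext x
      simp only [Finset.mem_Icc, Finset.mem_union, Finset.mem_Ico]
      omega
    have s3 : ∑ n ∈ Finset.Icc (-(N : ℤ)) (N + k), F n = ∑ n ∈ Finset.Icc (-(N : ℤ)) N, F n := by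
      symm
      refine Finset.sum_subset (Finset.Icc_subset_Icc le_rfl (by omega)) fun n hn hn' => ?_
      rw [Finset.mem_Icc] at hn hn'
      rw [hF]
      simp only
      rw [hB n (by omega), map_zero, smul_zero]
    rw [s1, eq_sub_iff_add_eq', ← s3, s2, Finset.sum_union]
    rw [Finset.disjoint_left]
    intro x
    simp only [Finset.mem_Icc, Finset.mem_Ico]
    omega
  -- The boundary terms match the regularisation of `oneBody u 0`.
  have e3 : u ^ (-(k : ℤ)) • ∑ n ∈ Finset.Ico (-(N : ℤ)) (-(N : ℤ) + k), F n =
      ((1 - u ^ (-(k : ℤ))) * (if m + k = 0 then u ^ (-(N : ℤ)) / (u - 1) else 0)) • v := by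
    have s1 : ∀ n ∈ Finset.Ico (-(N : ℤ)) (-(N : ℤ) + k), F n =
        u ^ n • (if m + k = 0 then v else 0) := by
      intro n hn
      rw [Finset.mem_Ico] at hn
      rw [hF]
      simp only
      rw [hb n (by omega)]
    rw [Finset.sum_congr rfl s1, ← Finset.sum_smul, smul_smul]
    split_ifs with hmk
    · have hu1 : u ≠ 1 := by tauto
      rw [sum_zpow_Ico hu hu1]
      congr 1
      rw [zpow_neg, zpow_natCast]
      field_simp
    · simp
  rw [map_add, map_smul, e1, e2, smul_sub, e3, smul_add, smul_smul, sub_smul 1, one_smul]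
  abel

/-! ### Matrix elements of one-body operators -/

lemma matEl_oneBody {u : ℝ} {m : ℤ} (hm : m ≠ 0) (S T : Maya) :
    matEl (oneBody u m) S T = ∑' n : ℤ, u ^ n * matEl (psi (m - n) ∘ₗ psiStar n) S T := by
  rw [matEl, oneBody_ket hm, tsum_eq_sum (s := hops m T), Finsupp.finsetSum_apply]
  · rfl
  · intro n hn
    rw [matEl, LinearMap.comp_apply, psi_psiStar_ket_eq_zero hm hn]
    simp

lemma matEl_oneBody_transpose {u : ℝ} (hu : u ≠ 0) (m : ℤ) (S T : Maya) :
    matEl (oneBody u m) S T = u ^ m * matEl (oneBody u (-m)) T S := by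
  by_cases hm : m = 0
  · subst hm
    rw [neg_zero, zpow_zero, one_mul, matEl, matEl, oneBody_zero_ket, oneBody_zero_ket,
      Finsupp.smul_apply, Finsupp.smul_apply, Finsupp.single_apply, Finsupp.single_apply]
    by_cases h : T = S
    · rw [h]
    · rw [if_neg h, if_neg (Ne.symm h)]
      simp
  · rw [matEl_oneBody hm, matEl_oneBody (neg_ne_zero.2 hm), ← tsum_mul_left,
      ← (Equiv.subRight m).tsum_eq (fun n => u ^ m * (u ^ n * _))]
    refine tsum_congr fun n => ?_
    rw [Equiv.subRight_apply, matEl_psi_psiStar, ← mul_assoc, ← zpow_add₀ hu,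
      add_sub_cancel, show -(n : ℤ) = -m - (n - m) by ring, show -(m - n) = n - m by ring]

lemma matEl_oneBody_ne_zero {u : ℝ} {m : ℤ} (hm : m ≠ 0) {S T : Maya}
    (h : matEl (oneBody u m) S T ≠ 0) :
    ∃ n : ℤ, n ∈ T.occ ∧ n - m ∉ T.occ ∧ S = (T.empty n).fill (n - m) := by
  rw [matEl, oneBody_ket hm, Finsupp.finsetSum_apply] at h
  obtain ⟨n, hn, h'⟩ := Finset.exists_ne_zero_of_sum_ne_zero h
  refine ⟨n, (mem_hops.1 hn).1, (mem_hops.1 hn).2, ?_⟩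
  rw [psi_psiStar_ket hn, Finsupp.smul_apply, Finsupp.single_apply] at h'
  by_contra hne
  rw [if_neg (Ne.symm hne)] at h'
  simp at h'

lemma chargeSum_hop (f : ℤ → ℝ) {T : Maya} {n m : ℤ} (h1 : n ∈ T.occ) (h2 : n - m ∉ T.occ) :
    chargeSum f ((T.empty n).fill (n - m)) = chargeSum f T - f n + f (n - m) := by
  rw [chargeSum_fill _ (fun h => h2 (Maya.mem_empty.1 h).1), chargeSum_empty _ h1]

lemma energy_of_matEl_oneBody {u : ℝ} {m : ℤ} {S T : Maya} (h : matEl (oneBody u m) S T ≠ 0) :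
    (energy S : ℤ) = energy T - m := by
  by_cases hm : m = 0
  · subst hm
    rw [matEl, oneBody_zero_ket, Finsupp.smul_apply, Finsupp.single_apply] at h
    by_cases hST : T = S
    · rw [hST, sub_zero]
    · rw [if_neg hST] at h
      simp at h
  · obtain ⟨n, h1, h2, rfl⟩ := matEl_oneBody_ne_zero hm h
    rw [energy_fill (fun h => h2 (Maya.mem_empty.1 h).1), energy_empty h1]
    ring

/-! ### Vertex operators -/

/-- The span of the states of energy at most `N`. -/
def lowSpace (N : ℕ) : Submodule ℝ Fock := Finsupp.supported ℝ ℝ {S | energy S ≤ N}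

lemma mem_lowSpace {N : ℕ} {v : Fock} : v ∈ lowSpace N ↔ ∀ S, v S ≠ 0 → energy S ≤ N := by
  rw [lowSpace, Finsupp.mem_supported]
  constructor
  · intro h S hS
    exact h (Finsupp.mem_support_iff.2 hS)
  · intro h S hS
    exact h S (Finsupp.mem_support_iff.1 hS)

lemma ket_mem_lowSpace {N : ℕ} {T : Maya} (h : energy T ≤ N) : ket T ∈ lowSpace N :=
  Finsupp.single_mem_supported _ _ h

lemma lowSpace_mono {M N : ℕ} (h : M ≤ N) : lowSpace M ≤ lowSpace N :=
  Finsupp.supported_mono fun _ hS => le_trans hS h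

lemma exists_mem_lowSpace (v : Fock) : ∃ N, v ∈ lowSpace N :=
  ⟨v.support.sup energy, mem_lowSpace.2 fun _ hS =>
    Finset.le_sup (f := energy) (Finsupp.mem_support_iff.2 hS)⟩

/-- Linear maps are determined on `lowSpace N` by the states of energy at most `N`. -/
lemma eqOn_lowSpace {M : Type*} [AddCommGroup M] [Module ℝ M] {A B : Fock →ₗ[ℝ] M} {N : ℕ}
    (h : ∀ T, energy T ≤ N → A (ket T) = B (ket T)) {v : Fock} (hv : v ∈ lowSpace N) :
    A v = B v := by
  rw [lowSpace, Finsupp.supported_eq_span_single] at hv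
  refine LinearMap.eqOn_span (f := A) (g := B) ?_ hv
  rintro _ ⟨T, hT, rfl⟩
  exact h T hT

lemma map_apply_eq_sum (A : Fock →ₗ[ℝ] Fock) (v : Fock) (S : Maya) {s : Finset Maya}
    (hs : ∀ T, v T ≠ 0 → T ∈ s) : A v S = ∑ T ∈ s, v T * matEl A S T := by
  have h1 : v = ∑ T ∈ s, v T • ket T := by
    conv_lhs => rw [← Finsupp.sum_single v]
    rw [Finsupp.sum, Finset.sum_subset (s₂ := s)]
    · exact Finset.sum_congr rfl fun T _ => by simp
    · intro T hT
      exact hs T (Finsupp.mem_support_iff.1 hT)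
    · intro T _ hT
      rw [Finsupp.notMem_support_iff.1 hT, Finsupp.single_zero]
  conv_lhs => rw [h1]
  rw [map_sum, Finsupp.finsetSum_apply]
  refine Finset.sum_congr rfl fun T _ => ?_
  rw [map_smul, Finsupp.smul_apply, smul_eq_mul, matEl]

lemma exists_of_map_apply_ne_zero {A : Fock →ₗ[ℝ] Fock} {v : Fock} {S : Maya} (h : A v S ≠ 0) :
    ∃ T, v T ≠ 0 ∧ matEl A S T ≠ 0 := by
  rw [map_apply_eq_sum A v S (s := v.support) fun T hT => Finsupp.mem_support_iff.2 hT] at h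
  obtain ⟨T, -, hT⟩ := Finset.exists_ne_zero_of_sum_ne_zero h
  exact ⟨T, left_ne_zero_of_mul hT, right_ne_zero_of_mul hT⟩

lemma oneBody_mem_lowSpace {u : ℝ} {m : ℤ} {M N : ℕ} {v : Fock} (hv : v ∈ lowSpace N)
    (h : (N : ℤ) - m ≤ M) : oneBody u m v ∈ lowSpace M := by
  rw [mem_lowSpace]
  intro S hS
  obtain ⟨T, hT, hST⟩ := exists_of_map_apply_ne_zero hS
  have h1 := mem_lowSpace.1 hv T hT
  have h2 := energy_of_matEl_oneBody hST
  omega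

lemma oneBody_eq_zero {u : ℝ} {m : ℤ} {N : ℕ} {v : Fock} (hv : v ∈ lowSpace N)
    (h : (N : ℤ) < m) : oneBody u m v = 0 := by
  ext S
  by_contra hS
  obtain ⟨T, hT, hST⟩ := exists_of_map_apply_ne_zero hS
  have h1 := mem_lowSpace.1 hv T hT
  have h2 := energy_of_matEl_oneBody hST
  omega

/-- The operator `∑_{k ≥ 1} c_k J_k`, a finite sum on each state. -/
def lowerSum (c : ℕ → ℝ) : Module.End ℝ Fock :=
  Finsupp.linearCombination ℝ fun T : Maya =>
    ∑ k ∈ Finset.Icc 1 (energy T), c k • cur (k : ℤ) (ket T)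

lemma lowerSum_apply (c : ℕ → ℝ) {N : ℕ} {v : Fock} (hv : v ∈ lowSpace N) :
    lowerSum c v = ∑ k ∈ Finset.Icc 1 N, c k • cur (k : ℤ) v := by
  suffices h : lowerSum c v = (∑ k ∈ Finset.Icc 1 N, c k • cur (k : ℤ)) v by
    rw [h, LinearMap.sum_apply]
    rfl
  refine eqOn_lowSpace (fun T hT => ?_) hv
  rw [lowerSum, Finsupp.linearCombination_single, one_smul, LinearMap.sum_apply]
  refine Finset.sum_subset (Finset.Icc_subset_Icc le_rfl hT) fun k hk hk' => ?_
  rw [Finset.mem_Icc] at hk hk'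
  rw [oneBody_eq_zero (ket_mem_lowSpace le_rfl) (by omega), smul_zero]

lemma lowerSum_mem_lowSpace (c : ℕ → ℝ) {M N : ℕ} {v : Fock} (hv : v ∈ lowSpace N)
    (h : N ≤ M + 1) : lowerSum c v ∈ lowSpace M := by
  rw [lowerSum_apply c hv]
  refine Submodule.sum_mem _ fun k hk => Submodule.smul_mem _ _ (oneBody_mem_lowSpace hv ?_)
  rw [Finset.mem_Icc] at hk
  omega

lemma lowerSum_eq_zero (c : ℕ → ℝ) {v : Fock} (hv : v ∈ lowSpace 0) : lowerSum c v = 0 := by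
  rw [lowerSum_apply c hv]
  simp

lemma lowerSum_pow_mem_lowSpace (c : ℕ → ℝ) (n : ℕ) {N : ℕ} {v : Fock} (hv : v ∈ lowSpace N) :
    (lowerSum c ^ n) v ∈ lowSpace (N - n) := by
  induction n with
  | zero => simpa using hv
  | succ n ih =>
    rw [pow_succ', Module.End.mul_apply]
    exact lowerSum_mem_lowSpace c ih (by omega)

lemma lowerSum_pow_eq_zero (c : ℕ → ℝ) {n N : ℕ} {v : Fock} (hv : v ∈ lowSpace N) (h : N < n) :
    (lowerSum c ^ n) v = 0 := by
  obtain ⟨m, rfl⟩ : ∃ m, n = m + 1 := ⟨n - 1, by omega⟩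
  have h1 := lowerSum_pow_mem_lowSpace c m hv
  rw [show N - m = 0 by omega] at h1
  rw [pow_succ', Module.End.mul_apply, lowerSum_eq_zero c h1]

/-- The vertex operator `exp (∑_{k ≥ 1} c_k J_k)`, a finite sum on each state. -/
def vertexOp (c : ℕ → ℝ) : Module.End ℝ Fock :=
  Finsupp.linearCombination ℝ fun T : Maya =>
    ∑ n ∈ Finset.range (energy T + 1), (n.factorial : ℝ)⁻¹ • (lowerSum c ^ n) (ket T)

lemma vertexOp_apply (c : ℕ → ℝ) {N : ℕ} {v : Fock} (hv : v ∈ lowSpace N) :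
    vertexOp c v = ∑ n ∈ Finset.range (N + 1), (n.factorial : ℝ)⁻¹ • (lowerSum c ^ n) v := by
  suffices h : vertexOp c v =
      (∑ n ∈ Finset.range (N + 1), (n.factorial : ℝ)⁻¹ • (lowerSum c ^ n)) v by
    rw [h, LinearMap.sum_apply]
    rfl
  refine eqOn_lowSpace (fun T hT => ?_) hv
  rw [vertexOp, Finsupp.linearCombination_single, one_smul, LinearMap.sum_apply]
  refine Finset.sum_subset (Finset.range_mono (by omega)) fun n _ hn' => ?_
  rw [Finset.mem_range] at hn'
  rw [lowerSum_pow_eq_zero c (ket_mem_lowSpace le_rfl) (by omega), smul_zero]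

lemma vertexOp_mem_lowSpace (c : ℕ → ℝ) {N : ℕ} {v : Fock} (hv : v ∈ lowSpace N) :
    vertexOp c v ∈ lowSpace N := by
  rw [vertexOp_apply c hv]
  exact Submodule.sum_mem _ fun n _ => Submodule.smul_mem _ _
    (lowSpace_mono (Nat.sub_le _ _) (lowerSum_pow_mem_lowSpace c n hv))

/-- A vertex operator is the identity plus an operator which lowers the energy. -/
lemma vertexOp_apply_top (c : ℕ → ℝ) {N : ℕ} {v : Fock} (hv : v ∈ lowSpace N) {S : Maya}
    (hS : N ≤ energy S) : vertexOp c v S = v S := by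
  rw [vertexOp_apply c hv, Finsupp.finsetSum_apply, Finset.sum_eq_single 0]
  · simp
  · intro n hn hn0
    rw [Finset.mem_range] at hn
    rw [Finsupp.smul_apply, smul_eq_zero]
    right
    by_contra h
    have := mem_lowSpace.1 (lowerSum_pow_mem_lowSpace c n hv) S h
    rcases Nat.eq_zero_or_pos N with h0 | h0
    · exact h (by rw [lowerSum_pow_eq_zero c hv (by omega)]; rfl)
    · omega
  · simp

lemma matEl_vertexOp_ne_zero {c : ℕ → ℝ} {S T : Maya} (h : matEl (vertexOp c) S T ≠ 0) :
    energy S ≤ energy T :=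
  mem_lowSpace.1 (vertexOp_mem_lowSpace c (ket_mem_lowSpace le_rfl)) S h

lemma matEl_vertexOp_self (c : ℕ → ℝ) (S : Maya) : matEl (vertexOp c) S S = 1 := by
  rw [matEl, vertexOp_apply_top c (ket_mem_lowSpace le_rfl) le_rfl]
  simp

/-- The energy operator `L_0`. -/
def energyOp : Module.End ℝ Fock := diag fun S => (energy S : ℝ)

lemma energyOp_oneBody (u : ℝ) (m : ℤ) (v : Fock) :
    energyOp (oneBody u m v) = oneBody u m (energyOp v) - (m : ℝ) • oneBody u m v := by
  suffices h : energyOp * oneBody u m = oneBody u m * energyOp - (m : ℝ) • oneBody u m from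
    LinearMap.congr_fun h v
  refine linearMap_eq_of_matEl fun S T => ?_
  simp only [matEl, Module.End.mul_apply, LinearMap.sub_apply, energyOp, diag_single, map_smul,
    diag_apply, LinearMap.smul_apply, Finsupp.sub_apply, Finsupp.smul_apply, smul_eq_mul]
  by_cases h : oneBody u m (ket T) S = 0
  · rw [h]; ring
  · have h1 := energy_of_matEl_oneBody h
    have h2 : (energy S : ℝ) = energy T - m := by exact_mod_cast h1
    rw [h2]; ring

lemma energyOp_mem_lowSpace {N : ℕ} {v : Fock} (hv : v ∈ lowSpace N) :
    energyOp v ∈ lowSpace N := by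
  rw [mem_lowSpace] at hv ⊢
  intro S hS
  rw [energyOp, diag_apply] at hS
  exact hv S (right_ne_zero_of_mul hS)

/-- The coefficients of `z d/dz ∑ c_k z^k`. -/
def eulerCoeff (c : ℕ → ℝ) (k : ℕ) : ℝ := k * c k

lemma energyOp_lowerSum (c : ℕ → ℝ) (v : Fock) :
    energyOp (lowerSum c v) = lowerSum c (energyOp v) - lowerSum (eulerCoeff c) v := by
  obtain ⟨N, hN⟩ := exists_mem_lowSpace v
  rw [lowerSum_apply c hN, lowerSum_apply c (energyOp_mem_lowSpace hN), lowerSum_apply _ hN, map_sum,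
    ← Finset.sum_sub_distrib]
  refine Finset.sum_congr rfl fun k _ => ?_
  rw [map_smul, energyOp_oneBody, smul_sub, smul_smul, eulerCoeff, mul_comm (c k)]
  simp

lemma cur_comm {j k : ℕ} (hj : j ≠ 0) (hk : k ≠ 0) (v : Fock) :
    cur j (cur k v) = cur k (cur j v) := by
  rw [cur_oneBody one_ne_zero hj (Or.inr ⟨by exact_mod_cast hk, by omega⟩)]
  simp

lemma lowerSum_comm (c d : ℕ → ℝ) : Commute (lowerSum c) (lowerSum d) := by
  refine LinearMap.ext fun v => ?_
  obtain ⟨N, hN⟩ := exists_mem_lowSpace v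
  rw [Module.End.mul_apply, Module.End.mul_apply,
    lowerSum_apply c (lowerSum_mem_lowSpace d hN (Nat.le_succ N)),
    lowerSum_apply d (lowerSum_mem_lowSpace c hN (Nat.le_succ N)), lowerSum_apply d hN,
    lowerSum_apply c hN]
  simp only [map_sum, map_smul, Finset.smul_sum]
  rw [Finset.sum_comm]
  refine Finset.sum_congr rfl fun k hk => Finset.sum_congr rfl fun j hj => ?_
  rw [Finset.mem_Icc] at hk hj
  rw [cur_comm (by omega) (by omega), smul_comm]

lemma lowerSum_vertexOp_comm (c d : ℕ → ℝ) (v : Fock) :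
    lowerSum d (vertexOp c v) = vertexOp c (lowerSum d v) := by
  obtain ⟨N, hN⟩ := exists_mem_lowSpace v
  rw [vertexOp_apply c hN, vertexOp_apply c (lowerSum_mem_lowSpace d hN (Nat.le_succ N)), map_sum]
  refine Finset.sum_congr rfl fun n _ => ?_
  rw [map_smul]
  congr 1
  exact LinearMap.congr_fun ((lowerSum_comm d c).pow_right n) v

lemma energyOp_lowerSum_pow (c : ℕ → ℝ) (n : ℕ) (v : Fock) :
    energyOp ((lowerSum c ^ n) v) =
      (lowerSum c ^ n) (energyOp v) - (n : ℝ) • lowerSum (eulerCoeff c) ((lowerSum c ^ (n - 1)) v) := by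
  induction n with
  | zero => simp
  | succ n ih =>
    have h1 : lowerSum c (lowerSum (eulerCoeff c) ((lowerSum c ^ (n - 1)) v)) =
        lowerSum (eulerCoeff c) (lowerSum c ((lowerSum c ^ (n - 1)) v)) :=
      LinearMap.congr_fun (lowerSum_comm c (eulerCoeff c)) _
    rw [pow_succ', Module.End.mul_apply, energyOp_lowerSum, ih, map_sub, map_smul, h1,
      Nat.add_sub_cancel]
    rcases Nat.eq_zero_or_pos n with rfl | hn
    · simp
    · rw [← Module.End.mul_apply (lowerSum c), ← Module.End.mul_apply (lowerSum c), ← pow_succ',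
        ← pow_succ', Nat.sub_add_cancel hn, Nat.cast_add_one, add_smul, one_smul]
      abel

/-- The differential equation satisfied by a vertex operator. -/
lemma energyOp_vertexOp (c : ℕ → ℝ) (v : Fock) :
    energyOp (vertexOp c v) =
      vertexOp c (energyOp v) - lowerSum (eulerCoeff c) (vertexOp c v) := by
  obtain ⟨N, hN⟩ := exists_mem_lowSpace v
  rw [vertexOp_apply c (lowSpace_mono (Nat.le_succ N) hN),
    vertexOp_apply c (lowSpace_mono (Nat.le_succ N) (energyOp_mem_lowSpace hN)), map_sum]
  simp only [map_smul, energyOp_lowerSum_pow, smul_sub, Finset.sum_sub_distrib]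
  congr 1
  rw [← vertexOp_apply c (lowSpace_mono (Nat.le_succ N) hN), vertexOp_apply c hN, map_sum,
    Finset.sum_range_succ']
  simp only [Nat.cast_zero, zero_smul, smul_zero, add_zero, map_smul]
  refine Finset.sum_congr rfl fun n _ => ?_
  rw [smul_smul, Nat.add_sub_cancel, Nat.factorial_succ]
  congr 1
  push_cast
  have : (n.factorial : ℝ) ≠ 0 := by exact_mod_cast n.factorial_ne_zero
  field_simp

/-- Uniqueness of the solutions of the differential equation of vertex operators: the component of
highest energy of `F |T⟩` is an eigenvector, so it lies in the degree where `F` vanishes by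
assumption. -/
lemma eq_zero_of_energyOp_left {F : Module.End ℝ Fock} (d : ℕ → ℝ) (m : ℤ)
    (h : ∀ v, energyOp (F v) = F (energyOp v) - lowerSum d (F v) - (m : ℝ) • F v)
    (h0 : ∀ S T, (energy S : ℤ) = energy T - m → matEl F S T = 0) : F = 0 := by
  refine linearMap_eq_of_matEl fun S₀ T => ?_
  suffices hw : F (ket T) = 0 by simp [matEl, hw]
  by_contra hw
  obtain ⟨S, hS, hmax⟩ := Finset.exists_max_image (F (ket T)).support energy
    (Finsupp.support_nonempty_iff.2 hw)
  rw [Finsupp.mem_support_iff] at hS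
  have h1 : lowerSum d (F (ket T)) S = 0 := by
    by_contra hne
    have hlow : F (ket T) ∈ lowSpace (energy S) :=
      mem_lowSpace.2 fun U hU => hmax U (Finsupp.mem_support_iff.2 hU)
    rcases Nat.eq_zero_or_pos (energy S) with hz | hz
    · rw [hz] at hlow
      rw [lowerSum_eq_zero d hlow] at hne
      exact hne rfl
    · have := mem_lowSpace.1 (lowerSum_mem_lowSpace d (M := energy S - 1) hlow (by omega)) S hne
      omega
  have h2 := congrArg (fun w : Fock => w S) (h (ket T))
  simp only [energyOp, diag_apply, diag_single, map_smul, Finsupp.sub_apply, Finsupp.smul_apply,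
    smul_eq_mul, h1, sub_zero] at h2
  have h3 : ((energy S : ℝ) - (energy T - m)) * F (ket T) S = 0 := by linarith
  rcases mul_eq_zero.1 h3 with h4 | h4
  · refine hS (h0 S T ?_)
    have : (energy S : ℝ) = energy T - m := by linarith
    exact_mod_cast this
  · exact hS h4

/-- Uniqueness for the differential equation with the lowering operator on the right, by induction
on the energy. -/
lemma eq_zero_of_energyOp_right {F : Module.End ℝ Fock} (d : ℕ → ℝ) (a : ℤ)
    (h : ∀ v, energyOp (F v) = F (energyOp v) - F (lowerSum d v) + (a : ℝ) • F v)
    (h0 : ∀ S T, (energy S : ℤ) = energy T + a → matEl F S T = 0) : F = 0 := by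
  have key : ∀ N : ℕ, ∀ T, energy T ≤ N → F (ket T) = 0 := by
    have step : ∀ T, F (lowerSum d (ket T)) = 0 → F (ket T) = 0 := by
      intro T hT
      ext S
      have h2 := congrArg (fun w : Fock => w S) (h (ket T))
      simp only [energyOp, diag_apply, diag_single, map_smul, 
        Finsupp.smul_apply, Finsupp.add_apply, smul_eq_mul, hT, sub_zero] at h2
      have h3 : ((energy S : ℝ) - (energy T + a)) * F (ket T) S = 0 := by linarith
      rcases mul_eq_zero.1 h3 with h4 | h4
      · refine h0 S T ?_
        have : (energy S : ℝ) = energy T + a := by linarith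
        exact_mod_cast this
      · exact h4
    intro N
    induction N with
    | zero =>
      intro T hT
      exact step T (by rw [lowerSum_eq_zero d (ket_mem_lowSpace hT), map_zero])
    | succ N ih =>
      intro T hT
      exact step T (eqOn_lowSpace (A := F) (B := 0) (fun U hU => ih U hU)
        (lowerSum_mem_lowSpace d (ket_mem_lowSpace hT) le_rfl))
  exact linearMap_eq_of_matEl fun S T => by rw [matEl, key _ T le_rfl]; rfl

lemma lowerSum_add (c d : ℕ → ℝ) (v : Fock) :
    lowerSum (fun k => c k + d k) v = lowerSum c v + lowerSum d v := by
  obtain ⟨N, hN⟩ := exists_mem_lowSpace v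
  rw [lowerSum_apply _ hN, lowerSum_apply _ hN, lowerSum_apply _ hN, ← Finset.sum_add_distrib]
  exact Finset.sum_congr rfl fun k _ => add_smul _ _ _

/-- Both sides solve the same differential equation and agree to leading order. -/
lemma vertexOp_add (c d : ℕ → ℝ) :
    vertexOp (fun k => c k + d k) = vertexOp c * vertexOp d := by
  rw [← sub_eq_zero]
  refine eq_zero_of_energyOp_left (eulerCoeff fun k => c k + d k) 0 (fun v => ?_) fun S T hST => ?_
  · have h1 : eulerCoeff (fun k => c k + d k) = fun k => eulerCoeff c k + eulerCoeff d k :=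
      funext fun k => mul_add _ _ _
    simp only [LinearMap.sub_apply, Module.End.mul_apply, map_sub, energyOp_vertexOp, h1,
      lowerSum_add, lowerSum_vertexOp_comm, Int.cast_zero, zero_smul, map_add]
    abel
  · have hST' : energy T ≤ energy S := by omega
    have hT := ket_mem_lowSpace (le_refl (energy T))
    simp only [matEl, LinearMap.sub_apply, Module.End.mul_apply, Finsupp.sub_apply]
    rw [vertexOp_apply_top _ hT hST', vertexOp_apply_top _ (vertexOp_mem_lowSpace _ hT) hST',
      vertexOp_apply_top _ hT hST', sub_self]

/-- The operator `a ^ L_0`. -/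
def powEnergy (a : ℝ) : Module.End ℝ Fock := diag fun S => a ^ energy S

lemma powEnergy_mem_lowSpace (a : ℝ) {N : ℕ} {v : Fock} (hv : v ∈ lowSpace N) :
    powEnergy a v ∈ lowSpace N := by
  rw [mem_lowSpace] at hv ⊢
  intro S hS
  rw [powEnergy, diag_apply] at hS
  exact hv S (right_ne_zero_of_mul hS)

lemma cur_powEnergy (a : ℝ) (k : ℕ) (v : Fock) :
    cur k (powEnergy a v) = a ^ k • powEnergy a (cur k v) := by
  suffices h : cur k * powEnergy a = a ^ k • (powEnergy a * cur k) from LinearMap.congr_fun h v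
  refine linearMap_eq_of_matEl fun S T => ?_
  simp only [matEl, Module.End.mul_apply, powEnergy, diag_single, map_smul, diag_apply,
    LinearMap.smul_apply, Finsupp.smul_apply, smul_eq_mul]
  by_cases h : cur k (ket T) S = 0
  · rw [h]; ring
  · have h1 := energy_of_matEl_oneBody h
    rw [show energy T = k + energy S by omega, pow_add]
    ring

lemma lowerSum_powEnergy (a : ℝ) (c : ℕ → ℝ) :
    SemiconjBy (powEnergy a) (lowerSum fun k => a ^ k * c k) (lowerSum c) := by
  refine LinearMap.ext fun v => ?_
  obtain ⟨N, hN⟩ := exists_mem_lowSpace v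
  rw [Module.End.mul_apply, Module.End.mul_apply, lowerSum_apply _ hN,
    lowerSum_apply _ (powEnergy_mem_lowSpace a hN), map_sum]
  refine Finset.sum_congr rfl fun k _ => ?_
  rw [map_smul, cur_powEnergy, smul_smul, mul_comm]

/-- The effect on a vertex operator of the rescaling `z ↦ a z`. -/
lemma matEl_vertexOp_scale (a : ℝ) (c : ℕ → ℝ) (S T : Maya) :
    a ^ energy S * matEl (vertexOp fun k => a ^ k * c k) S T =
      a ^ energy T * matEl (vertexOp c) S T := by
  have h : powEnergy a (vertexOp (fun k => a ^ k * c k) (ket T)) =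
      vertexOp c (powEnergy a (ket T)) := by
    rw [vertexOp_apply _ (ket_mem_lowSpace le_rfl),
      vertexOp_apply _ (powEnergy_mem_lowSpace a (ket_mem_lowSpace le_rfl)), map_sum]
    refine Finset.sum_congr rfl fun n _ => ?_
    rw [map_smul]
    congr 1
    exact LinearMap.congr_fun ((lowerSum_powEnergy a c).pow_right n) (ket T)
  have h2 := congrArg (fun w : Fock => w S) h
  simp only [powEnergy, diag_apply, diag_single, map_smul, Finsupp.smul_apply, smul_eq_mul] at h2
  exact h2

open Filter Topology in
lemma tendsto_vertexOp {c : ℕ → ℕ → ℝ} {d : ℕ → ℝ}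
    (h : ∀ k, k ≠ 0 → Tendsto (fun i => c i k) atTop (𝓝 (d k))) (S T : Maya) :
    Tendsto (fun i => matEl (vertexOp (c i)) S T) atTop (𝓝 (matEl (vertexOp d) S T)) := by
  have h1 : ∀ S U, Tendsto (fun i => matEl (lowerSum (c i)) S U) atTop
      (𝓝 (matEl (lowerSum d) S U)) := by
    intro S U
    simp only [matEl, lowerSum_apply _ (ket_mem_lowSpace (le_refl (energy U))),
      Finsupp.finsetSum_apply, Finsupp.smul_apply, smul_eq_mul]
    refine tendsto_finsetSum _ fun k hk => (h k ?_).mul_const _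
    rw [Finset.mem_Icc] at hk
    omega
  have h2 : ∀ n S, Tendsto (fun i => (lowerSum (c i) ^ n) (ket T) S) atTop
      (𝓝 ((lowerSum d ^ n) (ket T) S)) := by
    intro n
    induction n with
    | zero => intro S; simp
    | succ n ih =>
      intro S
      have hs : ∀ e : ℕ → ℝ, ∀ U, (lowerSum e ^ n) (ket T) U ≠ 0 → U ∈ lowStates (energy T) :=
        fun e U hU => mem_lowStates.2 (mem_lowSpace.1 (lowSpace_mono (Nat.sub_le _ n)
          (lowerSum_pow_mem_lowSpace e n (ket_mem_lowSpace le_rfl))) U hU)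
      simp only [pow_succ', Module.End.mul_apply]
      rw [map_apply_eq_sum (lowerSum d) _ S (hs d)]
      refine Tendsto.congr (fun i => (map_apply_eq_sum (lowerSum (c i)) _ S (hs (c i))).symm) ?_
      exact tendsto_finsetSum _ fun U _ => (ih U).mul (h1 S U)
  simp only [matEl, vertexOp_apply _ (ket_mem_lowSpace (le_refl (energy T))),
    Finsupp.finsetSum_apply, Finsupp.smul_apply, smul_eq_mul]
  exact tendsto_finsetSum _ fun n _ => (h2 n S).const_mul _

/-! ### The shift symmetry -/

/-- The polynomial `∏_{i < K} (1 - z / r ^ (2 i + 1))`, the quotient of the symbols of a vertex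
operator and of its dilation by `r ^ (-2 K)`. -/
def shiftPoly (r : ℝ) (K : ℕ) : Polynomial ℝ :=
  ∏ i ∈ Finset.range K, (1 - Polynomial.C (r ^ (2 * i + 1))⁻¹ * Polynomial.X)

lemma natDegree_shiftPoly_le (r : ℝ) (K : ℕ) : (shiftPoly r K).natDegree ≤ K := by
  refine (Polynomial.natDegree_prod_le _ _).trans ?_
  refine (Finset.sum_le_card_nsmul _ _ 1 fun i _ => ?_).trans (by simp)
  compute_degree

/-- Newton's identities for the polynomial `∏_{i < K} (1 - x_i z)`. -/
lemma newton_prod (x : ℕ → ℝ) (K n : ℕ) :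
    (n : ℝ) * (∏ i ∈ Finset.range K, (1 - Polynomial.C (x i) * Polynomial.X)).coeff n =
      ∑ p ∈ Finset.HasAntidiagonal.antidiagonal n,
        (∏ i ∈ Finset.range K, (1 - Polynomial.C (x i) * Polynomial.X)).coeff p.1 *
          (if p.2 = 0 then 0 else -∑ i ∈ Finset.range K, x i ^ p.2) := by
  set B : ℕ → PowerSeries ℝ := fun K => PowerSeries.mk fun k =>
    if k = 0 then 0 else -∑ i ∈ Finset.range K, x i ^ k with hB
  set P : ℕ → PowerSeries ℝ := fun K =>
    ∏ i ∈ Finset.range K, (1 - PowerSeries.C (x i) * PowerSeries.X) with hP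
  have hPc : ∀ K, ((∏ i ∈ Finset.range K, (1 - Polynomial.C (x i) * Polynomial.X) :
      Polynomial ℝ) : PowerSeries ℝ) = P K := by
    intro K
    rw [hP]
    induction K with
    | zero => simp
    | succ K ih =>
      rw [Finset.prod_range_succ, Polynomial.coe_mul, ih]
      simp only [Finset.prod_range_succ]
      congr 1
      rw [Polynomial.coe_sub, Polynomial.coe_mul, Polynomial.coe_one, Polynomial.coe_C,
        Polynomial.coe_X]
  have geom : ∀ y : ℝ, (1 - PowerSeries.C y * PowerSeries.X) *
      PowerSeries.mk (fun k => if k = 0 then 0 else y ^ k) = PowerSeries.C y * PowerSeries.X := by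
    intro y
    ext k
    rw [sub_mul, one_mul, map_sub, mul_assoc, PowerSeries.coeff_C_mul, PowerSeries.coeff_C_mul,
      PowerSeries.coeff_mk]
    rcases k with _ | _ | k
    · simp
    · rw [PowerSeries.coeff_succ_X_mul]
      simp
    · rw [PowerSeries.coeff_succ_X_mul, PowerSeries.coeff_mk, PowerSeries.coeff_X]
      simp [pow_succ]
      ring
  have key : ∀ K, PowerSeries.X * PowerSeries.derivative ℝ (P K) = P K * B K := by
    intro K
    induction K with
    | zero =>
      have : B 0 = 0 := by
        ext k
        simp [hB]
      simp [hP, this]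
    | succ K ih =>
      have h1 : P (K + 1) = P K * (1 - PowerSeries.C (x K) * PowerSeries.X) := by
        simp only [hP, Finset.prod_range_succ]
      have h2 : B (K + 1) = B K - PowerSeries.mk (fun k => if k = 0 then 0 else x K ^ k) := by
        ext k
        simp only [hB, map_sub, PowerSeries.coeff_mk, Finset.sum_range_succ]
        split_ifs <;> ring
      have h3 : PowerSeries.derivative ℝ (1 - PowerSeries.C (x K) * PowerSeries.X) =
          -PowerSeries.C (x K) := by
        rw [map_sub, Derivation.leibniz]
        simp
      rw [h1, h2, Derivation.leibniz, h3, smul_eq_mul, smul_eq_mul]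
      linear_combination (1 - PowerSeries.C (x K) * PowerSeries.X) * ih + P K * geom (x K)
  have h := congrArg (PowerSeries.coeff n) (key K)
  rw [PowerSeries.coeff_mul _ (P K), ← hPc] at h
  simp only [Polynomial.coeff_coe, hB, PowerSeries.coeff_mk] at h
  rw [← h]
  rcases n with _ | n
  · simp
  · rw [PowerSeries.coeff_succ_X_mul, PowerSeries.coeff_derivative, Polynomial.coeff_coe, mul_comm,
      Nat.cast_succ]

/-- The shift polynomial is self-reciprocal up to a dilation. -/
lemma coeff_shiftPoly_reverse {r : ℝ} (hr : r ≠ 0) {K j : ℕ} (hj : j ≤ K) :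
    r ^ (K ^ 2) * (shiftPoly r K).coeff (K - j) =
      (-1) ^ K * ((r ^ (2 * K)) ^ j * (shiftPoly r K).coeff j) := by
  have h1 : Polynomial.reflect K (shiftPoly r K) =
      ∏ i ∈ Finset.range K, (Polynomial.X - Polynomial.C (r ^ (2 * i + 1))⁻¹) := by
    induction K generalizing j with
    | zero => simp [shiftPoly]
    | succ K ih =>
      rw [shiftPoly, Finset.prod_range_succ, Finset.prod_range_succ, ← shiftPoly,
        Polynomial.reflect_mul _ _ (natDegree_shiftPoly_le r K) (by compute_degree),
        ih (Nat.zero_le _)]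
      congr 1
      ext n
      rw [Polynomial.coeff_reflect]
      rcases n with _ | _ | n
      · simp [Polynomial.revAt_le, Polynomial.coeff_one]
      · simp [Polynomial.revAt_le, Polynomial.coeff_one, Polynomial.coeff_C]
      · rw [Polynomial.revAt_eq_self_of_lt (by omega)]
        simp [Polynomial.coeff_one, Polynomial.coeff_X]
  have h2 : Polynomial.C (r ^ (K ^ 2)) *
      ∏ i ∈ Finset.range K, (Polynomial.X - Polynomial.C (r ^ (2 * i + 1))⁻¹) =
      Polynomial.C ((-1) ^ K) *
        (shiftPoly r K).comp (Polynomial.C (r ^ (2 * K)) * Polynomial.X) := by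
    have e1 : ∀ K : ℕ, r ^ (K ^ 2) = ∏ i ∈ Finset.range K, r ^ (2 * i + 1) := by
      intro K
      induction K with
      | zero => simp
      | succ K ih =>
        rw [Finset.prod_range_succ, ← ih, ← pow_add]
        congr 1
        ring
    have e2 : ((-1 : ℝ)) ^ K = ∏ _i ∈ Finset.range K, (-1 : ℝ) := by simp
    rw [e1, e2, map_prod, map_prod, shiftPoly, Polynomial.prod_comp, ← Finset.prod_mul_distrib,
      ← Finset.prod_mul_distrib, ← Finset.prod_range_reflect]
    refine Finset.prod_congr rfl fun i hi => ?_
    rw [Finset.mem_range] at hi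
    have e3 : r ^ (2 * K) * (r ^ (2 * i + 1))⁻¹ = r ^ (2 * (K - 1 - i) + 1) := by
      rw [show 2 * K = (2 * (K - 1 - i) + 1) + (2 * i + 1) by omega, pow_add, mul_assoc,
        mul_inv_cancel₀ (pow_ne_zero _ hr), mul_one]
    simp only [Polynomial.sub_comp, Polynomial.one_comp, Polynomial.mul_comp, Polynomial.C_comp,
      Polynomial.X_comp]
    rw [mul_sub, ← Polynomial.C_mul, mul_inv_cancel₀ (pow_ne_zero _ hr), ← e3]
    simp only [Polynomial.C_mul, Polynomial.C_neg, Polynomial.C_1]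
    ring
  have h3 := congrArg (fun p => Polynomial.coeff p j) h2
  simp only [Polynomial.coeff_C_mul, ← h1, Polynomial.coeff_reflect, Polynomial.revAt_le hj,
    Polynomial.comp_C_mul_X_coeff] at h3
  rw [h3]
  ring

/-- The coefficients `q^{k/2} / (k (1 - q^k))` of the vertex operators `G_±(q)`. -/
def rhoCoeff (q : ℝ) (k : ℕ) : ℝ := q ^ ((k : ℝ) / 2) / (k * (1 - q ^ k))

lemma rpow_half {q : ℝ} (hq : 0 ≤ q) (k : ℕ) : q ^ ((k : ℝ) / 2) = Real.sqrt q ^ k := by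
  rw [Real.sqrt_eq_rpow, ← Real.rpow_natCast, ← Real.rpow_mul hq]
  congr 1
  ring

lemma sum_antidiagonal_smul {M : Type*} [AddCommGroup M] [Module ℝ M] (g : ℕ → ℕ → ℝ) (f : ℕ → M)
    (N : ℕ) (hf : ∀ n, N ≤ n → f n = 0) :
    ∑ j ∈ Finset.range N, ∑ k ∈ Finset.range N, g j k • f (j + k) =
      ∑ n ∈ Finset.range N, (∑ p ∈ Finset.HasAntidiagonal.antidiagonal n, g p.1 p.2) • f n := by
  rw [← Finset.sum_product', ← Finset.sum_filter_of_ne (p := fun p : ℕ × ℕ => p.1 + p.2 < N)]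
  · rw [← Finset.sum_fiberwise_of_maps_to (g := fun p : ℕ × ℕ => p.1 + p.2)
      (t := Finset.range N) (fun p hp => by simpa using (Finset.mem_filter.1 hp).2)]
    refine Finset.sum_congr rfl fun n hn => ?_
    rw [Finset.sum_smul]
    refine Finset.sum_congr ?_ fun p hp => ?_
    · ext p
      simp only [Finset.mem_filter, Finset.mem_product, Finset.mem_range,
        Finset.HasAntidiagonal.mem_antidiagonal] at hn ⊢
      omega
    · rw [Finset.HasAntidiagonal.mem_antidiagonal.1 hp]
  · intro p _ hp
    by_contra h
    exact hp (by rw [hf _ (not_lt.1 h), smul_zero])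

/-- The commutators of the currents with `oneBody (q ^ K)` turn the coefficients of `G₊(q)` into the
power sums of the reciprocal roots of the shift polynomial. -/
lemma eulerCoeff_rhoCoeff {q : ℝ} (hq0 : 0 < q) (hq1 : q < 1) (K : ℕ) {k : ℕ} (hk : k ≠ 0) :
    eulerCoeff (rhoCoeff q) k * (1 - (q ^ K) ^ (-(k : ℤ))) =
      -∑ i ∈ Finset.range K, ((Real.sqrt q ^ (2 * i + 1))⁻¹) ^ k := by
  have hr : Real.sqrt q ≠ 0 := (Real.sqrt_pos.2 hq0).ne'
  have hrq : Real.sqrt q ^ 2 = q := Real.sq_sqrt hq0.le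
  have h1 : 1 - q ^ k ≠ 0 := sub_ne_zero.2 (pow_lt_one₀ hq0.le hq1 hk).ne'
  have hk' : (k : ℝ) ≠ 0 := by exact_mod_cast hk
  have hqk : q ^ k ≠ 0 := (pow_pos hq0 k).ne'
  have h2 : ∀ i, ((Real.sqrt q ^ (2 * i + 1))⁻¹) ^ k = (Real.sqrt q ^ k)⁻¹ * ((q ^ k)⁻¹) ^ i := by
    intro i
    rw [inv_pow, ← pow_mul, inv_pow, ← mul_inv]
    congr 1
    rw [← pow_mul]
    nth_rw 3 [← hrq]
    rw [← pow_mul, ← pow_add]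
    congr 1
    ring
  have h3 : (q ^ k)⁻¹ ≠ 1 := by
    rw [Ne, inv_eq_one]
    exact fun h => h1 (by rw [h, sub_self])
  simp only [h2]
  rw [← Finset.mul_sum, geom_sum_eq h3, eulerCoeff, rhoCoeff, rpow_half hq0.le, zpow_neg,
    zpow_natCast, ← pow_mul, mul_comm K k, pow_mul, ← inv_pow]
  have h4 : (q ^ k)⁻¹ - 1 ≠ 0 := sub_ne_zero.2 h3
  have h5 : Real.sqrt q ^ k * Real.sqrt q ^ k = q ^ k := by rw [← mul_pow, Real.mul_self_sqrt hq0.le]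
  have h6 : Real.sqrt q ^ k ≠ 0 := pow_ne_zero _ hr
  have h7 : (q ^ k)⁻¹ - 1 = (1 - q ^ k) * (q ^ k)⁻¹ := by field_simp
  rw [h7, show (k : ℝ) * (Real.sqrt q ^ k / (k * (1 - q ^ k))) = Real.sqrt q ^ k / (1 - q ^ k) by
    field_simp]
  generalize ((q ^ k)⁻¹) ^ K = y
  rw [show (Real.sqrt q ^ k)⁻¹ = Real.sqrt q ^ k * (q ^ k)⁻¹ by
    rw [← h5]; field_simp]
  field_simp
  ring

/-- The infinitesimal form of the shift symmetry. -/
lemma lowerSum_shift {q : ℝ} (hq0 : 0 < q) (hq1 : q < 1) {K : ℕ} (hK : K ≠ 0) (m : ℤ) (w : Fock) :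
    ∑ j ∈ Finset.range (K + 1), (shiftPoly (Real.sqrt q) K).coeff j •
      (lowerSum (eulerCoeff (rhoCoeff q)) (oneBody (q ^ K) (m + j) w) -
        oneBody (q ^ K) (m + j) (lowerSum (eulerCoeff (rhoCoeff q)) w)) =
    ∑ j ∈ Finset.range (K + 1), ((j : ℝ) * (shiftPoly (Real.sqrt q) K).coeff j) •
      oneBody (q ^ K) (m + j) w := by
  have hu : q ^ K ≠ 0 := (pow_pos hq0 K).ne'
  have hu1 : q ^ K ≠ 1 := (pow_lt_one₀ hq0.le hq1 hK).ne
  obtain ⟨N, hN⟩ := exists_mem_lowSpace w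
  set N' := N + m.natAbs + K with hN'
  set c : ℕ → ℝ := fun j => (shiftPoly (Real.sqrt q) K).coeff j with hc
  set b : ℕ → ℝ := fun k => if k = 0 then 0 else
    -∑ i ∈ Finset.range K, ((Real.sqrt q ^ (2 * i + 1))⁻¹) ^ k with hb
  set f : ℕ → Fock := fun n => oneBody (q ^ K) (m + n) w with hf
  have hf0 : ∀ n, N' + 1 ≤ n → f n = 0 := fun n hn => oneBody_eq_zero hN (by omega)
  have hc0 : ∀ j, K + 1 ≤ j → c j = 0 := fun j hj => Polynomial.coeff_eq_zero_of_natDegree_lt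
    ((natDegree_shiftPoly_le _ K).trans_lt (by omega))
  -- The commutator with the current `J_k` shifts the index by `k`; the index `k = 0` is added for
  -- the convolution with the coefficients of the shift polynomial.
  have step : ∀ j, lowerSum (eulerCoeff (rhoCoeff q)) (f j) -
      oneBody (q ^ K) (m + j) (lowerSum (eulerCoeff (rhoCoeff q)) w) =
      ∑ k ∈ Finset.range (N' + 1), b k • f (j + k) := by
    intro j
    have h1 : f j ∈ lowSpace N' := oneBody_mem_lowSpace hN (by omega)
    have h2 : w ∈ lowSpace N' := lowSpace_mono (by omega) hN
    rw [lowerSum_apply _ h1, lowerSum_apply _ h2, map_sum, ← Finset.sum_sub_distrib]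
    refine Finset.sum_subset_zero_on_sdiff (fun k hk => ?_) (fun k hk => ?_) fun k hk => ?_
    · rw [Finset.mem_Icc] at hk
      rw [Finset.mem_range]
      omega
    · rw [Finset.mem_sdiff, Finset.mem_range, Finset.mem_Icc] at hk
      have : k = 0 := by omega
      simp [hb, this]
    · rw [Finset.mem_Icc] at hk
      have hk0 : k ≠ 0 := by omega
      rw [map_smul, ← smul_sub, hf]
      simp only
      rw [cur_oneBody hu hk0 (Or.inl hu1), add_sub_cancel_left, smul_smul,
        eulerCoeff_rhoCoeff hq0 hq1 K hk0, hb]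
      simp only [if_neg hk0, Nat.cast_add, add_assoc]
  have ext1 : ∀ g : ℕ → Fock, ∑ j ∈ Finset.range (K + 1), c j • g j =
      ∑ j ∈ Finset.range (N' + 1), c j • g j := fun g =>
    Finset.sum_subset (Finset.range_mono (by omega)) fun j _ hj => by
      rw [Finset.mem_range, not_lt] at hj
      rw [hc0 j hj, zero_smul]
  change ∑ j ∈ Finset.range (K + 1), c j • (lowerSum (eulerCoeff (rhoCoeff q)) (f j) -
      oneBody (q ^ K) (m + j) (lowerSum (eulerCoeff (rhoCoeff q)) w)) =
    ∑ j ∈ Finset.range (K + 1), ((j : ℝ) * c j) • f j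
  simp only [step, mul_comm _ (c _), mul_smul]
  rw [ext1, ext1]
  simp only [Finset.smul_sum, smul_smul]
  rw [sum_antidiagonal_smul (fun j k => c j * b k) f _ hf0]
  refine Finset.sum_congr rfl fun n _ => ?_
  rw [mul_comm, hc]
  simp only
  rw [shiftPoly, newton_prod]

/-- The shift symmetry: conjugation by `G₊(q)` multiplies the symbol of a one-body operator by the
shift polynomial. -/
lemma vertexOp_oneBody {q : ℝ} (hq0 : 0 < q) (hq1 : q < 1) {K : ℕ} (hK : K ≠ 0) (m : ℤ) (v : Fock) :
    vertexOp (rhoCoeff q) (oneBody (q ^ K) m v) =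
      ∑ j ∈ Finset.range (K + 1), (shiftPoly (Real.sqrt q) K).coeff j •
        oneBody (q ^ K) (m + j) (vertexOp (rhoCoeff q) v) := by
  set G := vertexOp (rhoCoeff q) with hG
  set c : ℕ → ℝ := fun j => (shiftPoly (Real.sqrt q) K).coeff j with hc
  suffices h : G * oneBody (q ^ K) m -
      ∑ j ∈ Finset.range (K + 1), c j • (oneBody (q ^ K) (m + j) * G) = 0 by
    have h1 := LinearMap.congr_fun h v
    rw [LinearMap.sub_apply, LinearMap.sum_apply, LinearMap.zero_apply] at h1
    exact sub_eq_zero.1 h1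
  have hFv : ∀ v, (G * oneBody (q ^ K) m -
      ∑ j ∈ Finset.range (K + 1), c j • (oneBody (q ^ K) (m + j) * G)) v =
      G (oneBody (q ^ K) m v) -
        ∑ j ∈ Finset.range (K + 1), c j • oneBody (q ^ K) (m + j) (G v) := by
    intro v
    rw [LinearMap.sub_apply, LinearMap.sum_apply]
    rfl
  -- The difference solves the differential equation of vertex operators; it vanishes to leading
  -- order since the shift polynomial has constant term `1`.
  refine eq_zero_of_energyOp_left (eulerCoeff (rhoCoeff q)) m (fun v => ?_) fun S T hST => ?_
  · have h1 := lowerSum_shift hq0 hq1 hK m (G v)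
    have h2 : ∑ j ∈ Finset.range (K + 1), c j • (((m + (j : ℕ) : ℤ) : ℝ) •
        oneBody (q ^ K) (m + j) (G v)) = (m : ℝ) • ∑ j ∈ Finset.range (K + 1), c j •
        oneBody (q ^ K) (m + j) (G v) + ∑ j ∈ Finset.range (K + 1), ((j : ℝ) * c j) •
        oneBody (q ^ K) (m + j) (G v) := by
      rw [Finset.smul_sum, ← Finset.sum_add_distrib]
      refine Finset.sum_congr rfl fun j _ => ?_
      rw [smul_smul, smul_smul, ← add_smul]
      congr 1
      push_cast
      ring
    simp only [smul_sub, Finset.sum_sub_distrib] at h1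
    rw [hFv, hFv]
    simp only [map_sub, map_sum, map_smul, energyOp_vertexOp, energyOp_oneBody, smul_sub,
      Finset.sum_sub_distrib, hG] at h2 ⊢
    rw [h2, ← h1]
    abel
  · rw [matEl, hFv, Finsupp.sub_apply, sub_eq_zero]
    have hT := ket_mem_lowSpace (le_refl (energy T))
    rw [hG, vertexOp_apply_top _ (oneBody_mem_lowSpace (M := energy S) hT (by omega)) le_rfl,
      Finsupp.finsetSum_apply, Finset.sum_eq_single 0]
    · have hc0 : c 0 = 1 := by
        simp [hc, shiftPoly, Polynomial.coeff_zero_eq_eval_zero, Polynomial.eval_prod]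
      rw [hc0, one_smul, Nat.cast_zero, add_zero]
      have hs : ∀ U, vertexOp (rhoCoeff q) (ket T) U ≠ 0 → U ∈ lowStates (energy T) := fun U hU =>
        mem_lowStates.2 (mem_lowSpace.1 (vertexOp_mem_lowSpace _ hT) U hU)
      rw [map_apply_eq_sum _ _ S hs, Finset.sum_eq_single T, ← matEl, ← matEl,
        matEl_vertexOp_self, one_mul]
      · intro U _ hUT
        by_cases hz : matEl (oneBody (q ^ K) m) S U = 0
        · rw [hz, mul_zero]
        · have h1 := energy_of_matEl_oneBody hz
          rw [vertexOp_apply_top _ hT (by omega), Finsupp.single_apply, if_neg (Ne.symm hUT),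
            zero_mul]
      · intro h
        exact absurd (mem_lowStates.2 le_rfl) h
    · intro j _ hj
      rw [Finsupp.smul_apply, smul_eq_mul]
      by_contra hne
      have h1 := right_ne_zero_of_mul hne
      obtain ⟨U, hU, hSU⟩ := exists_of_map_apply_ne_zero h1
      have h2 := energy_of_matEl_oneBody hSU
      have h3 := mem_lowSpace.1 (vertexOp_mem_lowSpace _ hT) U hU
      omega
    · simp

/-! ### Intertwining currents and diagonal operators -/

/-- The eigenvalue of `q^{W_0/2}`. -/
def wWeight (q : ℝ) (S : Maya) : ℝ := Real.exp (Real.log q / 2 * chargeSum (fun n => (n : ℝ) ^ 2) S)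

/-- The matrix elements of `G₋(q) G₊(q)`. -/
def gramEl (q : ℝ) (S T : Maya) : ℝ :=
  ip (vertexOp (rhoCoeff q) (ket S)) (vertexOp (rhoCoeff q) (ket T))

/-- The eigenvalue `∑_{n ∈ T} u ^ n` of `∑ n, u ^ n ψ_{-n} ψ*_n`, regularised as in `oneBody`. -/
def levelSum (u : ℝ) (T : Maya) : ℝ := chargeSum (fun n => u ^ n) T + u / (u - 1)

/-- Moving a particle from the level `n` up to `n + K` multiplies `q^{W_0/2}` by
`q^{((n + K)² - n²)/2} = q^{K²/2} (q^K)^n`. -/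
lemma diag_wWeight_cur {q : ℝ} (hq0 : 0 < q) {K : ℕ} (hK : K ≠ 0) (S : Maya) :
    diag (wWeight q) (cur (-(K : ℤ)) (ket S)) =
      (Real.sqrt q ^ (K ^ 2) * wWeight q S) • oneBody (q ^ K) (-(K : ℤ)) (ket S) := by
  have hK' : -(K : ℤ) ≠ 0 := by simpa using hK
  rw [cur, oneBody_ket hK', oneBody_ket hK', map_sum, Finset.smul_sum]
  refine Finset.sum_congr rfl fun n hn => ?_
  rw [one_zpow, one_smul, psi_psiStar_ket hn, diag_single, smul_smul]
  congr 1
  rw [mem_hops] at hn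
  rw [wWeight, chargeSum_hop _ hn.1 hn.2, wWeight, ← rpow_half hq0.le, mul_right_comm, mul_comm,
    Real.rpow_def_of_pos hq0, ← zpow_natCast q K, ← zpow_mul, ← Real.rpow_intCast,
    Real.rpow_def_of_pos hq0, ← Real.exp_add, ← Real.exp_add]
  congr 1
  push_cast
  ring

/-- The intertwining relation
`J_K q^{W_0/2} G₋(q) G₊(q) = (-1)^K q^{W_0/2} G₋(q) G₊(q) ∑ n, q^{K n} ψ_{-n} ψ*_n`. -/
lemma ip_intertwine {q : ℝ} (hq0 : 0 < q) (hq1 : q < 1) {K : ℕ} (hK : K ≠ 0) (S T : Maya) :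
    ip (vertexOp (rhoCoeff q) (diag (wWeight q) (cur (-(K : ℤ)) (ket S))))
      (vertexOp (rhoCoeff q) (ket T)) =
    (-1) ^ K * levelSum (q ^ K) T * (wWeight q S * gramEl q S T) := by
  have hr : Real.sqrt q ≠ 0 := (Real.sqrt_pos.2 hq0).ne'
  have hrq : Real.sqrt q ^ (2 * K) = q ^ K := by rw [pow_mul, Real.sq_sqrt hq0.le]
  have hu : q ^ K ≠ 0 := (pow_pos hq0 K).ne'
  set G := vertexOp (rhoCoeff q) with hG
  set c : ℕ → ℝ := fun j => (shiftPoly (Real.sqrt q) K).coeff j with hc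
  -- The shift symmetry on the left factor, rewritten by self-reciprocity of the shift polynomial.
  have h1 : Real.sqrt q ^ (K ^ 2) • G (oneBody (q ^ K) (-(K : ℤ)) (ket S)) =
      (-1 : ℝ) ^ K • ∑ j ∈ Finset.range (K + 1), (c j * (q ^ K) ^ j) •
        oneBody (q ^ K) (-(j : ℤ)) (G (ket S)) := by
    rw [hG, vertexOp_oneBody hq0 hq1 hK, ← Finset.sum_range_reflect, Finset.smul_sum,
      Finset.smul_sum]
    refine Finset.sum_congr rfl fun j hj => ?_
    rw [Finset.mem_range] at hj
    have hj' : j ≤ K := by omega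
    rw [smul_smul, smul_smul, show K + 1 - 1 - j = K - j by omega,
      coeff_shiftPoly_reverse hr hj', hrq, hc]
    congr 1
    · ring
    · congr 2
      push_cast [hj']
      ring
  -- The result is the adjoint of what the shift symmetry produces on the right factor.
  have h2 : ∀ v w, ip v (∑ j ∈ Finset.range (K + 1), c j • oneBody (q ^ K) ((0 : ℤ) + j) w) =
      ip (∑ j ∈ Finset.range (K + 1), (c j * (q ^ K) ^ j) • oneBody (q ^ K) (-(j : ℤ)) v) w := by
    intro v w
    rw [map_sum, map_sum, LinearMap.sum_apply]
    refine Finset.sum_congr rfl fun j _ => ?_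
    rw [map_smul, map_smul, LinearMap.smul_apply, zero_add,
      ip_adjoint (A := oneBody (q ^ K) (j : ℤ)) (B := (q ^ K) ^ j • oneBody (q ^ K) (-(j : ℤ)))]
    · rw [LinearMap.smul_apply, map_smul, LinearMap.smul_apply, smul_smul]
    · intro S T
      rw [matEl_oneBody_transpose hu, zpow_natCast]
      rfl
  rw [diag_wWeight_cur hq0 hK, map_smul, mul_comm, mul_smul, h1, map_smul, map_smul,
    LinearMap.smul_apply, LinearMap.smul_apply, ← h2, ← vertexOp_oneBody hq0 hq1 hK,
    oneBody_zero_ket, map_smul, map_smul, ← hG, smul_eq_mul, smul_eq_mul, smul_eq_mul, gramEl,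
    levelSum]
  ring

lemma matEl_cur_transpose (k : ℤ) (S T : Maya) : matEl (cur k) S T = matEl (cur (-k)) T S := by
  rw [cur, matEl_oneBody_transpose one_ne_zero, one_zpow, one_mul]

/-- The intertwining relation in terms of matrix elements. -/
lemma sum_cur_gramEl {q : ℝ} (hq0 : 0 < q) (hq1 : q < 1) {K : ℕ} (hK : K ≠ 0) (S T : Maya)
    {s : Finset Maya} (hs : ∀ U, matEl (cur (K : ℤ)) S U ≠ 0 → U ∈ s) :
    ∑ U ∈ s, matEl (cur (K : ℤ)) S U * (wWeight q U * gramEl q U T) =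
      (-1) ^ K * levelSum (q ^ K) T * (wWeight q S * gramEl q S T) := by
  rw [← ip_intertwine hq0 hq1 hK]
  have h : cur (-(K : ℤ)) (ket S) = ∑ U ∈ s, matEl (cur (K : ℤ)) S U • ket U := by
    ext V
    rw [Finsupp.finsetSum_apply]
    simp only [Finsupp.smul_apply, Finsupp.single_apply, smul_eq_mul, mul_ite, mul_one, mul_zero]
    rw [Finset.sum_ite_eq', matEl_cur_transpose]
    split_ifs with h
    · rfl
    · by_contra h'
      exact h (hs V (by rw [matEl_cur_transpose]; exact h'))
  rw [h]
  simp only [map_sum, map_smul, LinearMap.sum_apply, LinearMap.smul_apply, diag_single, smul_eq_mul]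
  exact Finset.sum_congr rfl fun U _ => rfl

/-! ### Young diagrams and the states of fixed charge -/

lemma diagram_ext {lam mu : YoungDiagram} (h : ∀ i, lam.rowLen i = mu.rowLen i) : lam = mu := by
  refine SetLike.ext fun c => ?_
  obtain ⟨i, j⟩ := c
  rw [YoungDiagram.mem_iff_lt_rowLen, YoungDiagram.mem_iff_lt_rowLen, h]

lemma exists_rowLen_eq_zero (lam : YoungDiagram) : ∃ M, ∀ i, M ≤ i → lam.rowLen i = 0 := by
  refine ⟨lam.colLen 0, fun i hi => ?_⟩
  by_contra h
  have h1 : (i, 0) ∈ lam := YoungDiagram.mem_iff_lt_rowLen.2 (Nat.pos_of_ne_zero h)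
  rw [YoungDiagram.mem_iff_lt_colLen] at h1
  omega

lemma rowLen_bot (i : ℕ) : (⊥ : YoungDiagram).rowLen i = 0 := by
  by_contra h
  exact YoungDiagram.notMem_bot _ (YoungDiagram.mem_iff_lt_rowLen.2 (Nat.pos_of_ne_zero h))

/-- The Young diagram with given row lengths. -/
def diagramOf (f : ℕ → ℕ) (hf : Antitone f) (M : ℕ) : YoungDiagram where
  cells := {c ∈ Finset.range M ×ˢ Finset.range (f 0) | c.2 < f c.1}
  isLowerSet := by
    rintro ⟨i, j⟩ ⟨i', j'⟩ ⟨h1, h2⟩ h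
    simp only [Finset.coe_filter, Finset.mem_product, Finset.mem_range, Set.mem_ofPred_eq] at h h1 h2 ⊢
    have := hf h1
    omega

lemma rowLen_diagramOf {f : ℕ → ℕ} (hf : Antitone f) {M : ℕ} (hM : ∀ i, M ≤ i → f i = 0) (i : ℕ) :
    (diagramOf f hf M).rowLen i = f i := by
  refine eq_of_forall_lt_iff fun j => ?_
  rw [← YoungDiagram.mem_iff_lt_rowLen, ← YoungDiagram.mem_cells]
  simp only [diagramOf, Finset.mem_filter, Finset.mem_product, Finset.mem_range,
    and_iff_right_iff_imp]
  intro h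
  refine ⟨?_, h.trans_le (hf (Nat.zero_le i))⟩
  by_contra h'
  rw [hM i (not_lt.1 h')] at h
  omega

lemma card_eq_sum_rowLen {lam : YoungDiagram} {M : ℕ} (hM : ∀ i, M ≤ i → lam.rowLen i = 0) :
    lam.card = ∑ i ∈ Finset.range M, lam.rowLen i := by
  rw [YoungDiagram.card, Finset.card_eq_sum_card_fiberwise (f := Prod.fst) (t := Finset.range M)]
  · exact Finset.sum_congr rfl fun i _ => (YoungDiagram.rowLen_eq_card lam).symm
  · rintro ⟨i, j⟩ h
    have h1 := YoungDiagram.mem_iff_lt_rowLen.1 ((YoungDiagram.mem_cells _).1 (Finset.mem_coe.1 h))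
    rw [Finset.mem_coe, Finset.mem_range]
    by_contra h'
    simp only at h'
    rw [hM i (not_lt.1 h')] at h1
    omega

/-- Put a row of length `max a (lam.rowLen 0)` on top of a Young diagram. -/
def consRow (a : ℕ) (lam : YoungDiagram) : YoungDiagram :=
  diagramOf (fun i => i.casesOn (max a (lam.rowLen 0)) lam.rowLen) (by
    refine antitone_nat_of_succ_le fun i => ?_
    rcases i with _ | i
    · exact le_max_right _ _
    · exact lam.rowLen_anti _ _ (Nat.le_succ i)) (exists_rowLen_eq_zero lam).choose.succ

lemma rowLen_consRow (a : ℕ) (lam : YoungDiagram) (i : ℕ) : (consRow a lam).rowLen i =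
    i.casesOn (max a (lam.rowLen 0)) lam.rowLen := by
  refine rowLen_diagramOf _ (fun i hi => ?_) i
  rcases i with _ | i
  · omega
  · exact (exists_rowLen_eq_zero lam).choose_spec i (by omega)

lemma rowLen_consRow_zero {a : ℕ} {lam : YoungDiagram} (h : lam.rowLen 0 ≤ a) :
    (consRow a lam).rowLen 0 = a := by
  rw [rowLen_consRow]
  exact max_eq_left h

lemma rowLen_consRow_succ (a : ℕ) (lam : YoungDiagram) (i : ℕ) :
    (consRow a lam).rowLen (i + 1) = lam.rowLen i := rowLen_consRow a lam (i + 1)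

/-- Remove the first row of a Young diagram. -/
def tailRows (lam : YoungDiagram) : YoungDiagram :=
  diagramOf (fun i => lam.rowLen (i + 1))
    (fun _ _ h => lam.rowLen_anti _ _ (Nat.succ_le_succ h)) (exists_rowLen_eq_zero lam).choose

lemma rowLen_tailRows (lam : YoungDiagram) (i : ℕ) :
    (tailRows lam).rowLen i = lam.rowLen (i + 1) :=
  rowLen_diagramOf _ (fun i hi => (exists_rowLen_eq_zero lam).choose_spec (i + 1) (by omega)) i

lemma rowLen_tailRows_zero_le (lam : YoungDiagram) : (tailRows lam).rowLen 0 ≤ lam.rowLen 0 := by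
  rw [rowLen_tailRows]
  exact lam.rowLen_anti _ _ (Nat.zero_le 1)

lemma consRow_tailRows (lam : YoungDiagram) : consRow (lam.rowLen 0) (tailRows lam) = lam := by
  refine diagram_ext fun i => ?_
  rcases i with _ | i
  · exact rowLen_consRow_zero (rowLen_tailRows_zero_le lam)
  · rw [rowLen_consRow_succ, rowLen_tailRows]

lemma tailRows_consRow (a : ℕ) (lam : YoungDiagram) : tailRows (consRow a lam) = lam :=
  diagram_ext fun i => by rw [rowLen_tailRows, rowLen_consRow_succ]

lemma card_consRow {a : ℕ} {lam : YoungDiagram} (h : lam.rowLen 0 ≤ a) :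
    (consRow a lam).card = a + lam.card := by
  obtain ⟨M, hM⟩ := exists_rowLen_eq_zero lam
  rw [card_eq_sum_rowLen (M := M + 1), card_eq_sum_rowLen hM, Finset.sum_range_succ',
    rowLen_consRow_zero h, add_comm]
  · simp only [rowLen_consRow_succ]
  · intro i hi
    obtain ⟨i, rfl⟩ : ∃ j, i = j + 1 := ⟨i - 1, by omega⟩
    rw [rowLen_consRow_succ, hM i (by omega)]

lemma card_eq_rowLen_add (lam : YoungDiagram) :
    lam.card = lam.rowLen 0 + (tailRows lam).card := by
  conv_lhs => rw [← consRow_tailRows lam]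
  exact card_consRow (rowLen_tailRows_zero_le lam)

lemma eq_bot_of_rowLen {lam : YoungDiagram} (h : lam.rowLen 0 = 0) : lam = ⊥ :=
  diagram_ext fun i => by
    rw [rowLen_bot]
    have := lam.rowLen_anti 0 i (Nat.zero_le i)
    omega

lemma le_of_rowLen {lam mu : YoungDiagram} (h : ∀ i, lam.rowLen i ≤ mu.rowLen i) :
    lam ≤ mu := by
  rintro ⟨i, j⟩ hc
  rw [YoungDiagram.mem_iff_lt_rowLen] at hc ⊢
  exact hc.trans_le (h i)

lemma card_mono {lam mu : YoungDiagram} (h : lam ≤ mu) : lam.card ≤ mu.card :=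
  Finset.card_le_card (YoungDiagram.cells_subset_iff.2 h)

/-- The state of charge `p` labelled by the partition `lam`. -/
def mayaOf (p : ℤ) (lam : YoungDiagram) : Maya where
  occ := Set.range fun i : ℕ => p + lam.rowLen i - i
  finite_particles := by
    refine ((Finset.range (lam.rowLen 0 + p).toNat).finite_toSet.image
      fun i : ℕ => p + (lam.rowLen i : ℤ) - i).subset ?_
    rintro _ ⟨h, i, rfl⟩
    refine ⟨i, ?_, rfl⟩
    have := lam.rowLen_anti 0 i (Nat.zero_le i)
    rw [Finset.mem_coe, Finset.mem_range]
    simp only at h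
    omega
  finite_holes := by
    obtain ⟨M, hM⟩ := exists_rowLen_eq_zero lam
    refine (Set.finite_Ioc (p - M) 0).subset ?_
    rintro n ⟨h1, h2⟩
    refine ⟨?_, h1⟩
    by_contra h
    refine h2 ⟨(p - n).toNat, ?_⟩
    simp only
    rw [hM _ (by omega)]
    omega

lemma mem_mayaOf {p n : ℤ} {lam : YoungDiagram} :
    n ∈ (mayaOf p lam).occ ↔ ∃ i : ℕ, p + (lam.rowLen i : ℤ) - i = n := Iff.rfl

lemma mayaOf_bot (p : ℤ) : mayaOf p ⊥ = vac p := by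
  ext n
  rw [mem_mayaOf]
  change _ ↔ n ≤ p
  constructor
  · rintro ⟨i, rfl⟩
    rw [rowLen_bot]
    omega
  · intro h
    refine ⟨(p - n).toNat, ?_⟩
    rw [rowLen_bot]
    omega

lemma le_of_mem_mayaOf {p n : ℤ} {lam : YoungDiagram} (h : n ∈ (mayaOf p lam).occ) :
    n ≤ p + lam.rowLen 0 := by
  obtain ⟨i, rfl⟩ := mem_mayaOf.1 h
  have := lam.rowLen_anti 0 i (Nat.zero_le i)
  omega

lemma notMem_mayaOf {p : ℤ} {a : ℕ} {lam : YoungDiagram} (h : lam.rowLen 0 ≤ a) :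
    p + a ∉ (mayaOf (p - 1) lam).occ := fun h' => by
  have := le_of_mem_mayaOf h'
  omega

lemma mayaOf_consRow (p : ℤ) {a : ℕ} {lam : YoungDiagram} (h : lam.rowLen 0 ≤ a) :
    mayaOf p (consRow a lam) = (mayaOf (p - 1) lam).fill (p + a) := by
  ext n
  rw [Maya.mem_fill, mem_mayaOf, mem_mayaOf]
  constructor
  · rintro ⟨i, rfl⟩
    rcases i with _ | i
    · left
      rw [rowLen_consRow_zero h]
      simp
    · right
      refine ⟨i, ?_⟩
      rw [rowLen_consRow_succ]
      push_cast
      ring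
  · rintro (rfl | ⟨i, rfl⟩)
    · refine ⟨0, ?_⟩
      rw [rowLen_consRow_zero h]
      simp
    · refine ⟨i + 1, ?_⟩
      rw [rowLen_consRow_succ]
      push_cast
      ring

/-- Adding a first row is creating the topmost particle, with no sign. -/
lemma psi_mayaOf (p : ℤ) {a : ℕ} {lam : YoungDiagram} (h : lam.rowLen 0 ≤ a) :
    psi (-(p + a)) (ket (mayaOf (p - 1) lam)) = ket (mayaOf p (consRow a lam)) := by
  rw [psi_single, neg_neg, if_neg (notMem_mayaOf h), mayaOf_consRow p h]
  congr 1
  have : {b : ℤ | b ∈ (mayaOf (p - 1) lam).occ ∧ p + a < b} = ∅ := by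
    ext b
    simp only [Set.mem_ofPred_eq, Set.mem_empty_iff_false, iff_false, not_and, not_lt]
    intro hb
    have := le_of_mem_mayaOf hb
    omega
  rw [Maya.sign, this]
  simp

lemma vac_fill (p : ℤ) : vac p = (vac (p - 1)).fill p := by
  ext n
  rw [Maya.mem_fill]
  change n ≤ p ↔ n = p ∨ n ≤ p - 1
  omega

lemma chargeSum_vac (f : ℤ → ℝ) (p : ℤ) :
    chargeSum f (vac p) = chargeSum f (vac (p - 1)) + f p := by
  have h : p ∉ (vac (p - 1)).occ := by
    change ¬ p ≤ p - 1
    omega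
  rw [vac_fill p, chargeSum_fill f h]

lemma chargeSum_vac_zero (f : ℤ → ℝ) : chargeSum f (vac 0) = 0 := by
  have : ∀ n, f n * occNum (vac 0) n = 0 := fun n => by
    rw [occNum, show (vac 0).occ = {n | n ≤ 0} from rfl, Set.mem_ofPred_eq]
    split_ifs <;> simp
  simp [chargeSum, this]

lemma chargeSum_vac_of (f g : ℤ → ℝ) (h0 : g 0 = 0) (h : ∀ p, g p = g (p - 1) + f p) (p : ℤ) :
    chargeSum f (vac p) = g p := by
  induction p using Int.induction_on with
  | zero => rw [chargeSum_vac_zero, h0]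
  | succ i ih => rw [chargeSum_vac, h, add_sub_cancel_right, ih]
  | pred i ih =>
    rw [chargeSum_vac, h] at ih
    linarith

lemma chargeSum_mayaOf (f : ℤ → ℝ) {M : ℕ} : ∀ {p : ℤ} {lam : YoungDiagram},
    (∀ i, M ≤ i → lam.rowLen i = 0) → chargeSum f (mayaOf p lam) = chargeSum f (vac p) +
      ∑ i ∈ Finset.range M, (f (p + lam.rowLen i - i) - f (p - i)) := by
  induction M with
  | zero =>
    intro p lam hM
    rw [eq_bot_of_rowLen (hM 0 le_rfl), mayaOf_bot]
    simp
  | succ M ih =>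
    intro p lam hM
    have h := rowLen_tailRows_zero_le lam
    conv_lhs => rw [← consRow_tailRows lam]
    rw [mayaOf_consRow p h, chargeSum_fill _ (notMem_mayaOf h), ih fun i hi => by
      rw [rowLen_tailRows, hM _ (by omega)], Finset.sum_range_succ', chargeSum_vac f p]
    have : ∀ i : ℕ, f (p - 1 + (tailRows lam).rowLen i - i) - f (p - 1 - i) =
        f (p + lam.rowLen (i + 1) - (i + 1 : ℕ)) - f (p - (i + 1 : ℕ)) := by
      intro i
      rw [rowLen_tailRows]
      congr 2 <;> push_cast <;> ring
    simp only [this, Nat.cast_zero, sub_zero]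
    ring

/-- The charge of a state. -/
def charge (S : Maya) : ℝ := chargeSum (fun _ => 1) S

lemma charge_mayaOf (p : ℤ) (lam : YoungDiagram) : charge (mayaOf p lam) = p := by
  obtain ⟨M, hM⟩ := exists_rowLen_eq_zero lam
  rw [charge, chargeSum_mayaOf _ hM, chargeSum_vac_of _ (fun p => (p : ℝ)) (by simp) (by simp)]
  simp

lemma energy_vac (p : ℤ) : (energy (vac p) : ℝ) = (p : ℝ) * (p + 1) / 2 := by
  rw [energy_eq_chargeSum, chargeSum_vac_of _ (fun p : ℤ => (p : ℝ) * (p + 1) / 2) (by simp)]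
  intro p
  push_cast
  ring

lemma energy_mayaOf (p : ℤ) (lam : YoungDiagram) :
    energy (mayaOf p lam) = energy (vac p) + lam.card := by
  obtain ⟨M, hM⟩ := exists_rowLen_eq_zero lam
  have : (energy (mayaOf p lam) : ℝ) = energy (vac p) + lam.card := by
    rw [energy_eq_chargeSum, chargeSum_mayaOf _ hM, energy_eq_chargeSum, card_eq_sum_rowLen hM,
      Nat.cast_sum]
    congr 1
    refine Finset.sum_congr rfl fun i _ => ?_
    push_cast
    ring
  exact_mod_cast this

lemma wWeight_vac {q : ℝ} (hq : 0 < q) (p : ℤ) :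
    wWeight q (vac p) = q ^ ((p : ℝ) * (p + 1) * (2 * p + 1) / 12) := by
  rw [wWeight, chargeSum_vac_of _ (fun p : ℤ => (p : ℝ) * (p + 1) * (2 * p + 1) / 6) (by simp),
    Real.rpow_def_of_pos hq]
  · congr 1
    ring
  · intro p
    push_cast
    ring

lemma strictAnti_levels (p : ℤ) (lam : YoungDiagram) :
    StrictMono fun i : ℕ => -(p + (lam.rowLen i : ℤ) - i) := by
  intro i j hij
  have := lam.rowLen_anti i j hij.le
  simp only
  omega

lemma mayaOf_injective {p p' : ℤ} {lam lam' : YoungDiagram} (h : mayaOf p lam = mayaOf p' lam') :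
    p = p' ∧ lam = lam' := by
  have hp : p = p' := by
    have := congrArg charge h
    rw [charge_mayaOf, charge_mayaOf] at this
    exact_mod_cast this
  subst hp
  refine ⟨rfl, diagram_ext fun i => ?_⟩
  have h1 : (fun i : ℕ => -(p + (lam.rowLen i : ℤ) - i)) =
      fun i : ℕ => -(p + (lam'.rowLen i : ℤ) - i) := by
    rw [← StrictMono.range_inj (strictAnti_levels p lam) (strictAnti_levels p lam')]
    ext n
    have h2 := congrArg (fun S : Maya => -n ∈ S.occ) h
    simp only [mem_mayaOf] at h2
    simp only [Set.mem_range, neg_eq_iff_eq_neg]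
    rw [h2]
  have h3 := congrFun h1 i
  omega

/-- Every state is labelled by its charge and a partition. -/
lemma exists_eq_mayaOf (S : Maya) : ∃ p lam, S = mayaOf p lam := by
  -- The occupied levels are enumerated downwards from an upper bound `B`.
  obtain ⟨B, hB⟩ : ∃ B : ℤ, ∀ n ∈ S.occ, n ≤ B := by
    obtain ⟨B, hB⟩ := (S.finite_above 0).bddAbove
    refine ⟨max B 0, fun n hn => ?_⟩
    rcases le_or_gt n 0 with h | h
    · exact h.trans (le_max_right _ _)
    · exact (hB ⟨hn, h⟩).trans (le_max_left _ _)
  obtain ⟨b, hb⟩ : ∃ b : ℤ, ∀ n ≤ b, n ∈ S.occ := by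
    obtain ⟨b, hb⟩ := S.finite_holes.bddBelow
    refine ⟨min (b - 1) 0, fun n hn => ?_⟩
    by_contra h
    have := hb ⟨hn.trans (min_le_right _ _), h⟩
    omega
  set P : ℕ → Prop := fun j => B - j ∈ S.occ with hP
  set j₀ : ℕ := (B - b).toNat with hj₀
  have hPj : ∀ j, j₀ ≤ j → P j := fun j hj => hb _ (by omega)
  have hinf : (Set.ofPred P).Infinite := by
    refine (Set.Ici_infinite j₀).mono fun j hj => hPj j hj
  have hmono := Nat.nth_strictMono hinf
  have hrange := Nat.range_nth_of_infinite hinf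
  have hge : ∀ i, i ≤ Nat.nth P i := fun i => hmono.le_apply
  have hstep : ∀ i, j₀ ≤ i → Nat.nth P (i + 1) = Nat.nth P i + 1 := by
    intro i hi
    have h1 : Nat.nth P i + 1 ∈ Set.ofPred P := hPj _ (by have := hge i; omega)
    rw [← hrange] at h1
    obtain ⟨k, hk⟩ := h1
    have h2 : i < k := hmono.lt_iff_lt.1 (by omega)
    have h3 : Nat.nth P (i + 1) ≤ Nat.nth P k := hmono.monotone h2
    have h4 : Nat.nth P i < Nat.nth P (i + 1) := hmono (Nat.lt_succ_self i)
    omega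
  have hconst : ∀ i, j₀ ≤ i → (Nat.nth P i : ℤ) - i = Nat.nth P j₀ - j₀ := by
    intro i hi
    induction i, hi using Nat.le_induction with
    | base => rfl
    | succ i hi ih =>
      rw [hstep i hi, ← ih]
      push_cast
      ring
  have hmon : ∀ i j, i ≤ j → (Nat.nth P i : ℤ) - i ≤ Nat.nth P j - j := by
    intro i j hij
    induction j, hij using Nat.le_induction with
    | base => rfl
    | succ j hj ih =>
      have : Nat.nth P j < Nat.nth P (j + 1) := hmono (Nat.lt_succ_self j)
      push_cast
      omega
  set p : ℤ := B - (Nat.nth P j₀ - j₀) with hp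
  have hnn : ∀ i, (Nat.nth P i : ℤ) - i ≤ Nat.nth P j₀ - j₀ := by
    intro i
    rcases le_total j₀ i with h | h
    · exact (hconst i h).le
    · exact hmon i j₀ h
  set f : ℕ → ℕ := fun i => (B - Nat.nth P i + i - p).toNat with hf
  have hanti : Antitone f := fun i j hij => by
    have := hmon i j hij
    simp only [hf]
    omega
  have hf0 : ∀ i, j₀ ≤ i → f i = 0 := fun i hi => by
    have := hconst i hi
    simp only [hf]
    omega
  refine ⟨p, diagramOf f hanti j₀, ?_⟩
  ext n
  rw [mem_mayaOf]
  simp only [rowLen_diagramOf hanti hf0]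
  have hval : ∀ i : ℕ, p + (f i : ℤ) - i = B - Nat.nth P i := by
    intro i
    have := hnn i
    simp only [hf]
    omega
  simp only [hval]
  constructor
  · intro hn
    have h1 : (B - n).toNat ∈ Set.ofPred P := by
      change B - ((B - n).toNat : ℤ) ∈ S.occ
      have := hB n hn
      rwa [show B - ((B - n).toNat : ℤ) = n by omega]
    rw [← hrange] at h1
    obtain ⟨i, hi⟩ := h1
    have := hB n hn
    exact ⟨i, by omega⟩
  · rintro ⟨i, rfl⟩
    have h1 : Nat.nth P i ∈ Set.ofPred P := by
      rw [← hrange]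
      exact ⟨i, rfl⟩
    exact h1

/-! ### Adding horizontal strips -/

lemma energy_of_matEl_psi {b : ℤ} {S T : Maya} (h : matEl (psi b) S T ≠ 0) :
    (energy S : ℤ) = energy T - b := by
  rw [matEl, psi_single] at h
  split_ifs at h with hb
  · exact absurd rfl h
  · rw [Finsupp.single_apply] at h
    by_cases hS : T.fill (-b) = S
    · rw [← hS, energy_fill hb]
      ring
    · rw [if_neg hS] at h
      exact absurd rfl h

lemma psi_mem_lowSpace {b : ℤ} {M N : ℕ} {v : Fock} (hv : v ∈ lowSpace N) (h : (N : ℤ) - b ≤ M) :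
    psi b v ∈ lowSpace M := by
  rw [mem_lowSpace]
  intro S hS
  obtain ⟨T, hT, hST⟩ := exists_of_map_apply_ne_zero hS
  have h1 := mem_lowSpace.1 hv T hT
  have h2 := energy_of_matEl_psi hST
  omega

lemma psi_eq_zero {b : ℤ} {N : ℕ} {v : Fock} (hv : v ∈ lowSpace N) (h : (N : ℤ) < b) :
    psi b v = 0 := by
  ext S
  by_contra hS
  obtain ⟨T, hT, hST⟩ := exists_of_map_apply_ne_zero hS
  have h1 := mem_lowSpace.1 hv T hT
  have h2 := energy_of_matEl_psi hST
  omega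

lemma energyOp_psi (b : ℤ) (v : Fock) :
    energyOp (psi b v) = psi b (energyOp v) - (b : ℝ) • psi b v := by
  suffices h : energyOp * psi b = psi b * energyOp - (b : ℝ) • psi b from
    LinearMap.congr_fun h v
  refine linearMap_eq_of_matEl fun S T => ?_
  simp only [matEl, Module.End.mul_apply, LinearMap.sub_apply, energyOp, diag_single, map_smul,
    diag_apply, LinearMap.smul_apply, Finsupp.sub_apply, Finsupp.smul_apply, smul_eq_mul]
  by_cases h : psi b (ket T) S = 0
  · rw [h]; ring
  · have h1 := energy_of_matEl_psi h
    have h2 : (energy S : ℝ) = energy T - b := by exact_mod_cast h1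
    rw [h2]; ring

/-- The coefficients `x ^ k / k`: the corresponding vertex operator has the symbol
`1 / (1 - x z)`. -/
def stripCoeff (x : ℝ) (k : ℕ) : ℝ := x ^ k / k

lemma eulerCoeff_stripCoeff (x : ℝ) {k : ℕ} (hk : k ≠ 0) : eulerCoeff (stripCoeff x) k = x ^ k := by
  have : (k : ℝ) ≠ 0 := by exact_mod_cast hk
  rw [eulerCoeff, stripCoeff]
  field_simp

/-- The infinitesimal form of `vertexOp_psi_sub`: the commutator of `∑ x^k J_k` with
`ψ_b - x ψ_{b+1}` telescopes. -/
lemma lowerSum_psi_sub (x : ℝ) (b : ℤ) (v : Fock) :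
    lowerSum (eulerCoeff (stripCoeff x)) (psi b v - x • psi (b + 1) v) =
      psi b (lowerSum (eulerCoeff (stripCoeff x)) v) -
        x • psi (b + 1) (lowerSum (eulerCoeff (stripCoeff x)) v) + x • psi (b + 1) v := by
  obtain ⟨N, hN⟩ := exists_mem_lowSpace v
  set M := N + b.natAbs with hM
  have h1 : psi b v - x • psi (b + 1) v ∈ lowSpace M :=
    Submodule.sub_mem _ (psi_mem_lowSpace hN (by omega))
      (Submodule.smul_mem _ _ (psi_mem_lowSpace hN (by omega)))
  have h2 : v ∈ lowSpace M := lowSpace_mono (by omega) hN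
  rw [lowerSum_apply _ h1, lowerSum_apply _ h2, map_sum, map_sum, Finset.smul_sum,
    ← Finset.sum_sub_distrib, ← sub_eq_iff_eq_add', ← Finset.sum_sub_distrib]
  have tele : ∀ (g : ℕ → Fock) (M : ℕ), ∑ k ∈ Finset.Icc 1 M, (g k - g (k + 1)) =
      g 1 - g (M + 1) := by
    intro g M
    induction M with
    | zero => simp
    | succ M ih =>
      rw [Finset.sum_Icc_succ_top (by omega), ih]
      abel
  have h3 : psi (b + (M + 1 : ℕ)) v = 0 := psi_eq_zero hN (by omega)
  rw [Finset.sum_congr rfl (g := fun k : ℕ => x ^ k • psi (b + (k : ℕ)) v -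
    x ^ (k + 1) • psi (b + (k + 1 : ℕ)) v), tele (fun k : ℕ => x ^ k • psi (b + (k : ℕ)) v), h3]
  · simp
  · intro k hk
    rw [Finset.mem_Icc] at hk
    have hk0 : k ≠ 0 := by omega
    have hk1 : (k : ℤ) ≠ 0 := by omega
    rw [eulerCoeff_stripCoeff x hk0, map_sub, map_smul, map_smul, map_smul, cur_psi hk1,
      cur_psi hk1, smul_sub, smul_add, smul_add, smul_add, pow_succ, mul_smul,
      show b + 1 + (k : ℤ) = b + (k + 1 : ℕ) by push_cast; ring, smul_comm x (x ^ k)]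
    abel

/-- The relation between the vertex operator with symbol `1 / (1 - x z)` and the fermion modes. -/
lemma vertexOp_psi_sub (x : ℝ) (b : ℤ) (v : Fock) :
    vertexOp (stripCoeff x) (psi b v) = psi b (vertexOp (stripCoeff x) v) +
      x • vertexOp (stripCoeff x) (psi (b + 1) v) := by
  set G := vertexOp (stripCoeff x) with hG
  suffices h : G * (psi b - x • psi (b + 1)) - psi b * G = 0 by
    have h1 := LinearMap.congr_fun h v
    simp only [LinearMap.sub_apply, Module.End.mul_apply, LinearMap.smul_apply, map_sub, map_smul,
      LinearMap.zero_apply] at h1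
    rw [sub_sub, sub_eq_zero] at h1
    rw [h1, add_comm]
  have hF : ∀ v, (G * (psi b - x • psi (b + 1)) - psi b * G) v =
      G (psi b v - x • psi (b + 1) v) - psi b (G v) := fun v => rfl
  refine eq_zero_of_energyOp_right (eulerCoeff (stripCoeff x)) (-b) (fun v => ?_) fun S T hST => ?_
  · simp only [hF]
    have h1 : energyOp (psi b v - x • psi (b + 1) v) = psi b (energyOp v) -
        x • psi (b + 1) (energyOp v) - (b : ℝ) • (psi b v - x • psi (b + 1) v) +
        x • psi (b + 1) v := by
      rw [map_sub, map_smul, energyOp_psi, energyOp_psi]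
      push_cast
      simp only [smul_sub, add_smul, smul_add, one_smul, smul_comm x (b : ℝ)]
      abel
    rw [map_sub, hG, energyOp_vertexOp, h1, lowerSum_vertexOp_comm, lowerSum_psi_sub, energyOp_psi,
      energyOp_vertexOp, ← lowerSum_vertexOp_comm _ _ v]
    simp only [map_add, map_sub, map_smul, Int.cast_neg, neg_smul, smul_sub]
    abel
  · rw [matEl, hF, Finsupp.sub_apply, sub_eq_zero]
    have hT := ket_mem_lowSpace (le_refl (energy T))
    have h1 : psi b (ket T) - x • psi (b + 1) (ket T) ∈ lowSpace (energy S) :=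
      Submodule.sub_mem _ (psi_mem_lowSpace hT (by omega))
        (Submodule.smul_mem _ _ (psi_mem_lowSpace hT (by omega)))
    have h2 : psi (b + 1) (ket T) S = 0 := by
      by_contra h
      have := energy_of_matEl_psi h
      omega
    have hs : ∀ U, G (ket T) U ≠ 0 → U ∈ lowStates (energy T) := fun U hU =>
      mem_lowStates.2 (mem_lowSpace.1 (vertexOp_mem_lowSpace _ hT) U hU)
    rw [hG, vertexOp_apply_top _ h1 le_rfl, Finsupp.sub_apply, Finsupp.smul_apply, h2, smul_zero,
      sub_zero, ← hG, map_apply_eq_sum _ _ S hs, Finset.sum_eq_single T]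
    · have h3 := matEl_vertexOp_self (stripCoeff x) T
      rw [matEl, ← hG] at h3
      rw [h3, one_mul, matEl]
    · intro U _ hUT
      by_cases hz : matEl (psi b) S U = 0
      · rw [hz, mul_zero]
      · have h3 := energy_of_matEl_psi hz
        rw [hG, vertexOp_apply_top _ hT (by omega), Finsupp.single_apply, if_neg (Ne.symm hUT),
          zero_mul]
    · intro h
      exact absurd (mem_lowStates.2 le_rfl) h

/-- `lam / nu` is a horizontal strip. -/
def IsStrip (nu lam : YoungDiagram) : Prop :=
  ∀ i, nu.rowLen i ≤ lam.rowLen i ∧ lam.rowLen (i + 1) ≤ nu.rowLen i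

lemma IsStrip.le {nu lam : YoungDiagram} (h : IsStrip nu lam) : nu ≤ lam :=
  le_of_rowLen fun i => (h i).1

/-- The diagrams which arise from `lam` by removal of a horizontal strip. -/
def strips (lam : YoungDiagram) : Finset YoungDiagram :=
  Set.Finite.toFinset (s := {nu | IsStrip nu lam}) <| by
    refine Set.Finite.of_finite_image (f := YoungDiagram.cells) ?_
      fun a _ b _ h => YoungDiagram.ext h
    refine (lam.cells.powerset.finite_toSet).subset ?_
    rintro _ ⟨nu, hnu, rfl⟩
    rw [Finset.mem_coe, Finset.mem_powerset, YoungDiagram.cells_subset_iff]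
    exact IsStrip.le hnu

lemma mem_strips {nu lam : YoungDiagram} : nu ∈ strips lam ↔ IsStrip nu lam := by
  simp [strips]

lemma isStrip_consRow_iff {a : ℕ} {lam nu : YoungDiagram} (h : lam.rowLen 0 ≤ a) :
    IsStrip nu (consRow a lam) ↔
      lam.rowLen 0 ≤ nu.rowLen 0 ∧ nu.rowLen 0 ≤ a ∧ IsStrip (tailRows nu) lam := by
  constructor
  · intro hs
    refine ⟨?_, ?_, fun i => ?_⟩
    · have := (hs 0).2
      rwa [rowLen_consRow_succ] at this
    · have := (hs 0).1
      rwa [rowLen_consRow_zero h] at this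
    · have := hs (i + 1)
      rwa [rowLen_consRow_succ, rowLen_consRow_succ, ← rowLen_tailRows] at this
  · rintro ⟨h1, h2, h3⟩ i
    rcases i with _ | i
    · rw [rowLen_consRow_zero h, rowLen_consRow_succ]
      exact ⟨h2, h1⟩
    · rw [rowLen_consRow_succ, rowLen_consRow_succ, ← rowLen_tailRows]
      exact h3 i

/-- Ground states have no particle that can be lowered. -/
lemma vertexOp_vac (c : ℕ → ℝ) (p : ℤ) : vertexOp c (ket (vac p)) = ket (vac p) := by
  have h1 : lowerSum c (ket (vac p)) = 0 := by
    rw [lowerSum_apply c (ket_mem_lowSpace le_rfl)]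
    refine Finset.sum_eq_zero fun k hk => ?_
    rw [Finset.mem_Icc] at hk
    rw [cur, oneBody_ket (by omega), Finset.sum_eq_zero, smul_zero]
    intro n hn
    obtain ⟨h1, h2⟩ := mem_hops.1 hn
    exact absurd (show n - k ≤ p by have : n ≤ p := h1; omega) h2
  rw [vertexOp_apply c (ket_mem_lowSpace le_rfl), Finset.sum_eq_single 0]
  · simp
  · intro n _ hn
    obtain ⟨n, rfl⟩ := Nat.exists_eq_succ_of_ne_zero hn
    rw [pow_succ, Module.End.mul_apply, h1, map_zero, smul_zero]
  · simp

/-- The vertex operator with symbol `1 / (1 - x z)` removes horizontal strips. -/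
lemma vertexOp_stripCoeff (x : ℝ) (p : ℤ) (lam : YoungDiagram) :
    vertexOp (stripCoeff x) (ket (mayaOf p lam)) =
      ∑ nu ∈ strips lam, x ^ (lam.card - nu.card) • ket (mayaOf p nu) := by
  induction hn : lam.card using Nat.strong_induction_on generalizing p lam with
  | h n ih =>
  subst hn
  set a := lam.rowLen 0 with ha
  set mu := tailRows lam with hmu
  have hmua : mu.rowLen 0 ≤ a := rowLen_tailRows_zero_le lam
  have hlam : consRow a mu = lam := consRow_tailRows lam
  have hcard : lam.card = a + mu.card := card_eq_rowLen_add lam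
  rcases Nat.eq_zero_or_pos a with ha0 | ha0
  · have hbot : lam = ⊥ := eq_bot_of_rowLen ha0
    have hs : strips lam = {⊥} := by
      ext nu
      rw [mem_strips, Finset.mem_singleton]
      constructor
      · intro h
        exact eq_bot_of_rowLen (by have := (h 0).1; omega)
      · rintro rfl i
        rw [hbot]
        simp only [rowLen_bot]
        exact ⟨le_rfl, le_rfl⟩
    rw [hs, Finset.sum_singleton, hbot, mayaOf_bot, vertexOp_vac]
    simp
  -- Either the first row is untouched, or its last box can be removed first.
  conv_lhs => rw [← hlam, ← psi_mayaOf p hmua, vertexOp_psi_sub, ih mu.card (by omega) _ mu rfl]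
  rw [← Finset.sum_filter_add_sum_filter_not (strips lam) (fun nu => nu.rowLen 0 = a)]
  congr 1
  · rw [map_sum]
    refine Finset.sum_bij' (fun nu _ => consRow a nu) (fun nu _ => tailRows nu) ?_ ?_ ?_ ?_ ?_
    · intro nu hnu
      rw [mem_strips] at hnu
      have h1 : nu.rowLen 0 ≤ a := (hnu 0).1.trans hmua
      rw [Finset.mem_filter, mem_strips, ← hlam, isStrip_consRow_iff hmua, rowLen_consRow_zero h1,
        tailRows_consRow]
      exact ⟨⟨hmua, le_rfl, hnu⟩, rfl⟩
    · intro nu hnu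
      rw [Finset.mem_filter, mem_strips, ← hlam, isStrip_consRow_iff hmua] at hnu
      exact mem_strips.2 hnu.1.2.2
    · intro nu _
      exact tailRows_consRow a nu
    · intro nu hnu
      rw [Finset.mem_filter] at hnu
      rw [← hnu.2, consRow_tailRows]
    · intro nu hnu
      rw [mem_strips] at hnu
      have h1 : nu.rowLen 0 ≤ a := (hnu 0).1.trans hmua
      rw [map_smul, psi_mayaOf p h1, card_consRow h1, hcard, Nat.add_sub_add_left]
  · rcases lt_or_eq_of_le hmua with hlt | heq
    · have h1 : mu.rowLen 0 ≤ a - 1 := by omega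
      have h2 : -(p + (a : ℤ)) + 1 = -(p + (a - 1 : ℕ)) := by
        rw [Nat.cast_sub ha0]
        push_cast
        ring
      have h3 : (consRow (a - 1) mu).card = a - 1 + mu.card := card_consRow h1
      rw [h2, psi_mayaOf p h1, ih _ (by omega) _ _ rfl, Finset.smul_sum]
      refine Finset.sum_congr ?_ fun nu hnu => ?_
      · ext nu
        rw [Finset.mem_filter, mem_strips, mem_strips, ← hlam, isStrip_consRow_iff hmua,
          isStrip_consRow_iff h1]
        constructor
        · rintro ⟨h4, h5, h6⟩
          exact ⟨⟨h4, by omega, h6⟩, by omega⟩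
        · rintro ⟨⟨h4, h5, h6⟩, h7⟩
          exact ⟨h4, by omega, h6⟩
      · have h4 := card_mono (lam := nu) (mu := consRow (a - 1) mu) (by
          rw [Finset.mem_filter, mem_strips, ← hlam, isStrip_consRow_iff hmua] at hnu
          exact ((isStrip_consRow_iff h1).2 ⟨hnu.1.1, by omega, hnu.1.2.2⟩).le)
        rw [smul_smul, ← pow_succ']
        congr 2
        omega
    · have h1 : psi (-(p + (a : ℤ)) + 1) (ket (mayaOf (p - 1) mu)) = 0 := by
        rw [psi_single, if_pos]
        rw [mem_mayaOf]
        exact ⟨0, by rw [heq]; push_cast; ring⟩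
      rw [h1, map_zero, smul_zero, Finset.sum_eq_zero]
      intro nu hnu
      rw [Finset.mem_filter, mem_strips, ← hlam, isStrip_consRow_iff hmua] at hnu
      omega

lemma charge_of_matEl_cur {k : ℤ} (hk : k ≠ 0) {S T : Maya} (h : matEl (cur k) S T ≠ 0) :
    charge S = charge T := by
  obtain ⟨n, h1, h2, rfl⟩ := matEl_oneBody_ne_zero hk h
  rw [charge, chargeSum_hop _ h1 h2, sub_add_cancel, charge]

/-- Vertex operators preserve the charge. -/
lemma charge_of_matEl_vertexOp {c : ℕ → ℝ} {S T : Maya} (h : matEl (vertexOp c) S T ≠ 0) :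
    charge S = charge T := by
  have hlow : ∀ S U, matEl (lowerSum c) S U ≠ 0 → charge S = charge U := by
    intro S U h
    rw [matEl, lowerSum_apply _ (ket_mem_lowSpace le_rfl), Finsupp.finsetSum_apply] at h
    obtain ⟨k, hk, h'⟩ := Finset.exists_ne_zero_of_sum_ne_zero h
    rw [Finset.mem_Icc] at hk
    rw [Finsupp.smul_apply] at h'
    exact charge_of_matEl_cur (by omega) (right_ne_zero_of_smul h')
  have hpow : ∀ n S, (lowerSum c ^ n) (ket T) S ≠ 0 → charge S = charge T := by
    intro n
    induction n with
    | zero =>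
      intro S h
      rw [pow_zero, Module.End.one_apply, Finsupp.single_apply] at h
      by_cases hT : T = S
      · rw [hT]
      · rw [if_neg hT] at h
        exact absurd rfl h
    | succ n ih =>
      intro S h
      rw [pow_succ', Module.End.mul_apply] at h
      obtain ⟨U, hU, hSU⟩ := exists_of_map_apply_ne_zero h
      exact (hlow S U hSU).trans (ih U hU)
  rw [matEl, vertexOp_apply _ (ket_mem_lowSpace le_rfl), Finsupp.finsetSum_apply] at h
  obtain ⟨n, -, h'⟩ := Finset.exists_ne_zero_of_sum_ne_zero h
  rw [Finsupp.smul_apply] at h'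
  exact hpow n S (right_ne_zero_of_smul h')

/-! ### Schur functions as matrix elements of vertex operators -/

lemma isStrip_iff {nu lam : YoungDiagram} :
    IsStrip nu lam ↔ nu ≤ lam ∧ ∀ i j, (i + 1, j) ∈ lam → (i, j) ∈ nu := by
  constructor
  · intro h
    refine ⟨h.le, fun i j hc => ?_⟩
    rw [YoungDiagram.mem_iff_lt_rowLen] at hc ⊢
    exact hc.trans_le (h i).2
  · rintro ⟨h1, h2⟩ i
    constructor
    · by_contra h
      have h3 : (i, lam.rowLen i) ∈ nu := YoungDiagram.mem_iff_lt_rowLen.2 (not_le.1 h)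
      exact lt_irrefl _ (YoungDiagram.mem_iff_lt_rowLen.1 (h1 h3))
    · by_contra h
      have h3 : (i + 1, nu.rowLen i) ∈ lam := YoungDiagram.mem_iff_lt_rowLen.2 (not_le.1 h)
      exact lt_irrefl _ (YoungDiagram.mem_iff_lt_rowLen.1 (h2 i _ h3))

/-- The tableaux of shape `lam` with entries less than `n`. -/
def boundedTableaux (n : ℕ) (lam : YoungDiagram) : Finset (SemistandardYoungTableau lam) :=
  Set.Finite.toFinset (s := {T | ∀ c ∈ lam.cells, T c.1 c.2 < n}) <| by
    have : Finite {T : SemistandardYoungTableau lam | ∀ c ∈ lam.cells, T c.1 c.2 < n} := by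
      refine Finite.of_injective (β := lam.cells → Fin n)
        (fun T c => ⟨T.1 c.1.1 c.1.2, T.2 c.1 c.2⟩) fun T T' h => ?_
      refine Subtype.ext (SemistandardYoungTableau.ext fun i j => ?_)
      by_cases hc : (i, j) ∈ lam.cells
      · exact congrArg Fin.val (congrFun h ⟨(i, j), hc⟩)
      · have hc' : (i, j) ∉ lam := fun h => hc ((YoungDiagram.mem_cells _).2 h)
        rw [T.1.zeros hc', T'.1.zeros hc']
    exact Set.toFinite _

lemma mem_boundedTableaux {n : ℕ} {lam : YoungDiagram} {T : SemistandardYoungTableau lam} :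
    T ∈ boundedTableaux n lam ↔ ∀ i j, (i, j) ∈ lam → T i j < n := by
  simp [boundedTableaux]

/-- The shape formed by the entries less than `n` of a tableau. -/
def subShape (n : ℕ) {lam : YoungDiagram} (T : SemistandardYoungTableau lam) : YoungDiagram where
  cells := {c ∈ lam.cells | T c.1 c.2 < n}
  isLowerSet := by
    rintro ⟨i, j⟩ ⟨i', j'⟩ ⟨h1, h2⟩ h
    simp only [Finset.coe_filter, YoungDiagram.mem_cells, Set.mem_ofPred_eq] at h h1 h2 ⊢
    have hc : (i', j) ∈ lam := lam.up_left_mem h1 le_rfl h.1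
    exact ⟨lam.up_left_mem h1 h2 h.1, ((T.row_weak_of_le h2 hc).trans (T.col_weak h1 h.1)).trans_lt h.2⟩

lemma mem_subShape {n i j : ℕ} {lam : YoungDiagram} {T : SemistandardYoungTableau lam} :
    (i, j) ∈ subShape n T ↔ (i, j) ∈ lam ∧ T i j < n := by
  rw [← YoungDiagram.mem_cells, subShape, Finset.mem_filter, YoungDiagram.mem_cells]

/-- The restriction of a tableau to a smaller shape. -/
def restrictTableau {nu lam : YoungDiagram} (h : nu ≤ lam) (T : SemistandardYoungTableau lam) :
    SemistandardYoungTableau nu where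
  entry i j := if (i, j) ∈ nu then T i j else 0
  row_weak' {i j1 j2} hj hc := by
    rw [if_pos hc, if_pos (nu.up_left_mem le_rfl hj.le hc)]
    exact T.row_weak hj (h hc)
  col_strict' {i1 i2 j} hi hc := by
    rw [if_pos hc, if_pos (nu.up_left_mem hi.le le_rfl hc)]
    exact T.col_strict hi (h hc)
  zeros' hc := if_neg hc

/-- Fill a horizontal strip with the letter `n`. -/
def extendTableau {nu lam : YoungDiagram} (h : IsStrip nu lam) {n : ℕ}
    (T : SemistandardYoungTableau nu) (hT : ∀ i j, (i, j) ∈ nu → T i j < n) :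
    SemistandardYoungTableau lam where
  entry i j := if (i, j) ∈ nu then T i j else if (i, j) ∈ lam then n else 0
  row_weak' {i j1 j2} hj hc := by
    by_cases h2 : (i, j2) ∈ nu
    · rw [if_pos h2, if_pos (nu.up_left_mem le_rfl hj.le h2)]
      exact T.row_weak hj h2
    · rw [if_neg h2, if_pos hc]
      split_ifs with h1 h3
      · exact (hT i j1 h1).le
      · exact le_rfl
      · exact Nat.zero_le n
  col_strict' {i1 i2 j} hi hc := by
    have h1 : (i1, j) ∈ nu := (isStrip_iff.1 h).2 i1 j (lam.up_left_mem hi le_rfl hc)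
    rw [if_pos h1]
    by_cases h2 : (i2, j) ∈ nu
    · rw [if_pos h2]
      exact T.col_strict hi h2
    · rw [if_neg h2, if_pos hc]
      exact hT i1 j h1
  zeros' hc := by rw [if_neg fun h' => hc (h.le h'), if_neg hc]

/-- The Schur polynomial in the variables `x_0, …, x_{n-1}`. -/
def schurPoly (x : ℕ → ℝ) (n : ℕ) (lam : YoungDiagram) : ℝ :=
  ∑ T ∈ boundedTableaux n lam, ∏ c ∈ lam.cells, x (T c.1 c.2)

/-- The branching rule of Schur polynomials: removal of the largest letter. -/
lemma schurPoly_succ (x : ℕ → ℝ) (n : ℕ) (lam : YoungDiagram) :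
    schurPoly x (n + 1) lam =
      ∑ nu ∈ strips lam, x n ^ (lam.card - nu.card) * schurPoly x n nu := by
  rw [schurPoly, ← Finset.sum_fiberwise_of_maps_to (g := subShape n) (t := strips lam)]
  · refine Finset.sum_congr rfl fun nu hnu => ?_
    rw [mem_strips] at hnu
    have hle := hnu.le
    rw [schurPoly, Finset.mul_sum]
    have bdd : ∀ T ∈ boundedTableaux n nu, ∀ i j, (i, j) ∈ nu → T i j < n := fun T hT =>
      mem_boundedTableaux.1 hT
    refine Finset.sum_bij' (fun T _ => restrictTableau hle T)
      (fun T hT => extendTableau hnu T (bdd T hT)) ?_ ?_ ?_ ?_ ?_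
    · intro T hT
      rw [Finset.mem_filter] at hT
      rw [mem_boundedTableaux]
      intro i j hc
      change (if (i, j) ∈ nu then T i j else 0) < n
      rw [if_pos hc]
      rw [← hT.2, mem_subShape] at hc
      exact hc.2
    · intro T hT
      rw [Finset.mem_filter, mem_boundedTableaux]
      constructor
      · intro i j hc
        change (if (i, j) ∈ nu then T i j else if (i, j) ∈ lam then n else 0) < n + 1
        split_ifs with h1
        · exact (bdd T hT i j h1).trans (Nat.lt_succ_self n)
        · exact Nat.lt_succ_self n
      · refine SetLike.ext fun c => ?_
        obtain ⟨i, j⟩ := c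
        rw [mem_subShape]
        change (i, j) ∈ lam ∧ (if (i, j) ∈ nu then T i j else if (i, j) ∈ lam then n else 0) < n ↔ _
        constructor
        · rintro ⟨h1, h2⟩
          by_contra h3
          rw [if_neg h3, if_pos h1] at h2
          exact lt_irrefl _ h2
        · intro h1
          rw [if_pos h1]
          exact ⟨hle h1, bdd T hT i j h1⟩
    · intro T hT
      rw [Finset.mem_filter, mem_boundedTableaux] at hT
      ext i j
      change (if (i, j) ∈ nu then (if (i, j) ∈ nu then T i j else 0) else
        if (i, j) ∈ lam then n else 0) = T i j
      split_ifs with h1 h2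
      · rfl
      · rw [← hT.2, mem_subShape] at h1
        have := hT.1 i j h2
        by_contra h3
        exact h1 ⟨h2, by omega⟩
      · rw [T.zeros h2]
    · intro T hT
      ext i j
      change (if (i, j) ∈ nu then (if (i, j) ∈ nu then T i j else
        if (i, j) ∈ lam then n else 0) else 0) = T i j
      split_ifs with h1
      · rfl
      · rw [T.zeros h1]
    · intro T hT
      rw [Finset.mem_filter, mem_boundedTableaux] at hT
      have hsub : nu.cells ⊆ lam.cells := YoungDiagram.cells_subset_iff.2 hle
      rw [← Finset.prod_sdiff hsub]
      congr 1
      · rw [Finset.prod_congr rfl (g := fun _ => x n), Finset.prod_const,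
          Finset.card_sdiff_of_subset hsub]
        rintro ⟨i, j⟩ hc
        rw [Finset.mem_sdiff, YoungDiagram.mem_cells, YoungDiagram.mem_cells, ← hT.2,
          mem_subShape] at hc
        have := hT.1 i j hc.1
        congr 1
        by_contra h3
        exact hc.2 ⟨hc.1, by simp only at h3; omega⟩
      · refine Finset.prod_congr rfl ?_
        rintro ⟨i, j⟩ hc
        rw [YoungDiagram.mem_cells] at hc
        change _ = x (if (i, j) ∈ nu then T i j else 0)
        rw [if_pos hc]
  · intro T hT
    rw [mem_boundedTableaux] at hT
    rw [mem_strips, isStrip_iff]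
    constructor
    · rintro ⟨i, j⟩ hc
      exact (mem_subShape.1 hc).1
    · intro i j hc
      have h1 : T i j < T (i + 1) j := T.col_strict (Nat.lt_succ_self i) hc
      have h2 := hT _ _ hc
      exact mem_subShape.2 ⟨lam.up_left_mem (Nat.le_succ i) le_rfl hc, by omega⟩

/-- The power sums of `x_0, …, x_{n-1}`, divided by their degrees. -/
def powerSumCoeff (x : ℕ → ℝ) (n k : ℕ) : ℝ := ∑ i ∈ Finset.range n, stripCoeff (x i) k

lemma vertexOp_powerSumCoeff_succ (x : ℕ → ℝ) (n : ℕ) : vertexOp (powerSumCoeff x (n + 1)) =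
    vertexOp (powerSumCoeff x n) * vertexOp (stripCoeff (x n)) := by
  rw [← vertexOp_add]
  congr 1
  funext k
  exact Finset.sum_range_succ _ _

lemma vertexOp_zero : vertexOp (fun _ => 0) = 1 := by
  have h : lowerSum (fun _ => 0) = 0 := by
    refine LinearMap.ext fun v => ?_
    obtain ⟨N, hN⟩ := exists_mem_lowSpace v
    rw [lowerSum_apply _ hN]
    simp
  refine linearMap_eq_of_matEl fun S T => ?_
  rw [matEl, matEl, vertexOp_apply _ (ket_mem_lowSpace le_rfl), h, Finset.sum_eq_single 0]
  · simp
  · intro n _ hn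
    rw [zero_pow hn]
    simp
  · simp

/-- Branching of the matrix elements of a product of vertex operators. -/
lemma matEl_powerSumCoeff_succ (x : ℕ → ℝ) (n : ℕ) (S : Maya) (p : ℤ) (lam : YoungDiagram) :
    matEl (vertexOp (powerSumCoeff x (n + 1))) S (mayaOf p lam) =
      ∑ nu ∈ strips lam, x n ^ (lam.card - nu.card) *
        matEl (vertexOp (powerSumCoeff x n)) S (mayaOf p nu) := by
  rw [matEl, vertexOp_powerSumCoeff_succ, Module.End.mul_apply, vertexOp_stripCoeff, map_sum,
    Finsupp.finsetSum_apply]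
  exact Finset.sum_congr rfl fun nu _ => by rw [map_smul, Finsupp.smul_apply, smul_eq_mul, matEl]

lemma powerSumCoeff_zero (x : ℕ → ℝ) : powerSumCoeff x 0 = fun _ => 0 :=
  funext fun _ => Finset.sum_range_zero _

/-- Schur polynomials satisfy the same branching rule as the matrix elements. -/
lemma schurPoly_eq_matEl (x : ℕ → ℝ) (n : ℕ) (p : ℤ) (lam : YoungDiagram) :
    schurPoly x n lam = matEl (vertexOp (powerSumCoeff x n)) (vac p) (mayaOf p lam) := by
  induction n generalizing lam with
  | zero =>
    rw [powerSumCoeff_zero, vertexOp_zero, matEl, Module.End.one_apply, Finsupp.single_apply,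
      ← mayaOf_bot]
    by_cases h : lam = ⊥
    · subst h
      rw [if_pos rfl, schurPoly]
      have h1 : boundedTableaux 0 (⊥ : YoungDiagram) = {default} := by
        ext T
        rw [mem_boundedTableaux, Finset.mem_singleton]
        refine iff_of_true (fun i j h => absurd h (YoungDiagram.notMem_bot _)) ?_
        ext i j
        rw [T.zeros (YoungDiagram.notMem_bot _),
          SemistandardYoungTableau.zeros _ (YoungDiagram.notMem_bot _)]
      rw [h1, Finset.sum_singleton, YoungDiagram.cells_bot, Finset.prod_empty]
    · rw [if_neg fun h' => h (mayaOf_injective h').2, schurPoly, Finset.sum_eq_zero]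
      intro T hT
      rw [mem_boundedTableaux] at hT
      refine absurd (eq_bot_of_rowLen ?_) h
      by_contra h0
      exact Nat.not_lt_zero _ (hT 0 0 (YoungDiagram.mem_iff_lt_rowLen.2 (Nat.pos_of_ne_zero h0)))
  | succ n ih =>
    rw [schurPoly_succ, matEl_powerSumCoeff_succ]
    exact Finset.sum_congr rfl fun nu _ => by rw [ih]

open Filter Topology in
/-- The power sums of `a q^{1/2}, a q^{3/2}, …` are geometric series. -/
lemma tendsto_powerSumCoeff {q : ℝ} (hq0 : 0 < q) (hq1 : q < 1) (a : ℝ) {k : ℕ} (hk : k ≠ 0) :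
    Tendsto (fun n => powerSumCoeff (fun i => a * Real.sqrt q * q ^ i) n k) atTop
      (𝓝 (a ^ k * rhoCoeff q k)) := by
  have h1 := (hasSum_geometric_of_lt_one (pow_nonneg hq0.le k) (pow_lt_one₀ hq0.le hq1 hk)).mul_left
    (a ^ k * Real.sqrt q ^ k / k)
  have h2 := h1.tendsto_sum_nat
  refine (Tendsto.congr (fun n => ?_) h2).trans (le_of_eq ?_)
  · refine Finset.sum_congr rfl fun i _ => ?_
    rw [stripCoeff, mul_pow, mul_pow, ← pow_mul, ← pow_mul, mul_comm k i]
    ring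
  · rw [rhoCoeff, rpow_half hq0.le]
    congr 1
    field_simp

open Filter Topology in
lemma tendsto_vertexOp_rhoCoeff {q : ℝ} (hq0 : 0 < q) (hq1 : q < 1) (a : ℝ) (S T : Maya) :
    Tendsto (fun n => matEl (vertexOp (powerSumCoeff (fun i => a * Real.sqrt q * q ^ i) n)) S T)
      atTop (𝓝 (matEl (vertexOp fun k => a ^ k * rhoCoeff q k) S T)) :=
  tendsto_vertexOp (fun _ hk => tendsto_powerSumCoeff hq0 hq1 a hk) S T

lemma matEl_powerSumCoeff_nonneg {x : ℕ → ℝ} (hx : ∀ i, 0 ≤ x i) (n : ℕ) (S T : Maya) :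
    0 ≤ matEl (vertexOp (powerSumCoeff x n)) S T := by
  obtain ⟨p, lam, rfl⟩ := exists_eq_mayaOf T
  induction n generalizing lam with
  | zero =>
    rw [powerSumCoeff_zero, vertexOp_zero, matEl, Module.End.one_apply, Finsupp.single_apply]
    split_ifs <;> norm_num
  | succ n ih =>
    rw [matEl_powerSumCoeff_succ]
    exact Finset.sum_nonneg fun nu _ => mul_nonneg (pow_nonneg (hx n) _) (ih nu)

/-- The matrix elements of `G₊(q)` are nonnegative. -/
lemma matEl_rhoCoeff_nonneg {q : ℝ} (hq0 : 0 < q) (hq1 : q < 1) (S T : Maya) :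
    0 ≤ matEl (vertexOp (rhoCoeff q)) S T := by
  have h := tendsto_vertexOp_rhoCoeff hq0 hq1 1 S T
  simp only [one_pow, one_mul] at h
  exact ge_of_tendsto' h fun n => matEl_powerSumCoeff_nonneg
    (fun i => mul_nonneg (Real.sqrt_nonneg q) (pow_nonneg hq0.le i)) n S T

/-- The special values of Schur functions are the matrix elements of `G₊(q)` between a ground state
and a general state. -/
lemma hasSum_tableauWeight {q : ℝ} (hq0 : 0 < q) (hq1 : q < 1) (p : ℤ) (lam : YoungDiagram) :
    HasSum (fun T : SemistandardYoungTableau lam => tableauWeight q T)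
      (matEl (vertexOp (rhoCoeff q)) (vac p) (mayaOf p lam)) := by
  have hw : ∀ T : SemistandardYoungTableau lam, tableauWeight q T =
      ∏ c ∈ lam.cells, Real.sqrt q * q ^ (T c.1 c.2) := fun T =>
    Finset.prod_congr rfl fun c _ => by
      rw [Real.rpow_add hq0, Real.rpow_natCast, Real.sqrt_eq_rpow, mul_comm]
  have hnn : ∀ T : SemistandardYoungTableau lam, 0 ≤ tableauWeight q T := fun T =>
    Finset.prod_nonneg fun c _ => Real.rpow_nonneg hq0.le _
  have h := tendsto_vertexOp_rhoCoeff hq0 hq1 1 (vac p) (mayaOf p lam)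
  simp only [one_pow, one_mul, ← schurPoly_eq_matEl] at h
  have h' : Filter.Tendsto (fun n => ∑ T ∈ boundedTableaux n lam, tableauWeight q T) Filter.atTop
      (nhds (matEl (vertexOp (rhoCoeff q)) (vac p) (mayaOf p lam))) := by
    refine h.congr fun n => ?_
    exact Finset.sum_congr rfl fun T _ => (hw T).symm
  -- The tableaux with entries less than `n` exhaust all tableaux, and the weights are nonnegative.
  have hmono : Monotone fun n => boundedTableaux n lam := fun m n hmn T hT => by
    rw [mem_boundedTableaux] at hT ⊢
    exact fun i j hc => (hT i j hc).trans_le hmn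
  have hex : ∀ T : SemistandardYoungTableau lam, ∃ n, T ∈ boundedTableaux n lam := fun T =>
    ⟨(lam.cells.sup fun c => T c.1 c.2) + 1, mem_boundedTableaux.2 fun i j hc =>
      Nat.lt_succ_of_le (Finset.le_sup (f := fun c : ℕ × ℕ => T c.1 c.2)
        ((YoungDiagram.mem_cells _).2 hc))⟩
  have htend := Filter.tendsto_atTop_finset_of_monotone hmono hex
  have hsum : Summable fun T : SemistandardYoungTableau lam => tableauWeight q T := by
    refine summable_of_sum_le hnn (c := matEl (vertexOp (rhoCoeff q)) (vac p) (mayaOf p lam))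
      fun F => ?_
    obtain ⟨n, hn⟩ := (htend.eventually (Filter.eventually_ge_atTop F)).exists
    refine (Finset.sum_le_sum_of_subset_of_nonneg hn fun T _ _ => hnn T).trans ?_
    exact Monotone.ge_of_tendsto (f := fun n => ∑ T ∈ boundedTableaux n lam, tableauWeight q T)
      (fun m n hmn => Finset.sum_le_sum_of_subset_of_nonneg (hmono hmn) fun T _ _ => hnn T) h' n
  have := hsum.hasSum.comp htend
  rw [← tendsto_nhds_unique this h']
  exact hsum.hasSum

lemma schurRho_eq_matEl {q : ℝ} (hq0 : 0 < q) (hq1 : q < 1) (p : ℤ) (lam : YoungDiagram) :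
    schurRho q lam = matEl (vertexOp (rhoCoeff q)) (vac p) (mayaOf p lam) :=
  (hasSum_tableauWeight hq0 hq1 p lam).tsum_eq

/-! ### Convergence of the sums over intermediate states -/

/-- A diagram with at most `l` rows has at most as many extensions by a horizontal strip as there
are exponents `d_0, …, d_l`, the numbers of boxes added to the rows `0, …, l`. -/
lemma sum_isStrip_le {x : ℝ} (hx0 : 0 ≤ x) (hx1 : x < 1) {mu : YoungDiagram} {l : ℕ}
    (hmu : mu.rowLen l = 0) (F : Finset YoungDiagram) :
    ∑ lam ∈ F with IsStrip mu lam, x ^ (lam.card - mu.card) ≤ ((1 - x)⁻¹) ^ (l + 1) := by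
  have hmu' : ∀ i, l ≤ i → mu.rowLen i = 0 := fun i hi => by
    have := mu.rowLen_anti l i hi
    omega
  set M := F.sup YoungDiagram.card + 1 with hM
  set d : YoungDiagram → Fin (l + 1) → ℕ := fun lam i => lam.rowLen i - mu.rowLen i with hd
  set A : Finset YoungDiagram := {lam ∈ F | IsStrip mu lam} with hA
  have hstrip : ∀ lam ∈ A, IsStrip mu lam := fun lam h => (Finset.mem_filter.1 h).2
  have hzero : ∀ lam ∈ A, ∀ i, l + 1 ≤ i → lam.rowLen i = 0 := by
    intro lam h i hi
    obtain ⟨j, rfl⟩ : ∃ j, i = j + 1 := ⟨i - 1, by omega⟩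
    have h1 := (hstrip lam h j).2
    have h2 := hmu' j (by omega)
    omega
  have hinj : Set.InjOn d A := by
    intro lam h lam' h' he
    refine diagram_ext fun i => ?_
    rcases lt_or_ge i (l + 1) with hi | hi
    · have h1 := congrFun he ⟨i, hi⟩
      have h2 := (hstrip lam h i).1
      have h3 := (hstrip lam' h' i).1
      simp only [hd] at h1
      omega
    · rw [hzero lam h i hi, hzero lam' h' i hi]
  have hval : ∀ lam ∈ A, x ^ (lam.card - mu.card) = ∏ i, x ^ (d lam i) := by
    intro lam h
    rw [Finset.prod_pow_eq_pow_sum, card_eq_sum_rowLen (hzero lam h),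
      card_eq_sum_rowLen (M := l + 1) fun i hi => hmu' i (by omega), Finset.sum_range,
      Finset.sum_range]
    congr 1
    exact (Finset.sum_tsub_distrib Finset.univ (f := fun i : Fin (l + 1) => lam.rowLen i)
      (g := fun i : Fin (l + 1) => mu.rowLen i) fun i _ => (hstrip lam h i).1).symm
  have hmem : A.image d ⊆ Fintype.piFinset fun _ : Fin (l + 1) => Finset.range M := by
    intro e he
    obtain ⟨lam, h, rfl⟩ := Finset.mem_image.1 he
    rw [Fintype.mem_piFinset]
    intro i
    rw [Finset.mem_range, hM, Nat.lt_succ_iff]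
    refine le_trans ?_ (Finset.le_sup (f := YoungDiagram.card) (Finset.mem_filter.1 h).1)
    rw [card_eq_sum_rowLen (hzero lam h)]
    exact (Nat.sub_le _ _).trans (Finset.single_le_sum (f := fun i => lam.rowLen i)
      (fun _ _ => Nat.zero_le _) (Finset.mem_range.2 i.2))
  calc ∑ lam ∈ A, x ^ (lam.card - mu.card) = ∑ lam ∈ A, ∏ i, x ^ (d lam i) :=
        Finset.sum_congr rfl hval
    _ = ∑ e ∈ A.image d, ∏ i, x ^ (e i) :=
        (Finset.sum_image (f := fun e : Fin (l + 1) → ℕ => ∏ i, x ^ (e i)) hinj).symm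
    _ ≤ ∑ e ∈ Fintype.piFinset fun _ : Fin (l + 1) => Finset.range M, ∏ i, x ^ (e i) :=
        Finset.sum_le_sum_of_subset_of_nonneg hmem fun e _ _ =>
          Finset.prod_nonneg fun i _ => pow_nonneg hx0 _
    _ = (∑ j ∈ Finset.range M, x ^ j) ^ (l + 1) := by
        rw [← Finset.prod_univ_sum, Finset.prod_const, Finset.card_univ, Fintype.card_fin]
    _ ≤ ((1 - x)⁻¹) ^ (l + 1) := by
        refine pow_le_pow_left₀ (Finset.sum_nonneg fun j _ => pow_nonneg hx0 j) ?_ _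
        rw [← tsum_geometric_of_lt_one hx0 hx1]
        exact (summable_geometric_of_lt_one hx0 hx1).sum_le_tsum _ fun j _ => pow_nonneg hx0 j

/-- Each variable adds at most one row. -/
lemma rowLen_eq_zero_of_matEl {x : ℕ → ℝ} {p : ℤ} {nu : YoungDiagram} {l : ℕ}
    (hnu : nu.rowLen l = 0) (n : ℕ) {lam : YoungDiagram}
    (h : matEl (vertexOp (powerSumCoeff x n)) (mayaOf p nu) (mayaOf p lam) ≠ 0) :
    lam.rowLen (l + n) = 0 := by
  induction n generalizing lam with
  | zero =>
    rw [powerSumCoeff_zero, vertexOp_zero, matEl, Module.End.one_apply, Finsupp.single_apply] at h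
    by_cases h' : mayaOf p lam = mayaOf p nu
    · rw [(mayaOf_injective h').2]
      exact hnu
    · rw [if_neg h'] at h
      exact absurd rfl h
  | succ n ih =>
    rw [matEl_powerSumCoeff_succ] at h
    obtain ⟨mu, hmu, h'⟩ := Finset.exists_ne_zero_of_sum_ne_zero h
    have h1 := ih (right_ne_zero_of_mul h')
    have h2 := (mem_strips.1 hmu (l + n)).2
    rw [← add_assoc]
    omega

/-- The row sums of a product of `n` vertex operators, bounded by adding one strip at a time. -/
lemma sum_powerSumCoeff_le {x : ℕ → ℝ} (hx0 : ∀ i, 0 ≤ x i) (hx1 : ∀ i, x i < 1) (p : ℤ)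
    {nu : YoungDiagram} {l : ℕ} (hnu : nu.rowLen l = 0) (n : ℕ) (F : Finset YoungDiagram) :
    ∑ lam ∈ F, matEl (vertexOp (powerSumCoeff x n)) (mayaOf p nu) (mayaOf p lam) ≤
      ∏ i ∈ Finset.range n, ((1 - x i)⁻¹) ^ (l + i + 1) := by
  induction n generalizing F with
  | zero =>
    have h1 : ∀ lam, matEl (vertexOp (powerSumCoeff x 0)) (mayaOf p nu) (mayaOf p lam) =
        if lam = nu then 1 else 0 := by
      intro lam
      rw [powerSumCoeff_zero, vertexOp_zero, matEl, Module.End.one_apply, Finsupp.single_apply]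
      by_cases h : lam = nu
      · rw [if_pos (by rw [h]), if_pos h]
      · rw [if_neg fun h' => h (mayaOf_injective h').2, if_neg h]
    simp only [h1, Finset.sum_ite_eq', Finset.range_zero, Finset.prod_empty]
    split_ifs <;> norm_num
  | succ n ih =>
    set f := fun mu => matEl (vertexOp (powerSumCoeff x n)) (mayaOf p nu) (mayaOf p mu) with hf
    have hf0 : ∀ mu, 0 ≤ f mu := fun mu => matEl_powerSumCoeff_nonneg hx0 n _ _
    have h1 : ∀ lam ∈ F, matEl (vertexOp (powerSumCoeff x (n + 1))) (mayaOf p nu) (mayaOf p lam) =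
        ∑ mu ∈ F.biUnion strips, if IsStrip mu lam then x n ^ (lam.card - mu.card) * f mu else 0 := by
      intro lam hlam
      rw [matEl_powerSumCoeff_succ, ← Finset.sum_filter]
      refine Finset.sum_congr ?_ fun _ _ => rfl
      ext mu
      rw [mem_strips, Finset.mem_filter, Finset.mem_biUnion]
      exact ⟨fun h => ⟨⟨lam, hlam, mem_strips.2 h⟩, h⟩, fun h => h.2⟩
    rw [Finset.sum_congr rfl h1, Finset.sum_comm, Finset.prod_range_succ]
    calc ∑ mu ∈ F.biUnion strips, ∑ lam ∈ F,
          (if IsStrip mu lam then x n ^ (lam.card - mu.card) * f mu else 0)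
        ≤ ∑ mu ∈ F.biUnion strips, f mu * ((1 - x n)⁻¹) ^ (l + n + 1) := by
          refine Finset.sum_le_sum fun mu _ => ?_
          rw [← Finset.sum_filter, ← Finset.sum_mul, mul_comm]
          by_cases hz : f mu = 0
          · rw [hz, zero_mul, zero_mul]
          · exact mul_le_mul_of_nonneg_left (sum_isStrip_le (hx0 n) (hx1 n)
              (rowLen_eq_zero_of_matEl hnu n hz) F) (hf0 mu)
      _ = (∑ mu ∈ F.biUnion strips, f mu) * ((1 - x n)⁻¹) ^ (l + n + 1) := by
          rw [Finset.sum_mul]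
      _ ≤ _ := mul_le_mul_of_nonneg_right (ih _)
          (pow_nonneg (inv_nonneg.2 (sub_nonneg.2 (hx1 n).le)) _)

lemma exists_prod_le {θ q : ℝ} (hθ0 : 0 ≤ θ) (hθ1 : θ < 1) (hq0 : 0 < q) (hq1 : q < 1) (l : ℕ) :
    ∃ C, ∀ n, ∏ i ∈ Finset.range n, ((1 - θ * q ^ i)⁻¹) ^ (l + i + 1) ≤ C := by
  have hsum : Summable fun i : ℕ => ((l + 1 : ℝ) * q ^ i + (i : ℝ) ^ 1 * q ^ i) * (1 - θ)⁻¹ :=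
    (((summable_geometric_of_lt_one hq0.le hq1).mul_left _).add
      (summable_pow_mul_geometric_of_norm_lt_one 1 (by
        rwa [Real.norm_of_nonneg hq0.le]))).mul_right _
  refine ⟨Real.exp (∑' i : ℕ, ((l + 1 : ℝ) * q ^ i + (i : ℝ) ^ 1 * q ^ i) * (1 - θ)⁻¹), fun n => ?_⟩
  have h1θ : 0 < 1 - θ := sub_pos.2 hθ1
  refine le_trans ?_ (Real.exp_le_exp.2 (hsum.sum_le_tsum (Finset.range n) fun i _ => by positivity))
  rw [Real.exp_sum]
  refine Finset.prod_le_prod (fun i _ => ?_) fun i _ => ?_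
  · have : θ * q ^ i ≤ 1 := mul_le_one₀ hθ1.le (pow_nonneg hq0.le i) (pow_le_one₀ hq0.le hq1.le)
    exact pow_nonneg (inv_nonneg.2 (sub_nonneg.2 this)) _
  · have hqi0 : 0 ≤ q ^ i := pow_nonneg hq0.le i
    have hqi1 : q ^ i ≤ 1 := pow_le_one₀ hq0.le hq1.le
    have h2 : θ * q ^ i ≤ θ := mul_le_of_le_one_right hθ0 hqi1
    have h3 : (1 - θ * q ^ i)⁻¹ ≤ 1 + q ^ i * (1 - θ)⁻¹ := by
      have hpos : 0 < 1 - θ * q ^ i := by linarith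
      rw [inv_le_iff_one_le_mul₀ hpos]
      have h4 : 1 ≤ (1 - θ)⁻¹ * (1 - θ * q ^ i) := by
        rw [inv_mul_eq_div, le_div_iff₀ h1θ]
        linarith
      nlinarith
    calc ((1 - θ * q ^ i)⁻¹) ^ (l + i + 1) ≤ (Real.exp (q ^ i * (1 - θ)⁻¹)) ^ (l + i + 1) := by
          refine pow_le_pow_left₀ (inv_nonneg.2 (by linarith)) (h3.trans ?_) _
          rw [add_comm]
          exact Real.add_one_le_exp _
      _ = Real.exp (((l + 1 : ℝ) * q ^ i + (i : ℝ) ^ 1 * q ^ i) * (1 - θ)⁻¹) := by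
          rw [← Real.exp_nat_mul]
          congr 1
          push_cast
          ring

/-- The row sums of `G₊(q) a^{L_0}` converge. -/
lemma summable_vertexOp_powEnergy {q a : ℝ} (hq0 : 0 < q) (hq1 : q < 1) (ha0 : 0 ≤ a)
    (ha1 : a * Real.sqrt q < 1) (S : Maya) :
    Summable fun U : Maya => a ^ energy U * matEl (vertexOp (rhoCoeff q)) S U := by
  obtain ⟨p, nu, rfl⟩ := exists_eq_mayaOf S
  have hθ0 : 0 ≤ a * Real.sqrt q := mul_nonneg ha0 (Real.sqrt_nonneg q)
  obtain ⟨l, hl⟩ := exists_rowLen_eq_zero nu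
  obtain ⟨C, hC⟩ := exists_prod_le hθ0 ha1 hq0 hq1 l
  have hinj : Function.Injective (mayaOf p) := fun _ _ h => (mayaOf_injective h).2
  simp only [← matEl_vertexOp_scale]
  refine Summable.mul_left _ ?_
  rw [← hinj.summable_iff]
  · have hx0 : ∀ i, 0 ≤ a * Real.sqrt q * q ^ i := fun i => mul_nonneg hθ0 (pow_nonneg hq0.le i)
    have hx1 : ∀ i, a * Real.sqrt q * q ^ i < 1 := fun i =>
      (mul_le_of_le_one_right hθ0 (pow_le_one₀ hq0.le hq1.le)).trans_lt ha1
    refine summable_of_sum_le (c := C) (fun lam => ?_) fun F => ?_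
    · exact ge_of_tendsto' (tendsto_vertexOp_rhoCoeff hq0 hq1 a _ _) fun n =>
        matEl_powerSumCoeff_nonneg hx0 n _ _
    · exact le_of_tendsto' (tendsto_finsetSum F fun lam _ =>
        tendsto_vertexOp_rhoCoeff hq0 hq1 a (mayaOf p nu) (mayaOf p lam)) fun n =>
        (sum_powerSumCoeff_le hx0 hx1 p (hl l le_rfl) n F).trans (hC n)
  · intro U hU
    by_contra h
    obtain ⟨p', lam, rfl⟩ := exists_eq_mayaOf U
    have h1 := charge_of_matEl_vertexOp h
    rw [charge_mayaOf, charge_mayaOf] at h1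
    have h2 : p = p' := by exact_mod_cast h1
    exact hU ⟨lam, by rw [h2]⟩

/-- Convergence of the Cauchy sums `∑_U ⟨S| G₊(q₁) |U⟩ Q^{E(U)} ⟨U| G₋(q₂) |T⟩`. -/
lemma summable_cauchy {q₁ q₂ Q : ℝ} (h₁0 : 0 < q₁) (h₁1 : q₁ < 1) (h₂0 : 0 < q₂) (h₂1 : q₂ < 1)
    (hQ0 : 0 < Q) (hQ : Q * Real.sqrt (q₁ * q₂) < 1) (S T : Maya) :
    Summable fun U : Maya => matEl (vertexOp (rhoCoeff q₁)) S U * Q ^ energy U *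
      matEl (vertexOp (rhoCoeff q₂)) T U := by
  -- `Q = a b` with `a √q₁ = b √q₂ = θ < 1`.
  have hs₁ : 0 < Real.sqrt q₁ := Real.sqrt_pos.2 h₁0
  have hs₂ : 0 < Real.sqrt q₂ := Real.sqrt_pos.2 h₂0
  set θ := Real.sqrt (Q * Real.sqrt (q₁ * q₂)) with hθ
  have hθ0 : 0 ≤ θ := Real.sqrt_nonneg _
  have hθ1 : θ < 1 := by
    rw [hθ, Real.sqrt_lt' one_pos]
    simpa using hQ
  have hθθ : θ * θ = Q * (Real.sqrt q₁ * Real.sqrt q₂) := by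
    rw [hθ, Real.mul_self_sqrt (by positivity), Real.sqrt_mul h₁0.le]
  have hab : θ / Real.sqrt q₁ * (θ / Real.sqrt q₂) = Q := by
    rw [div_mul_div_comm, hθθ]
    field_simp
  have h1 := summable_vertexOp_powEnergy (a := θ / Real.sqrt q₁) h₁0 h₁1 (by positivity)
    (by rwa [div_mul_cancel₀ _ hs₁.ne']) S
  have h2 := summable_vertexOp_powEnergy (a := θ / Real.sqrt q₂) h₂0 h₂1 (by positivity)
    (by rwa [div_mul_cancel₀ _ hs₂.ne']) T
  have n1 : ∀ U, 0 ≤ (θ / Real.sqrt q₁) ^ energy U * matEl (vertexOp (rhoCoeff q₁)) S U := fun U =>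
    mul_nonneg (by positivity) (matEl_rhoCoeff_nonneg h₁0 h₁1 S U)
  have n2 : ∀ U, 0 ≤ (θ / Real.sqrt q₂) ^ energy U * matEl (vertexOp (rhoCoeff q₂)) T U := fun U =>
    mul_nonneg (by positivity) (matEl_rhoCoeff_nonneg h₂0 h₂1 T U)
  -- The diagonal of the absolutely convergent double sum.
  have h3 := (h1.mul_of_nonneg h2 n1 n2).comp_injective (i := fun U : Maya => (U, U))
    fun U V h => (Prod.mk.inj h).1
  refine h3.congr fun U => ?_
  simp only [Function.comp_apply]
  rw [← hab, mul_pow]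
  ring

/-! ### Fermion bilinears as operators on the Fock space -/

lemma matEl_id (S T : Maya) : matEl LinearMap.id S T = if S = T then 1 else 0 := by
  rw [matEl, LinearMap.id_apply, Finsupp.single_apply]
  simp only [eq_comm]

lemma matEl_normalOrd (m n : ℤ) (S T : Maya) : matEl (normalOrd m n) S T =
    matEl (psi m ∘ₗ psiStar n) S T -
      if S = T then matEl (psi m ∘ₗ psiStar n) (vac 0) (vac 0) else 0 := by
  rw [normalOrd, matEl, LinearMap.sub_apply, LinearMap.smul_apply, Finsupp.sub_apply,
    Finsupp.smul_apply, ← matEl, ← matEl, matEl_id, smul_eq_mul, mul_ite, mul_one, mul_zero]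

/-- A nonzero matrix element of `ψ_{m-n} ψ*_n` moves a particle from the level `n` to `n - m`. -/
lemma hop_of_matEl {m n : ℤ} (hm : m ≠ 0) {S T : Maya}
    (h : matEl (psi (m - n) ∘ₗ psiStar n) S T ≠ 0) :
    n ∈ hops m T ∧ (energy S : ℤ) = energy T - m := by
  rw [matEl, LinearMap.comp_apply] at h
  by_cases hn : n ∈ hops m T
  · refine ⟨hn, ?_⟩
    rw [psi_psiStar_ket hn, Finsupp.single_apply] at h
    by_cases hS : (T.empty n).fill (n - m) = S
    · obtain ⟨h1, h2⟩ := mem_hops.1 hn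
      rw [← hS, energy_fill (fun h => h2 (Maya.mem_empty.1 h).1), energy_empty h1]
      ring
    · rw [if_neg hS] at h
      exact absurd rfl h
  · rw [psi_psiStar_ket_eq_zero hm hn] at h
    exact absurd rfl h

lemma matEl_normalOrd_of_ne {m n : ℤ} (hm : m ≠ 0) (S T : Maya) :
    matEl (normalOrd (m - n) n) S T = matEl (psi (m - n) ∘ₗ psiStar n) S T := by
  rw [matEl_normalOrd]
  have : matEl (psi (m - n) ∘ₗ psiStar n) (vac 0) (vac 0) = 0 := by
    by_contra h
    have := (hop_of_matEl hm h).2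
    omega
  rw [this, ite_self, sub_zero]

lemma J_eq {m : ℤ} (hm : m ≠ 0) (S T : Maya) : J m S T = matEl (cur m) S T := by
  rw [cur, matEl_oneBody hm, J]
  refine tsum_congr fun n => ?_
  rw [matEl_normalOrd_of_ne hm, one_zpow, one_mul]

lemma energy_of_J {m : ℤ} (hm : m ≠ 0) {S T : Maya} (h : J m S T ≠ 0) :
    (energy S : ℤ) = energy T - m := by
  rw [J_eq hm] at h
  exact energy_of_matEl_oneBody h

lemma matEl_normalOrd_self (n : ℤ) (S T : Maya) : matEl (normalOrd (-n) n) S T =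
    if S = T then occNum T n else 0 := by
  have key : ∀ S T : Maya, matEl (psi (-n) ∘ₗ psiStar n) S T =
      if S = T then (if n ∈ T.occ then 1 else 0) else 0 := by
    intro S T
    rw [matEl, LinearMap.comp_apply, psi_psiStar_ket_self, Finsupp.smul_apply, Finsupp.single_apply]
    by_cases h : S = T
    · rw [h, if_pos rfl, if_pos rfl, smul_eq_mul, mul_one]
    · rw [if_neg h, if_neg (Ne.symm h), smul_zero]
  rw [matEl_normalOrd, key, key, if_pos rfl]
  by_cases h : S = T
  · rw [if_pos h, if_pos h, if_pos h, occNum]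
    congr 1
    by_cases h0 : n ≤ 0
    · rw [if_pos h0, if_pos (show n ∈ (vac 0).occ from h0)]
    · rw [if_neg h0, if_neg (show n ∉ (vac 0).occ from h0)]
  · rw [if_neg h, if_neg h, if_neg h, sub_zero]

lemma tsum_normalOrd_self (f : ℤ → ℝ) (S T : Maya) :
    ∑' n : ℤ, f n * matEl (normalOrd (-n) n) S T = if S = T then chargeSum f T else 0 := by
  simp only [matEl_normalOrd_self, mul_ite, mul_zero]
  split_ifs with h
  · rfl
  · exact tsum_zero

/-- The diagonal bilinear `∑ n, f n :ψ_{-n} ψ*_n:`. -/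
lemma bilin_diag (f : ℤ → ℝ) :
    bilin (fun m n => if m = -n then f n else 0) =
      fun S T => if S = T then chargeSum f T else 0 := by
  funext S T
  rw [bilin, ← tsum_normalOrd_self,
    ← Function.Injective.tsum_eq (g := fun n : ℤ => (-n, n)) fun a b h => (Prod.mk.inj h).2]
  · simp
  · rintro ⟨m, n⟩ h
    refine ⟨n, ?_⟩
    by_contra hne
    rw [Function.mem_support] at h
    refine h ?_
    rw [if_neg, zero_mul]
    intro h'
    exact hne (Prod.ext (Eq.symm h') rfl)

/-- The energy difference of the two states selects one term of a sum of currents. -/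
lemma currentSum_eq_of {R : Type*} [CommRing R] [TopologicalSpace R] [Algebra ℝ R]
    {i : ℕ+ → ℤ} (hi : Function.Injective i) (hi0 : ∀ k, i k ≠ 0) (c : ℕ+ → R) {S T : Maya} {k : ℕ+}
    (hk : (energy S : ℤ) = energy T - i k) : currentSum i c S T = matEl (cur (i k)) S T • c k := by
  rw [← J_eq (hi0 k), currentSum]
  refine tsum_eq_single k fun j hj => ?_
  rw [show J (i j) S T = 0 from ?_, zero_smul]
  by_contra h
  have h1 := energy_of_J (hi0 j) h
  exact hj (hi (by omega))

lemma currentSum_eq_zero {R : Type*} [CommRing R] [TopologicalSpace R] [Algebra ℝ R]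
    {i : ℕ+ → ℤ} (hi0 : ∀ k, i k ≠ 0) (c : ℕ+ → R) {S T : Maya}
    (h : ∀ k, (energy S : ℤ) ≠ energy T - i k) : currentSum i c S T = 0 := by
  have : ∀ k, J (i k) S T • c k = 0 := fun k => by
    rw [show J (i k) S T = 0 from ?_, zero_smul]
    by_contra h'
    exact h k (energy_of_J (hi0 k) h')
  rw [currentSum]
  simp only [this, tsum_zero]

lemma matEl_lowerSum_of_eq (c : ℕ → ℝ) {S T : Maya} {k : ℕ} (hk : k ≠ 0)
    (h : energy T = energy S + k) : matEl (lowerSum c) S T = c k * matEl (cur (k : ℤ)) S T := by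
  rw [matEl, lowerSum_apply c (ket_mem_lowSpace le_rfl), Finsupp.finsetSum_apply,
    Finset.sum_eq_single k]
  · rfl
  · intro j _ hj
    rw [Finsupp.smul_apply, smul_eq_mul]
    by_contra h'
    have := energy_of_matEl_oneBody (right_ne_zero_of_mul h')
    omega
  · intro h'
    exact absurd (Finset.mem_Icc.2 ⟨by omega, by omega⟩) h'

lemma matEl_lowerSum_eq_zero (c : ℕ → ℝ) {S T : Maya} (h : energy T ≤ energy S) :
    matEl (lowerSum c) S T = 0 := by
  by_contra h'
  rcases Nat.eq_zero_or_pos (energy T) with h0 | h0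
  · rw [matEl, lowerSum_eq_zero c (ket_mem_lowSpace (N := 0) h0.le)] at h'
    exact h' rfl
  · have := mem_lowSpace.1 (lowerSum_mem_lowSpace c (M := energy T - 1)
      (ket_mem_lowSpace (le_refl (energy T))) (by omega)) S h'
    omega

lemma injective_natCast_pnat : Function.Injective fun k : ℕ+ => ((k : ℕ) : ℤ) :=
  fun _ _ h => PNat.coe_injective (Int.ofNat_inj.1 h)

lemma injective_neg_natCast_pnat : Function.Injective fun k : ℕ+ => -((k : ℕ) : ℤ) :=
  fun _ _ h => injective_natCast_pnat (neg_injective h)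

lemma currentSum_pos (c : ℕ → ℝ) :
    currentSum (fun k => ((k : ℕ) : ℤ)) (fun k : ℕ+ => c k) = matEl (lowerSum c) := by
  have h0 : ∀ k : ℕ+, ((k : ℕ) : ℤ) ≠ 0 := fun k => by exact_mod_cast k.ne_zero
  funext S T
  rcases lt_or_ge (energy S) (energy T) with h | h
  · have hpos : 0 < energy T - energy S := by omega
    rw [currentSum_eq_of (k := ⟨_, hpos⟩) injective_natCast_pnat h0 _
        (by simp only [PNat.mk_coe]; omega),
      matEl_lowerSum_of_eq c hpos.ne' (by omega), smul_eq_mul, mul_comm]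
    rfl
  · rw [matEl_lowerSum_eq_zero c h, currentSum_eq_zero h0]
    intro k
    have := k.pos
    omega

lemma currentSum_transpose {R : Type*} [CommRing R] [TopologicalSpace R] [Algebra ℝ R]
    {i : ℕ+ → ℤ} (hi0 : ∀ k, i k ≠ 0) (c : ℕ+ → R) (S T : Maya) :
    currentSum (fun k => -i k) c S T = currentSum i c T S := by
  refine tsum_congr fun k => ?_
  rw [J_eq (neg_ne_zero.2 (hi0 k)), J_eq (hi0 k), matEl_cur_transpose, neg_neg]

lemma currentSum_neg (c : ℕ → ℝ) :
    currentSum (fun k => -((k : ℕ) : ℤ)) (fun k : ℕ+ => c k) =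
      fun S T => matEl (lowerSum c) T S := by
  have h0 : ∀ k : ℕ+, ((k : ℕ) : ℤ) ≠ 0 := fun k => by exact_mod_cast k.ne_zero
  funext S T
  rw [currentSum_transpose h0, currentSum_pos]

/-- Linear combinations of currents are fermion bilinears. -/
lemma bilin_current {i : ℕ+ → ℤ} (hi : Function.Injective i) (hi0 : ∀ k, i k ≠ 0) (c : ℕ+ → ℝ) :
    bilin (fun m n => if h : ∃ k, i k = m + n then c h.choose else 0) = currentSum i c := by
  funext S T
  by_cases hST : ∃ k, (energy S : ℤ) = energy T - i k
  · obtain ⟨k, hk⟩ := hST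
    rw [currentSum_eq_of hi hi0 c hk, bilin, matEl_oneBody (hi0 k), smul_eq_mul, mul_comm,
      ← tsum_mul_left, ← Function.Injective.tsum_eq (g := fun n : ℤ => (i k - n, n))
        fun a b h => (Prod.mk.inj h).2]
    · refine tsum_congr fun n => ?_
      have hex : ∃ j, i j = i k - n + n := ⟨k, by ring⟩
      have hch : hex.choose = k := hi (by rw [hex.choose_spec]; ring)
      rw [dif_pos hex, hch, matEl_normalOrd_of_ne (hi0 k), one_zpow, one_mul]
    · rintro ⟨m, n⟩ h
      rw [Function.mem_support] at h
      simp only at h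
      split_ifs at h with hex
      · obtain ⟨j, hj⟩ := hex
        have h1 := right_ne_zero_of_mul h
        have hm : m = i j - n := by omega
        rw [hm, matEl_normalOrd_of_ne (hi0 j)] at h1
        have h2 := (hop_of_matEl (hi0 j) h1).2
        exact ⟨n, by simp only [Prod.mk.injEq, and_true]; omega⟩
      · rw [zero_mul] at h
        exact absurd rfl h
  · rw [not_exists] at hST
    rw [currentSum_eq_zero hi0 c hST, bilin]
    have : ∀ mn : ℤ × ℤ, (if h : ∃ k, i k = mn.1 + mn.2 then c h.choose else 0) *
        matEl (normalOrd mn.1 mn.2) S T = 0 := by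
      rintro ⟨m, n⟩
      simp only
      split_ifs with hex
      · obtain ⟨j, hj⟩ := id hex
        have hm : m = i j - n := by omega
        have h0 : matEl (normalOrd m n) S T = 0 := by
          rw [hm, matEl_normalOrd_of_ne (hi0 j)]
          by_contra h1
          exact hST j (hop_of_matEl (hi0 j) h1).2
        rw [h0, mul_zero]
      · rw [zero_mul]
    simp only [this, tsum_zero]

/-! ### Exponentials of operators -/

lemma matEl_mul (A B : Module.End ℝ Fock) : Op.mul (matEl A) (matEl B) = matEl (A * B) := by
  funext S T
  rw [Op.mul, matEl, Module.End.mul_apply,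
    map_apply_eq_sum A _ S (s := (B (ket T)).support) fun U hU => Finsupp.mem_support_iff.2 hU,
    tsum_eq_sum (s := (B (ket T)).support)]
  · exact Finset.sum_congr rfl fun U _ => mul_comm _ _
  · intro U hU
    rw [show matEl B U T = 0 from Finsupp.notMem_support_iff.1 hU, mul_zero]

lemma matEl_one : (Op.one : Op ℝ) = matEl 1 := by
  funext S T
  exact (matEl_id S T).symm

lemma pow_matEl (A : Module.End ℝ Fock) (n : ℕ) : Op.pow (matEl A) n = matEl (A ^ n) := by
  induction n with
  | zero => rw [pow_zero, ← matEl_one]; rfl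
  | succ n ih => rw [pow_succ, ← matEl_mul, ← ih]; rfl

lemma composable_matEl (A : Op ℝ) (B : Module.End ℝ Fock) : Op.Composable A (matEl B) := fun S T =>
  summable_of_ne_finset_zero (s := (B (ket T)).support) fun U hU => by
    rw [show matEl B U T = 0 from Finsupp.notMem_support_iff.1 hU, mul_zero]

lemma pow_transpose (A : Module.End ℝ Fock) (n : ℕ) :
    Op.pow (fun S T => matEl A T S) n = fun S T => matEl (A ^ n) T S := by
  induction n with
  | zero =>
    funext S T
    rw [pow_zero, ← matEl_one]
    simp only [Op.pow, Op.one, eq_comm]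
  | succ n ih =>
    rw [pow_succ', ← matEl_mul]
    funext S T
    rw [Op.pow, ih]
    exact tsum_congr fun U => mul_comm _ _

lemma matEl_lowerSum_pow_eq_zero (c : ℕ → ℝ) {n : ℕ} {S T : Maya} (h : energy T < n) :
    matEl (lowerSum c ^ n) S T = 0 := by
  rw [matEl, lowerSum_pow_eq_zero c (ket_mem_lowSpace le_rfl) h]
  rfl

lemma sum_matEl_lowerSum_pow (c : ℕ → ℝ) (S T : Maya) :
    ∑' n : ℕ, ((n.factorial : ℝ)⁻¹) • matEl (lowerSum c ^ n) S T = matEl (vertexOp c) S T := by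
  rw [matEl, vertexOp_apply c (ket_mem_lowSpace (le_refl (energy T))), Finsupp.finsetSum_apply,
    tsum_eq_sum (s := Finset.range (energy T + 1))]
  · rfl
  · intro n hn
    rw [Finset.mem_range] at hn
    rw [matEl_lowerSum_pow_eq_zero c (by omega), smul_zero]

lemma summable_matEl_lowerSum_pow (c : ℕ → ℝ) (S T : Maya) :
    Summable fun n : ℕ => ((n.factorial : ℝ)⁻¹) • matEl (lowerSum c ^ n) S T :=
  summable_of_ne_finset_zero (s := Finset.range (energy T + 1)) fun n hn => by
    rw [Finset.mem_range] at hn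
    rw [matEl_lowerSum_pow_eq_zero c (by omega), smul_zero]

lemma exp_lowerSum (c : ℕ → ℝ) : Op.exp (matEl (lowerSum c)) = matEl (vertexOp c) := by
  funext S T
  simp only [Op.exp, pow_matEl]
  exact sum_matEl_lowerSum_pow c S T

lemma expConverges_lowerSum (c : ℕ → ℝ) : Op.ExpConverges (matEl (lowerSum c)) := by
  refine ⟨fun n => composable_matEl _ _, fun S T => ?_⟩
  simp only [pow_matEl]
  exact summable_matEl_lowerSum_pow c S T

lemma exp_lowerSum_transpose (c : ℕ → ℝ) :
    Op.exp (fun S T => matEl (lowerSum c) T S) = fun S T => matEl (vertexOp c) T S := by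
  funext S T
  simp only [Op.exp, pow_transpose]
  exact sum_matEl_lowerSum_pow c T S

lemma expConverges_lowerSum_transpose (c : ℕ → ℝ) :
    Op.ExpConverges (fun S T => matEl (lowerSum c) T S) := by
  refine ⟨fun n S T => ?_, fun S T => ?_⟩
  · simp only [pow_transpose]
    exact (composable_matEl (matEl (lowerSum c)) (lowerSum c ^ n) T S).congr fun U => mul_comm _ _
  · simp only [pow_transpose]
    exact summable_matEl_lowerSum_pow c T S

lemma matEl_diag (d : Maya → ℝ) (S T : Maya) : matEl (diag d) S T = if S = T then d T else 0 := by
  rw [matEl, diag_single, Finsupp.smul_apply, Finsupp.single_apply]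
  by_cases h : S = T
  · rw [if_pos h, if_pos h.symm, smul_eq_mul, mul_one]
  · rw [if_neg h, if_neg (Ne.symm h), smul_zero]

lemma diag_pow (d : Maya → ℝ) (n : ℕ) : diag d ^ n = diag fun S => d S ^ n := by
  induction n with
  | zero =>
    refine linearMap_eq_of_matEl fun S T => ?_
    rw [pow_zero, matEl_diag, pow_zero]
    exact matEl_id S T
  | succ n ih =>
    refine linearMap_eq_of_matEl fun S T => ?_
    rw [pow_succ, ih, matEl, Module.End.mul_apply, diag_single, map_smul, diag_single, smul_smul,
      ← diag_single (fun S => d S * d S ^ n), ← matEl, matEl_diag, matEl_diag, pow_succ']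

lemma hasSum_exp_diag (d : Maya → ℝ) (S T : Maya) :
    HasSum (fun n : ℕ => ((n.factorial : ℝ)⁻¹) • Op.pow (matEl (diag d)) n S T)
      (if S = T then Real.exp (d T) else 0) := by
  simp only [pow_matEl, diag_pow, matEl_diag]
  split_ifs with h
  · rw [Real.exp_eq_exp_ℝ]
    refine (NormedSpace.expSeries_div_hasSum_exp (d T)).congr_fun ?_
    intro n
    rw [smul_eq_mul, div_eq_inv_mul]
  · simp

lemma exp_diag (d : Maya → ℝ) :
    Op.exp (matEl (diag d)) = fun S T => if S = T then Real.exp (d T) else 0 := by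
  funext S T
  exact (hasSum_exp_diag d S T).tsum_eq

lemma expConverges_diag (d : Maya → ℝ) : Op.ExpConverges (matEl (diag d)) :=
  ⟨fun _ => composable_matEl _ _, fun S T => (hasSum_exp_diag d S T).summable⟩

/-! ### The operator `g` -/

lemma gCoeff_eq (q : ℝ) : gCoeff q = fun k : ℕ+ => rhoCoeff q k := rfl

lemma Gplus_eq (q : ℝ) : Gplus q = matEl (vertexOp (rhoCoeff q)) := by
  rw [Gplus, gCoeff_eq, currentSum_pos, exp_lowerSum]

lemma Gminus_eq (q : ℝ) : Gminus q = fun S T => matEl (vertexOp (rhoCoeff q)) T S := by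
  rw [Gminus, gCoeff_eq, currentSum_neg, exp_lowerSum_transpose]

lemma mul_diagonal (a : ℝ) (f : ℤ → ℝ) :
    (fun S T => a * ∑' n : ℤ, f n * matEl (normalOrd (-n) n) S T) =
      matEl (diag fun T => a * chargeSum f T) := by
  funext S T
  rw [tsum_normalOrd_self, matEl_diag, mul_ite, mul_zero]

lemma qW0half_eq (q : ℝ) : qW0half q = fun S T => if S = T then wWeight q T else 0 := by
  rw [qW0half]
  unfold W0
  rw [mul_diagonal (Real.log q / 2) fun n => (n : ℝ) ^ 2, exp_diag]
  rfl

lemma QL0_eq {Q : ℝ} (hQ : 0 < Q) : QL0 Q = fun S T => if S = T then Q ^ energy T else 0 := by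
  rw [QL0]
  unfold L0
  rw [mul_diagonal (Real.log Q) fun n => (n : ℝ), exp_diag]
  funext S T
  congr 1
  rw [← energy_eq_chargeSum, mul_comm, ← Real.log_pow, Real.exp_log (pow_pos hQ _)]

/-- `A` is the exponential of a fermion bilinear and the exponential series converges. -/
def IsExpBilin (A : Op ℝ) : Prop :=
  ∃ a : ℤ → ℤ → ℝ, Op.ExpConverges (bilin a) ∧ A = Op.exp (bilin a)

lemma IsGLInf.mul {g A : Op ℝ} (hg : IsGLInf g) (hA : IsExpBilin A) (hc : Op.Composable g A) :
    IsGLInf (g ⊚ A) := by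
  obtain ⟨a, ha, rfl⟩ := hA
  exact IsGLInf.mul_exp g a hg ha hc

lemma isExpBilin_Gplus (q : ℝ) : IsExpBilin (Gplus q) := by
  refine ⟨_, ?_, by rw [bilin_current (c := gCoeff q) injective_natCast_pnat fun k => by
    exact_mod_cast k.ne_zero]; rfl⟩
  rw [bilin_current injective_natCast_pnat fun k => by exact_mod_cast k.ne_zero, gCoeff_eq,
    currentSum_pos]
  exact expConverges_lowerSum _

lemma isExpBilin_Gminus (q : ℝ) : IsExpBilin (Gminus q) := by
  have h0 : ∀ k : ℕ+, -((k : ℕ) : ℤ) ≠ 0 := fun k => by simp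
  refine ⟨_, ?_, by rw [bilin_current (c := gCoeff q) injective_neg_natCast_pnat h0]; rfl⟩
  rw [bilin_current injective_neg_natCast_pnat h0, gCoeff_eq, currentSum_neg]
  exact expConverges_lowerSum_transpose _

lemma isExpBilin_diagonal (a : ℝ) (f : ℤ → ℝ) :
    IsExpBilin (Op.exp fun S T => a * ∑' n : ℤ, f n * matEl (normalOrd (-n) n) S T) := by
  have h : bilin (fun m n => if m = -n then a * f n else 0) =
      matEl (diag fun T => a * chargeSum f T) := by
    rw [bilin_diag]
    funext S T
    rw [matEl_diag]
    congr 1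
    rw [chargeSum, chargeSum, ← tsum_mul_left]
    exact tsum_congr fun n => mul_assoc _ _ _
  refine ⟨_, ?_, by rw [h, mul_diagonal]⟩
  rw [h]
  exact expConverges_diag _

lemma mul_diag_op (A : Op ℝ) (d : Maya → ℝ) :
    A ⊚ (fun S T => if S = T then d T else 0) = fun S T => A S T * d T := by
  funext S T
  rw [Op.mul, tsum_eq_single T]
  · rw [if_pos rfl]
  · intro U hU
    rw [if_neg hU, mul_zero]

lemma composable_diag_op (A : Op ℝ) (d : Maya → ℝ) :
    Op.Composable A (fun S T => if S = T then d T else 0) := fun S T =>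
  summable_of_ne_finset_zero (s := {T}) fun U hU => by
    show A S U * (if U = T then d T else 0) = 0
    rw [if_neg (fun h => hU (Finset.mem_singleton.2 h)), mul_zero]

lemma matEl_vertexOp_support {c : ℕ → ℝ} {V S : Maya} (h : matEl (vertexOp c) V S ≠ 0) :
    V ∈ lowStates (energy S) := mem_lowStates.2 (matEl_vertexOp_ne_zero h)

lemma ip_eq_sum (v w : Fock) {s : Finset Maya} (hs : ∀ V, v V ≠ 0 → V ∈ s) :
    ip v w = ∑ V ∈ s, v V * w V := by
  rw [ip, Finsupp.linearCombination_apply, Finsupp.sum, LinearMap.sum_apply]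
  exact Finset.sum_subset (fun V hV => hs V (Finsupp.mem_support_iff.1 hV)) fun V _ hV => by
    rw [Finsupp.notMem_support_iff.1 hV, zero_smul, LinearMap.zero_apply]

lemma gramEl_eq_sum (q : ℝ) (S T : Maya) : gramEl q S T = ∑ V ∈ lowStates (energy S),
    matEl (vertexOp (rhoCoeff q)) V S * matEl (vertexOp (rhoCoeff q)) V T :=
  ip_eq_sum _ _ fun _ hV => matEl_vertexOp_support hV

lemma gramEl_comm (q : ℝ) (S T : Maya) : gramEl q S T = gramEl q T S := ip_comm _ _

/-- `G₊` fixes the ground states. -/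
lemma gramEl_vac_left (q : ℝ) (p : ℤ) (T : Maya) :
    gramEl q (vac p) T = matEl (vertexOp (rhoCoeff q)) (vac p) T := by
  rw [gramEl, vertexOp_vac, ip_ket_left]
  rfl

/-- The operator `q^{W₀/2} G₋(q) G₊(q)`. -/
lemma qW0half_Gminus_Gplus (q : ℝ) :
    qW0half q ⊚ Gminus q ⊚ Gplus q = fun S T => wWeight q S * gramEl q S T := by
  have h1 : qW0half q ⊚ Gminus q =
      fun S T => wWeight q S * matEl (vertexOp (rhoCoeff q)) T S := by
    funext S T
    rw [Op.mul, tsum_eq_single S, qW0half_eq, Gminus_eq]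
    · simp only [if_true]
    · intro U hU
      rw [qW0half_eq]
      show (if S = U then wWeight q U else 0) * Gminus q U T = 0
      rw [if_neg (Ne.symm hU), zero_mul]
  funext S T
  rw [h1, Gplus_eq, Op.mul, tsum_eq_sum (s := lowStates (energy S)), gramEl_eq_sum, Finset.mul_sum]
  · exact Finset.sum_congr rfl fun V _ => mul_assoc _ _ _
  · intro V hV
    by_contra h
    exact hV (matEl_vertexOp_support (right_ne_zero_of_mul (left_ne_zero_of_mul h)))

lemma composable_qW0half_Gminus (q : ℝ) : Op.Composable (qW0half q) (Gminus q) := fun S T =>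
  summable_of_ne_finset_zero (s := {S}) fun U hU => by
    rw [qW0half_eq]
    show (if S = U then wWeight q U else 0) * Gminus q U T = 0
    rw [if_neg (fun h => hU (Finset.mem_singleton.2 h.symm)), zero_mul]

lemma summable_gramEl_vertexOp {q₁ q₂ Q : ℝ} (h₁0 : 0 < q₁) (h₁1 : q₁ < 1) (h₂0 : 0 < q₂)
    (h₂1 : q₂ < 1) (hQ0 : 0 < Q) (hQ : Q * Real.sqrt (q₁ * q₂) < 1) (S V : Maya) :
    Summable fun U : Maya =>
      gramEl q₁ S U * Q ^ energy U * matEl (vertexOp (rhoCoeff q₂)) V U := by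
  have : ∀ U, gramEl q₁ S U * Q ^ energy U * matEl (vertexOp (rhoCoeff q₂)) V U =
      ∑ V' ∈ lowStates (energy S), matEl (vertexOp (rhoCoeff q₁)) V' S *
        (matEl (vertexOp (rhoCoeff q₁)) V' U * Q ^ energy U *
          matEl (vertexOp (rhoCoeff q₂)) V U) := fun U => by
    rw [gramEl_eq_sum, Finset.sum_mul, Finset.sum_mul]
    exact Finset.sum_congr rfl fun V' _ => by ring
  simp only [this]
  exact summable_sum fun V' _ => (summable_cauchy h₁0 h₁1 h₂0 h₂1 hQ0 hQ V' V).mul_left _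

lemma hasSum_gramEl_gramEl {q₁ q₂ Q : ℝ} (h₁0 : 0 < q₁) (h₁1 : q₁ < 1) (h₂0 : 0 < q₂)
    (h₂1 : q₂ < 1) (hQ0 : 0 < Q) (hQ : Q * Real.sqrt (q₁ * q₂) < 1) (S T : Maya) :
    HasSum (fun U : Maya => gramEl q₁ S U * Q ^ energy U * gramEl q₂ U T)
      (∑ V ∈ lowStates (energy T), (∑' U : Maya, gramEl q₁ S U * Q ^ energy U *
        matEl (vertexOp (rhoCoeff q₂)) V U) * matEl (vertexOp (rhoCoeff q₂)) V T) := by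
  have : ∀ U, gramEl q₁ S U * Q ^ energy U * gramEl q₂ U T =
      ∑ V ∈ lowStates (energy T), gramEl q₁ S U * Q ^ energy U *
        matEl (vertexOp (rhoCoeff q₂)) V U * matEl (vertexOp (rhoCoeff q₂)) V T := fun U => by
    rw [gramEl_comm q₂, gramEl_eq_sum q₂, Finset.mul_sum]
    exact Finset.sum_congr rfl fun V _ => by ring
  simp only [this]
  exact hasSum_sum fun V _ =>
    (summable_gramEl_vertexOp h₁0 h₁1 h₂0 h₂1 hQ0 hQ S V).hasSum.mul_right _

/-- All products in `g` converge, so `g` is an element of `GL(∞)`; its matrix elements. -/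
lemma gOp_spec {q₁ q₂ Q : ℝ} (h₁0 : 0 < q₁) (h₁1 : q₁ < 1) (h₂0 : 0 < q₂)
    (h₂1 : q₂ < 1) (hQ0 : 0 < Q) (hQ : Q * Real.sqrt (q₁ * q₂) < 1) :
    IsGLInf (gOp q₁ q₂ Q) ∧ ∀ S T, gOp q₁ q₂ Q S T =
    wWeight q₁ S * (∑' U : Maya, gramEl q₁ S U * Q ^ energy U * gramEl q₂ U T) *
      wWeight q₂ T := by
  have hW : ∀ q, IsExpBilin (qW0half q) := fun q =>
    isExpBilin_diagonal (Real.log q / 2) fun n => (n : ℝ) ^ 2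
  have hL : IsExpBilin (QL0 Q) := isExpBilin_diagonal (Real.log Q) fun n => (n : ℝ)
  have g1 : IsGLInf (qW0half q₁) := by
    obtain ⟨a, ha, h⟩ := hW q₁
    exact h ▸ IsGLInf.exp a ha
  have g2 := g1.mul (isExpBilin_Gminus q₁) (composable_qW0half_Gminus q₁)
  have g3 := g2.mul (isExpBilin_Gplus q₁) (by rw [Gplus_eq]; exact composable_matEl _ _)
  have g4 := g3.mul hL (by rw [QL0_eq hQ0]; exact composable_diag_op _ _)
  have e4 : qW0half q₁ ⊚ Gminus q₁ ⊚ Gplus q₁ ⊚ QL0 Q =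
      fun S U => wWeight q₁ S * gramEl q₁ S U * Q ^ energy U := by
    rw [qW0half_Gminus_Gplus, QL0_eq hQ0, mul_diag_op]
  have g5 := g4.mul (isExpBilin_Gminus q₂) (by
    intro S V
    rw [e4, Gminus_eq]
    refine ((summable_gramEl_vertexOp h₁0 h₁1 h₂0 h₂1 hQ0 hQ S V).mul_left
      (wWeight q₁ S)).congr fun U => ?_
    ring)
  have e5 : qW0half q₁ ⊚ Gminus q₁ ⊚ Gplus q₁ ⊚ QL0 Q ⊚ Gminus q₂ = fun S V => wWeight q₁ S *
      ∑' U : Maya, gramEl q₁ S U * Q ^ energy U * matEl (vertexOp (rhoCoeff q₂)) V U := by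
    funext S V
    rw [e4, Gminus_eq, ← tsum_mul_left]
    exact tsum_congr fun U => by ring
  have g6 := g5.mul (isExpBilin_Gplus q₂) (by rw [Gplus_eq q₂]; exact composable_matEl _ _)
  have e6 : qW0half q₁ ⊚ Gminus q₁ ⊚ Gplus q₁ ⊚ QL0 Q ⊚ Gminus q₂ ⊚ Gplus q₂ =
      fun S T => wWeight q₁ S *
        ∑' U : Maya, gramEl q₁ S U * Q ^ energy U * gramEl q₂ U T := by
    funext S T
    rw [e5, Gplus_eq, (hasSum_gramEl_gramEl h₁0 h₁1 h₂0 h₂1 hQ0 hQ S T).tsum_eq, Op.mul,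
      tsum_eq_sum (s := lowStates (energy T)), Finset.mul_sum]
    · exact Finset.sum_congr rfl fun V _ => mul_assoc _ _ _
    · intro V hV
      by_contra h
      exact hV (matEl_vertexOp_support (right_ne_zero_of_mul h))
  have g7 := g6.mul (hW q₂) (by rw [qW0half_eq q₂]; exact composable_diag_op _ _)
  refine ⟨g7, fun S T => ?_⟩
  rw [gOp, e6, qW0half_eq, mul_diag_op]

/-- Exchanging `q₁` and `q₂` transposes `g`. -/
lemma gOp_comm {q₁ q₂ Q : ℝ} (h₁0 : 0 < q₁) (h₁1 : q₁ < 1) (h₂0 : 0 < q₂)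
    (h₂1 : q₂ < 1) (hQ0 : 0 < Q) (hQ : Q * Real.sqrt (q₁ * q₂) < 1) (S T : Maya) :
    gOp q₁ q₂ Q S T = gOp q₂ q₁ Q T S := by
  rw [(gOp_spec h₁0 h₁1 h₂0 h₂1 hQ0 hQ).2,
    (gOp_spec h₂0 h₂1 h₁0 h₁1 hQ0 (by rwa [mul_comm q₂])).2, mul_right_comm,
    mul_comm (wWeight q₁ S), mul_right_comm]
  congr 2
  refine tsum_congr fun U => ?_
  rw [gramEl_comm q₁, gramEl_comm q₂]
  ring

/-! ### Locally finite sums of formal power series -/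

/-- A family of formal power series is locally finite if only finitely many members contribute to
each coefficient. -/
def LocallyFinite {ι : Type*} (f : ι → Series) : Prop :=
  ∀ α, {i | MvPowerSeries.coeff α (f i) ≠ 0}.Finite

lemma LocallyFinite.summable {ι : Type*} {f : ι → Series} (hf : LocallyFinite f) : Summable f :=
  MvPowerSeries.WithPiTopology.summable_iff_summable_coeff.2 fun α =>
    summable_of_hasFiniteSupport (hf α)

lemma coeff_tsum {ι : Type*} {f : ι → Series} (hf : Summable f) (α : ℕ+ →₀ ℕ) :
    MvPowerSeries.coeff α (∑' i, f i) = ∑' i, MvPowerSeries.coeff α (f i) :=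
  ((MvPowerSeries.WithPiTopology.hasSum_iff_hasSum_coeff.1 hf.hasSum) α).tsum_eq.symm

lemma exists_coeff_ne_zero_of_tsum {ι : Type*} {f : ι → Series} {α : ℕ+ →₀ ℕ}
    (h : MvPowerSeries.coeff α (∑' i, f i) ≠ 0) : ∃ i, MvPowerSeries.coeff α (f i) ≠ 0 := by
  by_contra! h0
  by_cases hf : Summable f
  · rw [coeff_tsum hf] at h
    simp only [h0, tsum_zero, ne_eq, not_true_eq_false] at h
  · rw [tsum_eq_zero_of_not_summable hf, map_zero] at h
    exact h rfl

lemma exists_coeff_ne_zero_of_mul {f g : Series} {α : ℕ+ →₀ ℕ}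
    (h : MvPowerSeries.coeff α (f * g) ≠ 0) : ∃ β γ, β + γ = α ∧
      MvPowerSeries.coeff β f ≠ 0 ∧ MvPowerSeries.coeff γ g ≠ 0 := by
  rw [MvPowerSeries.coeff_mul] at h
  obtain ⟨x, hx, h⟩ := Finset.exists_ne_zero_of_sum_ne_zero h
  exact ⟨x.1, x.2, Finset.HasAntidiagonal.mem_antidiagonal.1 hx,
    left_ne_zero_of_mul h, right_ne_zero_of_mul h⟩

/-- The degree of a monomial in `t_1, t_2, …`, with `t_k` of degree `k`. -/
def wt (α : ℕ+ →₀ ℕ) : ℕ := Finsupp.weight (fun k : ℕ+ => (k : ℕ)) α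

lemma wt_add (α β : ℕ+ →₀ ℕ) : wt (α + β) = wt α + wt β := map_add _ _ _

lemma wt_single (k : ℕ+) : wt (Finsupp.single k 1) = k := by
  rw [wt, Finsupp.weight_single, one_smul]

/-! ### Graded operators -/

/-- Operators over formal power series such that the coefficient of a monomial of degree `w` lowers
the energy by `N w`. -/
def IsGraded (N : ℕ) (A : Op Series) : Prop :=
  ∀ α S T, MvPowerSeries.coeff α (A S T) ≠ 0 → energy T = energy S + N * wt α

lemma isGraded_one (N : ℕ) : IsGraded N (Op.one : Op Series) := by
  intro α S T h
  rw [Op.one] at h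
  split_ifs at h with hST
  · rw [MvPowerSeries.coeff_one] at h
    have h0 : α = 0 := by
      by_contra h'
      rw [if_neg h'] at h
      exact h rfl
    rw [hST, h0, wt, map_zero, mul_zero, add_zero]
  · exact absurd (map_zero _) h

lemma IsGraded.mul {N : ℕ} {A B : Op Series} (hA : IsGraded N A) (hB : IsGraded N B) :
    IsGraded N (A ⊚ B) := by
  intro α S T h
  obtain ⟨U, hU⟩ := exists_coeff_ne_zero_of_tsum h
  obtain ⟨β, γ, rfl, hβ, hγ⟩ := exists_coeff_ne_zero_of_mul hU
  rw [hB γ U T hγ, hA β S U hβ, wt_add]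
  ring

lemma IsGraded.pow {N : ℕ} {A : Op Series} (hA : IsGraded N A) (n : ℕ) :
    IsGraded N (Op.pow A n) := by
  induction n with
  | zero => exact isGraded_one N
  | succ n ih => exact ih.mul hA

lemma IsGraded.locallyFinite {N : ℕ} {A : Op Series} (hA : IsGraded N A) (S : Maya)
    (f : Maya → Series) : LocallyFinite fun U => A S U * f U := by
  intro α
  refine (lowStates (energy S + N * wt α)).finite_toSet.subset fun U hU => ?_
  obtain ⟨β, γ, rfl, hβ, -⟩ := exists_coeff_ne_zero_of_mul hU
  refine mem_lowStates.2 ?_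
  rw [hA β S U hβ, wt_add]
  gcongr
  omega

lemma IsGraded.composable {N : ℕ} {A : Op Series} (hA : IsGraded N A) (B : Op Series) :
    Op.Composable A B := fun S T => (hA.locallyFinite S fun U => B U T).summable

/-- The double sum over intermediate states is locally finite, whatever the last factor is. -/
lemma IsGraded.mul_assoc {N : ℕ} {A B : Op Series} (hA : IsGraded N A) (hB : IsGraded N B)
    (C : Op Series) : A ⊚ B ⊚ C = A ⊚ (B ⊚ C) := by
  funext S T
  have hs : Summable (Function.uncurry fun U V => A S V * (B V U * C U T)) := by
    refine LocallyFinite.summable fun α => ?_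
    have hf := (lowStates (energy S + N * wt α)).finite_toSet
    refine (hf.prod hf).subset ?_
    rintro ⟨U, V⟩ h
    obtain ⟨β, γ, rfl, hβ, h1⟩ := exists_coeff_ne_zero_of_mul h
    obtain ⟨γ', δ, rfl, hγ, -⟩ := exists_coeff_ne_zero_of_mul h1
    have e1 := hA β S V hβ
    have e2 := hB γ' V U hγ
    simp only [wt_add, mul_add]
    exact ⟨mem_lowStates.2 (by dsimp only; omega), mem_lowStates.2 (by dsimp only; omega)⟩
  calc (A ⊚ B ⊚ C) S T = ∑' U, ∑' V, A S V * (B V U * C U T) := by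
        refine tsum_congr fun U => ?_
        rw [Op.mul, ← Summable.tsum_mul_right _ (hA.composable B S U)]
        exact tsum_congr fun V => _root_.mul_assoc _ _ _
    _ = ∑' V, ∑' U, A S V * (B V U * C U T) := hs.tsum_comm.symm
    _ = (A ⊚ (B ⊚ C)) S T := tsum_congr fun V =>
        (hB.composable C V T).tsum_mul_left _

/-- Operators that strictly lower the energy. -/
def IsLowering (A : Op Series) : Prop := ∀ S T, A S T ≠ 0 → energy S < energy T

lemma IsLowering.pow {A : Op Series} (hA : IsLowering A) {n : ℕ} {S T : Maya}
    (h : Op.pow A n S T ≠ 0) : energy S + n ≤ energy T := by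
  induction n generalizing T with
  | zero =>
    have : S = T := by
      by_contra h'
      exact h (if_neg h')
    rw [this, add_zero]
  | succ n ih =>
    have h' : ∑' U, Op.pow A n S U * A U T ≠ 0 := h
    obtain ⟨U, hU⟩ : ∃ U, Op.pow A n S U * A U T ≠ 0 := by
      by_contra! h0
      exact h' (by simp only [h0, tsum_zero])
    have h1 := ih (left_ne_zero_of_mul hU)
    have h2 := hA U T (right_ne_zero_of_mul hU)
    omega

lemma IsLowering.summable_exp {A : Op Series} (hA : IsLowering A) (S T : Maya) :
    Summable fun n : ℕ => ((n.factorial : ℝ)⁻¹) • Op.pow A n S T :=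
  summable_of_ne_finset_zero (s := Finset.range (energy T + 1)) fun n hn => by
    rw [Finset.mem_range] at hn
    rw [show Op.pow A n S T = 0 from ?_, smul_zero]
    by_contra h
    have := hA.pow h
    omega

lemma expConverges {N : ℕ} {A : Op Series} (hA : IsGraded N A) (hA' : IsLowering A) :
    Op.ExpConverges A :=
  ⟨fun n => (hA.pow n).composable A, hA'.summable_exp⟩

lemma IsGraded.exp {N : ℕ} {A : Op Series} (hA : IsGraded N A) : IsGraded N (Op.exp A) := by
  intro α S T h
  obtain ⟨n, hn⟩ := exists_coeff_ne_zero_of_tsum h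
  rw [map_smul] at hn
  exact hA.pow n α S T (right_ne_zero_of_mul hn)

lemma IsGraded.pow_comm {N : ℕ} {A : Op Series} (hA : IsGraded N A) (n : ℕ) :
    A ⊚ Op.pow A n = Op.pow A n ⊚ A := by
  induction n with
  | zero =>
    funext S T
    refine (tsum_eq_single T ?_).trans (Eq.trans ?_ (tsum_eq_single S ?_).symm)
    · intro U hU
      rw [Op.pow, Op.one, if_neg hU, mul_zero]
    · rw [Op.pow, Op.one, Op.one, if_pos rfl, if_pos rfl, one_mul, mul_one]
    · intro U hU
      rw [Op.pow, Op.one, if_neg (Ne.symm hU), zero_mul]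
  | succ n ih => rw [Op.pow, ← hA.mul_assoc (hA.pow n), ih]

/-- Powers of a transposed operator; the powers of `A` commute with `A` since products of graded
operators are associative. -/
lemma IsGraded.pow_transpose {N : ℕ} {A : Op Series} (hA : IsGraded N A) (n : ℕ) :
    Op.pow (fun S T => A T S) n = fun S T => Op.pow A n T S := by
  induction n with
  | zero =>
    funext S T
    simp only [Op.pow, Op.one, eq_comm]
  | succ n ih =>
    funext S T
    rw [Op.pow, ih, Op.pow, ← hA.pow_comm]
    exact tsum_congr fun U => mul_comm _ _

lemma IsGraded.exp_transpose {N : ℕ} {A : Op Series} (hA : IsGraded N A) :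
    Op.exp (fun S T => A T S) = fun S T => Op.exp A T S := by
  funext S T
  simp only [Op.exp, hA.pow_transpose]

lemma expConverges_transpose {N : ℕ} {A : Op Series} (hA : IsGraded N A) (hA' : IsLowering A) :
    Op.ExpConverges (fun S T => A T S) := by
  refine ⟨fun n S T => ?_, fun S T => ?_⟩
  · rw [hA.pow_transpose]
    exact (hA.composable (Op.pow A n) T S).congr fun U => mul_comm _ _
  · simp only [hA.pow_transpose]
    exact hA'.summable_exp T S

/-- Exponentiation of the eigenvalue relation `A X = X d`, where `d` is diagonal. -/
lemma exp_mul_of_mul_eq {N : ℕ} {A : Op Series} (hA : IsGraded N A) (hA' : IsLowering A)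
    {X : Op Series} {d : Maya → Series} (h : A ⊚ X = fun S T => X S T * d T)
    (hd : ∀ T, Summable fun n : ℕ => ((n.factorial : ℝ)⁻¹) • d T ^ n) :
    Op.exp A ⊚ X = fun S T => X S T * NormedSpace.exp (d T) := by
  have hpow : ∀ n, Op.pow A n ⊚ X = fun S T => X S T * d T ^ n := by
    intro n
    induction n with
    | zero =>
      funext S T
      rw [pow_zero, mul_one]
      refine (tsum_eq_single S fun U hU => ?_).trans ?_
      · rw [Op.pow, Op.one, if_neg (Ne.symm hU), zero_mul]
      · rw [Op.pow, Op.one, if_pos rfl, one_mul]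
    | succ n ih =>
      rw [Op.pow, (hA.pow n).mul_assoc hA, h]
      funext S T
      have h1 : (Op.pow A n ⊚ fun S T => X S T * d T) S T = (Op.pow A n ⊚ X) S T * d T := by
        refine Eq.trans (tsum_congr fun U => ?_)
          (Summable.tsum_mul_right _ ((hA.pow n).composable X S T))
        exact (mul_assoc _ _ _).symm
      rw [h1, ih, pow_succ, mul_assoc]
  funext S T
  have hs : Summable (Function.uncurry fun (U : Maya) (n : ℕ) =>
      ((n.factorial : ℝ)⁻¹) • Op.pow A n S U * X U T) := by
    refine LocallyFinite.summable fun α => ?_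
    refine ((lowStates (energy S + N * wt α)).finite_toSet.prod
      (Finset.range (energy S + N * wt α + 1)).finite_toSet).subset ?_
    rintro ⟨U, n⟩ h
    obtain ⟨β, γ, rfl, hβ, -⟩ := exists_coeff_ne_zero_of_mul h
    rw [map_smul] at hβ
    have h0 := right_ne_zero_of_mul hβ
    have e1 := hA.pow n β S U h0
    have e2 := hA'.pow (n := n) (S := S) (T := U) fun h' => h0 (by rw [h', map_zero])
    simp only [wt_add, mul_add]
    exact ⟨mem_lowStates.2 (by dsimp only; omega), Finset.mem_coe.2 (Finset.mem_range.2 (by omega))⟩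
  calc (Op.exp A ⊚ X) S T = ∑' U, ∑' n : ℕ, ((n.factorial : ℝ)⁻¹) • Op.pow A n S U * X U T :=
        tsum_congr fun U => (Summable.tsum_mul_right _ (hA'.summable_exp S U)).symm
    _ = ∑' n : ℕ, ∑' U, ((n.factorial : ℝ)⁻¹) • Op.pow A n S U * X U T := hs.tsum_comm.symm
    _ = ∑' n : ℕ, X S T * ((n.factorial : ℝ)⁻¹ • d T ^ n) := by
        refine tsum_congr fun n => ?_
        simp only [smul_mul_assoc, mul_smul_comm]
        rw [Summable.tsum_const_smul _ ((hA.pow n).composable X S T)]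
        congr 1
        exact congrFun (congrFun (hpow n) S) T
    _ = X S T * NormedSpace.exp (d T) := by
        rw [(hd T).tsum_mul_left, NormedSpace.exp_eq_tsum ℝ]

/-! ### Linear forms in the coupling constants and their exponentials -/

/-- The linear form `∑_k a_k t_k`. -/
def linForm (a : ℕ+ → ℝ) : Series := fun α =>
  if h : ∃ k, α = Finsupp.single k 1 then a h.choose else 0

lemma coeff_linForm_single (a : ℕ+ → ℝ) (k : ℕ+) :
    MvPowerSeries.coeff (Finsupp.single k 1) (linForm a) = a k := by
  have hex : ∃ j : ℕ+, (Finsupp.single k 1 : ℕ+ →₀ ℕ) = Finsupp.single j 1 := ⟨k, rfl⟩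
  have h : MvPowerSeries.coeff (Finsupp.single k 1) (linForm a) = a hex.choose := dif_pos hex
  rw [h, ← Finsupp.single_left_injective one_ne_zero hex.choose_spec]

lemma coeff_linForm_of_ne (a : ℕ+ → ℝ) {α : ℕ+ →₀ ℕ} (h : ∀ k, α ≠ Finsupp.single k 1) :
    MvPowerSeries.coeff α (linForm a) = 0 := dif_neg (not_exists.2 h)

lemma coeff_smul_t (r : ℝ) (k : ℕ+) (α : ℕ+ →₀ ℕ) :
    MvPowerSeries.coeff α (r • t k) = if α = Finsupp.single k 1 then r else 0 := by
  rw [map_smul, t, MvPowerSeries.coeff_X, smul_eq_mul, mul_ite, mul_one, mul_zero]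

lemma hasSum_linForm (a : ℕ+ → ℝ) : HasSum (fun k => a k • t k) (linForm a) := by
  refine MvPowerSeries.WithPiTopology.hasSum_iff_hasSum_coeff.2 fun α => ?_
  simp only [coeff_smul_t]
  by_cases h : ∃ k, α = Finsupp.single k 1
  · obtain ⟨k, rfl⟩ := h
    rw [coeff_linForm_single]
    have := hasSum_single (f := fun j : ℕ+ =>
      if (Finsupp.single k 1 : ℕ+ →₀ ℕ) = Finsupp.single j 1 then a j else 0) k fun j hj =>
        if_neg fun h => hj (Finsupp.single_left_injective one_ne_zero h).symm
    simpa only [if_true] using this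
  · rw [not_exists] at h
    rw [coeff_linForm_of_ne a h]
    simp only [h, if_false]
    exact hasSum_zero

lemma linForm_add (a b : ℕ+ → ℝ) : linForm (fun k => a k + b k) = linForm a + linForm b := by
  refine (hasSum_linForm _).unique ?_
  simp only [add_smul]
  exact (hasSum_linForm a).add (hasSum_linForm b)

lemma constantCoeff_linForm (a : ℕ+ → ℝ) : MvPowerSeries.constantCoeff (linForm a) = 0 :=
  coeff_linForm_of_ne a fun k h => by
    have := DFunLike.congr_fun h k
    simp at this

lemma coeff_pow_eq_zero {f : Series} (hf : MvPowerSeries.constantCoeff f = 0) {α : ℕ+ →₀ ℕ} {n : ℕ}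
    (h : α.degree < n) : MvPowerSeries.coeff α (f ^ n) = 0 :=
  MvPowerSeries.coeff_eq_zero_of_constantCoeff_nilpotent (m := 1) (by rw [hf, pow_one]) (by omega)

lemma summable_expSeries {f : Series} (hf : MvPowerSeries.constantCoeff f = 0) :
    Summable fun n : ℕ => ((n.factorial : ℝ)⁻¹) • f ^ n := by
  refine LocallyFinite.summable fun α => ?_
  refine (Finset.range (α.degree + 1)).finite_toSet.subset fun n hn => ?_
  rw [Finset.mem_coe, Finset.mem_range]
  by_contra h
  refine hn ?_
  rw [map_smul, coeff_pow_eq_zero hf (by omega), smul_zero]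

/-- The Cauchy product of two exponential series, which is locally finite. -/
lemma exp_add {f g : Series} (hf : MvPowerSeries.constantCoeff f = 0)
    (hg : MvPowerSeries.constantCoeff g = 0) :
    NormedSpace.exp (f + g) = NormedSpace.exp f * NormedSpace.exp g := by
  rw [NormedSpace.exp_eq_tsum ℝ]
  dsimp only
  rw [(summable_expSeries hf).tsum_mul_tsum_eq_tsum_sum_antidiagonal (summable_expSeries hg)]
  · refine tsum_congr fun n => ?_
    rw [(Commute.all f g).add_pow', Finset.smul_sum]
    refine Finset.sum_congr rfl fun ij hij => ?_
    rw [Finset.HasAntidiagonal.mem_antidiagonal] at hij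
    rw [smul_mul_smul_comm, ← Nat.cast_smul_eq_nsmul ℝ, smul_smul, ← hij, Nat.cast_add_choose]
    congr 1
    have := Nat.factorial_ne_zero (ij.1 + ij.2)
    field_simp
  · refine LocallyFinite.summable fun α => ?_
    have hfin := (Finset.range (α.degree + 1)).finite_toSet
    refine (hfin.prod hfin).subset ?_
    rintro ⟨i, j⟩ h
    obtain ⟨β, γ, rfl, hβ, hγ⟩ := exists_coeff_ne_zero_of_mul h
    have e1 : i ≤ β.degree := by
      by_contra h'
      exact hβ (by rw [map_smul, coeff_pow_eq_zero hf (by omega), smul_zero])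
    have e2 : j ≤ γ.degree := by
      by_contra h'
      exact hγ (by rw [map_smul, coeff_pow_eq_zero hg (by omega), smul_zero])
    have e3 : (β + γ).degree = β.degree + γ.degree := map_add _ _ _
    simp only [Set.mem_prod, Finset.mem_coe, Finset.mem_range]
    omega

/-! ### The flows -/

lemma PNat.mul_natCast_ne_zero (N k : ℕ+) : (((N * k : ℕ+) : ℕ) : ℤ) ≠ 0 := by
  exact_mod_cast (N * k).ne_zero

lemma smul_sign_mul_t (r : ℝ) (n : ℕ) (k : ℕ+) :
    r • ((-1) ^ n * t k) = ((-1) ^ n * r) • t k := by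
  rw [mul_comm ((-1 : ℝ) ^ n), mul_smul]
  congr 1
  rcases Nat.even_or_odd n with h | h
  · rw [h.neg_one_pow, h.neg_one_pow, one_mul, one_smul]
  · rw [h.neg_one_pow, h.neg_one_pow, neg_one_mul, neg_one_smul]

lemma flowPlus_apply (N : ℕ+) (S T : Maya) : flowPlus N S T = linForm fun k =>
    (-1) ^ ((N * k : ℕ+) : ℕ) * matEl (cur (((N * k : ℕ+) : ℕ) : ℤ)) S T := by
  rw [← (hasSum_linForm _).tsum_eq, flowPlus, currentSum]
  refine tsum_congr fun k => ?_
  rw [J_eq (PNat.mul_natCast_ne_zero N k), smul_sign_mul_t]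

lemma flowMinus_eq (N : ℕ+) : flowMinus N = fun S T => flowPlus N T S := by
  funext S T
  exact currentSum_transpose (PNat.mul_natCast_ne_zero N) _ S T

lemma isGraded_flowPlus (N : ℕ+) : IsGraded N (flowPlus N) := by
  intro α S T h
  rw [flowPlus_apply] at h
  by_cases hα : ∃ k, α = Finsupp.single k 1
  · obtain ⟨k, rfl⟩ := hα
    rw [coeff_linForm_single] at h
    have := energy_of_matEl_oneBody (right_ne_zero_of_mul h)
    rw [PNat.mul_coe] at this
    rw [wt_single]
    omega
  · exact absurd (coeff_linForm_of_ne _ (not_exists.1 hα)) h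

lemma isLowering_flowPlus (N : ℕ+) : IsLowering (flowPlus N) := by
  intro S T h
  obtain ⟨k, hk⟩ : ∃ k : ℕ+, (energy S : ℤ) = energy T - ((N * k : ℕ+) : ℕ) := by
    by_contra! h'
    exact h (currentSum_eq_zero (PNat.mul_natCast_ne_zero N) _ h')
  have := (N * k).pos
  omega

lemma restrictedTimes_mul (N k : ℕ+) :
    restrictedTimes N (N * k) = (-1) ^ ((N * k : ℕ+) : ℕ) * t k := by
  rw [restrictedTimes, tsum_eq_single k fun j hj => if_neg fun h => hj (mul_left_cancel h),
    if_pos rfl]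

lemma restrictedTimes_eq_zero {N j : ℕ+} (h : ∀ k, N * k ≠ j) : restrictedTimes N j = 0 := by
  rw [restrictedTimes]
  simp only [h, if_false, tsum_zero]

lemma currentSum_restrictedTimes (N : ℕ+) :
    currentSum (fun k => ((k : ℕ) : ℤ)) (restrictedTimes N) = flowPlus N := by
  have h0 : ∀ k : ℕ+, ((k : ℕ) : ℤ) ≠ 0 := fun k => by exact_mod_cast k.ne_zero
  have hinj : Function.Injective fun k : ℕ+ => (((N * k : ℕ+) : ℕ) : ℤ) := fun _ _ h =>
    mul_left_cancel (injective_natCast_pnat h)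
  funext S T
  by_cases hj : ∃ j : ℕ+, (energy S : ℤ) = energy T - ((j : ℕ) : ℤ)
  · obtain ⟨j, hj⟩ := hj
    rw [currentSum_eq_of injective_natCast_pnat h0 _ hj]
    by_cases hk : ∃ k, N * k = j
    · obtain ⟨k, rfl⟩ := hk
      rw [flowPlus, currentSum_eq_of hinj (PNat.mul_natCast_ne_zero N) _ hj, restrictedTimes_mul]
    · rw [not_exists] at hk
      rw [restrictedTimes_eq_zero hk, smul_zero, flowPlus,
        currentSum_eq_zero (PNat.mul_natCast_ne_zero N)]
      intro k h
      refine hk k (injective_natCast_pnat ?_)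
      show (((N * k : ℕ+) : ℕ) : ℤ) = ((j : ℕ) : ℤ)
      omega
  · rw [not_exists] at hj
    rw [currentSum_eq_zero h0 _ hj, flowPlus, currentSum_eq_zero (PNat.mul_natCast_ne_zero N)]
    exact fun k => hj (N * k)

lemma currentSum_zero_times (i : ℕ+ → ℤ) :
    currentSum i (fun _ => (0 : Series)) = fun _ _ => 0 := by
  funext S T
  rw [currentSum]
  simp only [smul_zero, tsum_zero]

lemma exp_zero_op : Op.exp (fun _ _ => 0 : Op Series) = Op.one := by
  funext S T
  rw [Op.exp, tsum_eq_single 0]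
  · rw [Nat.factorial_zero, Nat.cast_one, inv_one, one_smul]
    rfl
  · intro n hn
    obtain ⟨m, rfl⟩ := Nat.exists_eq_succ_of_ne_zero hn
    rw [Op.pow, Op.mul]
    simp only [mul_zero, tsum_zero, smul_zero]

lemma mul_one_op (A : Op Series) : A ⊚ Op.one = A := by
  funext S T
  refine (tsum_eq_single T fun U hU => ?_).trans ?_
  · rw [Op.one, if_neg hU, mul_zero]
  · rw [Op.one, if_pos rfl, mul_one]

lemma one_mul_op (A : Op Series) : Op.one ⊚ A = A := by
  funext S T
  refine (tsum_eq_single S fun U hU => ?_).trans ?_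
  · rw [Op.one, if_neg (Ne.symm hU), zero_mul]
  · rw [Op.one, if_pos rfl, one_mul]

lemma todaTau_restrictedTimes_left (g : Op ℝ) (N : ℕ+) (p : ℤ) :
    todaTau g (restrictedTimes N) 0 p = vev p (Op.exp (flowPlus N) ⊚ Op.const Series g) := by
  rw [todaTau, currentSum_restrictedTimes]
  simp only [Pi.zero_apply, neg_zero]
  rw [currentSum_zero_times, exp_zero_op, mul_one_op]

lemma todaTau_restrictedTimes_right (g : Op ℝ) (N : ℕ+) (p : ℤ) :
    todaTau g 0 (fun j => -restrictedTimes N j) p =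
      vev p (Op.const Series g ⊚ Op.exp (flowMinus N)) := by
  have h : currentSum (fun k => -((k : ℕ) : ℤ)) (restrictedTimes N) = flowMinus N := by
    rw [flowMinus_eq, ← currentSum_restrictedTimes]
    funext S T
    exact currentSum_transpose (fun k => by exact_mod_cast k.ne_zero) _ S T
  rw [todaTau]
  simp only [neg_neg]
  rw [h, show (0 : ℕ+ → MvPowerSeries ℕ+ ℝ) = fun _ => 0 from rfl, currentSum_zero_times,
    exp_zero_op, one_mul_op]

/-! ### The flows acting on `g`, and the partition function -/

/-- The potentials are the eigenvalues `levelSum`, up to the constant that makes the prefactor of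
`Z`. -/
lemma Phi_eq {q : ℝ} (hq0 : 0 < q) (hq1 : q < 1) (k : ℕ+) (lam : YoungDiagram) (p : ℤ) :
    Phi q k lam p = q ^ (k : ℕ) / (1 - q ^ (k : ℕ)) + levelSum (q ^ (k : ℕ)) (mayaOf p lam) := by
  obtain ⟨M, hM⟩ := exists_rowLen_eq_zero lam
  set u := q ^ (k : ℕ) with hu
  have hu0 : u ≠ 0 := (pow_pos hq0 _).ne'
  have hu1 : 1 - u ≠ 0 := (sub_pos.2 (pow_lt_one₀ hq0.le hq1 k.ne_zero)).ne'
  have hu1' : u - 1 ≠ 0 := fun h => hu1 (by linarith)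
  have hz : ∀ n : ℤ, q ^ (((k : ℕ) : ℤ) * n) = u ^ n := fun n => by rw [zpow_mul, zpow_natCast]
  rw [levelSum, chargeSum_mayaOf _ hM,
    chargeSum_vac_of _ (fun p : ℤ => u * (1 - u ^ p) / (1 - u)) (by simp), Phi,
    tsum_eq_sum (s := Finset.range M)]
  · simp only [hz]
    rw [mul_comm p, hz]
    have : u / (u - 1) = -(u / (1 - u)) := by
      field_simp
      ring
    rw [this]
    ring
  · intro i hi
    rw [Finset.mem_range, not_lt] at hi
    rw [hM i hi, Nat.cast_zero, add_zero, sub_self]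
  · intro p
    rw [zpow_sub_one₀ hu0]
    field_simp
    ring

lemma PhiT_eq {q : ℝ} (hq0 : 0 < q) (hq1 : q < 1) (lam : YoungDiagram) (p : ℤ) :
    PhiT q lam p = linForm (fun k => q ^ (k : ℕ) / (1 - q ^ (k : ℕ))) +
      linForm fun k => levelSum (q ^ (k : ℕ)) (mayaOf p lam) := by
  rw [← linForm_add, PhiT]
  simp only [Phi_eq hq0 hq1]
  exact (hasSum_linForm _).tsum_eq

lemma coeff_mul_algebraMap (f : Series) (r : ℝ) (α : ℕ+ →₀ ℕ) :
    MvPowerSeries.coeff α (f * algebraMap ℝ Series r) = MvPowerSeries.coeff α f * r := by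
  rw [← Algebra.commutes, ← Algebra.smul_def, map_smul, smul_eq_mul, mul_comm]

lemma coeff_mul_const {N : ℕ} {A : Op Series} (hA : IsGraded N A) (B : Op ℝ) (α : ℕ+ →₀ ℕ)
    (S T : Maya) : MvPowerSeries.coeff α ((A ⊚ Op.const Series B) S T) =
      ∑ U ∈ lowStates (energy S + N * wt α), MvPowerSeries.coeff α (A S U) * B U T := by
  rw [Op.mul, coeff_tsum (hA.composable (Op.const Series B) S T)]
  simp only [Op.const, coeff_mul_algebraMap]
  refine tsum_eq_sum fun U hU => ?_
  by_contra h
  exact hU (mem_lowStates.2 (hA α S U (left_ne_zero_of_mul h)).le)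

/-- The flow acts on `q^{W₀/2} G₋(q) G₊(q)` by multiplication, on the right, with the diagonal
operator whose eigenvalues are the potentials. -/
lemma flowPlus_mul {q r : ℝ} (hr0 : 0 < r) (hr1 : r < 1) {N : ℕ+} (hrq : r ^ (N : ℕ) = q) :
    flowPlus N ⊚ Op.const Series (fun S T => wWeight r S * gramEl r S T) = fun S T =>
      Op.const Series (fun S T => wWeight r S * gramEl r S T) S T *
        linForm fun k => levelSum (q ^ (k : ℕ)) T := by
  funext S T
  ext α
  rw [coeff_mul_const (isGraded_flowPlus N), mul_comm (Op.const _ _ _ _), Op.const,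
    coeff_mul_algebraMap]
  simp only [flowPlus_apply]
  by_cases hα : ∃ k, α = Finsupp.single k 1
  · obtain ⟨k, rfl⟩ := hα
    simp only [coeff_linForm_single, mul_assoc]
    have hk : r ^ ((N * k : ℕ+) : ℕ) = q ^ (k : ℕ) := by rw [PNat.mul_coe, pow_mul, hrq]
    rw [← Finset.mul_sum, sum_cur_gramEl hr0 hr1 (N * k).ne_zero S T, hk]
    · rw [mul_assoc, ← mul_assoc, ← mul_pow, neg_one_mul, neg_neg, one_pow, one_mul]
    · intro U hU
      have := energy_of_matEl_oneBody hU
      rw [PNat.mul_coe] at this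
      rw [mem_lowStates, wt_single]
      omega
  · rw [not_exists] at hα
    simp only [coeff_linForm_of_ne _ hα, zero_mul, Finset.sum_const_zero]

section MatrixElements

variable {q q₁ q₂ Q : ℝ} {N : ℕ+}

/-- The sum over intermediate states in `exp(∑ (-1)^{Nk} t_k J_{Nk}) g`. -/
lemma hasSum_exp_flowPlus_gOp (h₁0 : 0 < q₁) (h₁1 : q₁ < 1) (h₂0 : 0 < q₂) (h₂1 : q₂ < 1)
    (hQ0 : 0 < Q) (hQ : Q * Real.sqrt (q₁ * q₂) < 1) (hN : q₁ ^ (N : ℕ) = q) (S T : Maya) :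
    HasSum (fun V : Maya => (wWeight q₁ S * gramEl q₁ S V *
        (Q ^ energy V * gramEl q₂ V T * wWeight q₂ T)) •
          NormedSpace.exp (linForm fun k => levelSum (q ^ (k : ℕ)) V))
      ((Op.exp (flowPlus N) ⊚ Op.const Series (gOp q₁ q₂ Q)) S T) := by
  have hg := isGraded_flowPlus N
  have hE := exp_mul_of_mul_eq hg (isLowering_flowPlus N) (flowPlus_mul h₁0 h₁1 hN)
    fun T => summable_expSeries (constantCoeff_linForm _)
  refine MvPowerSeries.WithPiTopology.hasSum_iff_hasSum_coeff.2 fun α => ?_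
  rw [coeff_mul_const hg.exp]
  have hgOp : ∀ U, HasSum (fun V : Maya => wWeight q₁ U * gramEl q₁ U V *
      (Q ^ energy V * gramEl q₂ V T * wWeight q₂ T)) (gOp q₁ q₂ Q U T) := fun U => by
    rw [(gOp_spec h₁0 h₁1 h₂0 h₂1 hQ0 hQ).2]
    have h := ((hasSum_gramEl_gramEl h₁0 h₁1 h₂0 h₂1 hQ0 hQ U T).summable.hasSum.mul_left
      (wWeight q₁ U)).mul_right (wWeight q₂ T)
    refine h.congr_fun fun V => ?_
    ring
  -- In each coefficient the flow is a finite sum over `U`, which is exchanged with the sum over `V`.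
  refine (hasSum_sum fun U (_ : U ∈ lowStates (energy S + N * wt α)) =>
    (hgOp U).mul_left (MvPowerSeries.coeff α (Op.exp (flowPlus N) S U))).congr_fun fun V => ?_
  have h1 := congrArg (MvPowerSeries.coeff α) (congrFun (congrFun hE S) V)
  rw [coeff_mul_const hg.exp, mul_comm (Op.const _ _ _ _), Op.const, coeff_mul_algebraMap] at h1
  rw [map_smul, smul_eq_mul, mul_right_comm, mul_comm (wWeight q₁ S * _), ← h1, Finset.sum_mul]
  exact Finset.sum_congr rfl fun U _ => by ring

/-- The partition function as a vacuum expectation value. -/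
lemma hasSum_Zterm (hq0 : 0 < q) (hq1 : q < 1) (h₁0 : 0 < q₁) (h₁1 : q₁ < 1) (h₂0 : 0 < q₂)
    (h₂1 : q₂ < 1) (hQ0 : 0 < Q) (hQ : Q * Real.sqrt (q₁ * q₂) < 1) (hN : q₁ ^ (N : ℕ) = q)
    (p : ℤ) : HasSum (Zterm q q₁ q₂ Q p) (prefactor q q₁ q₂ p *
      vev p (Op.exp (flowPlus N) ⊚ Op.const Series (gOp q₁ q₂ Q))) := by
  have h := hasSum_exp_flowPlus_gOp (N := N) h₁0 h₁1 h₂0 h₂1 hQ0 hQ hN (vac p) (vac p)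
  have hinj : Function.Injective (mayaOf p) := fun _ _ h => (mayaOf_injective h).2
  rw [← hinj.hasSum_iff] at h
  · refine (h.mul_left (prefactor q q₁ q₂ p)).congr_fun fun lam => ?_
    have hw : (q₁ * q₂) ^ (-((p : ℝ) * ((p : ℝ) + 1) * (2 * (p : ℝ) + 1)) / 12) *
        (wWeight q₁ (vac p) * wWeight q₂ (vac p)) = 1 := by
      rw [wWeight_vac h₁0, wWeight_vac h₂0, ← Real.mul_rpow h₁0.le h₂0.le,
        ← Real.rpow_add (mul_pos h₁0 h₂0), neg_div, neg_add_cancel, Real.rpow_zero]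
    have hQe : Q ^ ((lam.card : ℝ) + (p : ℝ) * ((p : ℝ) + 1) / 2) = Q ^ energy (mayaOf p lam) := by
      rw [← energy_vac, ← Nat.cast_add, Real.rpow_natCast, energy_mayaOf, add_comm]
    rw [Function.comp_apply, Zterm, prefactor, PhiT_eq hq0 hq1,
      exp_add (constantCoeff_linForm _) (constantCoeff_linForm _), (hasSum_linForm _).tsum_eq,
      smul_mul_smul_comm, gramEl_vac_left, gramEl_comm q₂, gramEl_vac_left, hQe,
      schurRho_eq_matEl h₁0 h₁1 p, schurRho_eq_matEl h₂0 h₂1 p]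
    congr 1
    generalize (q₁ * q₂) ^ (-((p : ℝ) * ((p : ℝ) + 1) * (2 * (p : ℝ) + 1)) / 12) = c at hw ⊢
    linear_combination (-(matEl (vertexOp (rhoCoeff q₁)) (vac p) (mayaOf p lam) *
      matEl (vertexOp (rhoCoeff q₂)) (vac p) (mayaOf p lam) * Q ^ energy (mayaOf p lam))) * hw
  -- Only the states of charge `p` contribute.
  · intro V hV
    rw [show gramEl q₂ V (vac p) = 0 from ?_, mul_zero, zero_mul, mul_zero, zero_smul]
    rw [gramEl_comm, gramEl_vac_left]
    by_contra hne
    obtain ⟨p', lam, rfl⟩ := exists_eq_mayaOf V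
    have h1 := charge_of_matEl_vertexOp hne
    rw [← mayaOf_bot, charge_mayaOf, charge_mayaOf, Int.cast_inj] at h1
    exact hV ⟨lam, by rw [h1]⟩

lemma Zterm_comm (q q₁ q₂ Q : ℝ) (p : ℤ) : Zterm q q₁ q₂ Q p = Zterm q q₂ q₁ Q p := by
  funext lam
  rw [Zterm, Zterm, mul_comm (schurRho q₁ lam)]

lemma prefactor_comm (q q₁ q₂ : ℝ) (p : ℤ) : prefactor q q₁ q₂ p = prefactor q q₂ q₁ p := by
  rw [prefactor, prefactor, mul_comm q₁]

end MatrixElements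

lemma exp_flowMinus (N : ℕ+) : Op.exp (flowMinus N) = fun S T => Op.exp (flowPlus N) T S := by
  rw [flowMinus_eq, (isGraded_flowPlus N).exp_transpose]

lemma const_mul_exp_flowMinus {g g' : Op ℝ} (h : ∀ S T, g S T = g' T S) (N : ℕ+) (S T : Maya) :
    (Op.const Series g ⊚ Op.exp (flowMinus N)) S T =
      (Op.exp (flowPlus N) ⊚ Op.const Series g') T S := by
  rw [exp_flowMinus]
  refine tsum_congr fun U => ?_
  rw [mul_comm, Op.const, Op.const, h]

lemma composable_exp_flowMinus (g : Op ℝ) (N : ℕ+) :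
    Op.Composable (Op.const Series g) (Op.exp (flowMinus N)) := by
  intro S T
  rw [exp_flowMinus]
  refine ((isGraded_flowPlus N).exp.composable (fun U V => Op.const Series g V U) T S).congr
    fun U => ?_
  exact mul_comm _ _

lemma root_spec {q r : ℝ} (hq0 : 0 < q) (hq1 : q < 1) {N : ℕ+}
    (hr : r = q ^ (1 / ((N : ℕ) : ℝ))) : 0 < r ∧ r < 1 ∧ r ^ (N : ℕ) = q := by
  have hN : (0 : ℝ) < ((N : ℕ) : ℝ) := by exact_mod_cast N.pos
  refine ⟨hr ▸ Real.rpow_pos_of_pos hq0 _, hr ▸ Real.rpow_lt_one hq0.le hq1 (by positivity), ?_⟩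
  rw [hr, ← Real.rpow_natCast, ← Real.rpow_mul hq0.le, one_div_mul_cancel hN.ne', Real.rpow_one]

end

end MeltingCrystal

theorem theorem1 (q q₁ q₂ Q : ℝ) (N₁ N₂ : ℕ+) (p : ℤ)
    (hq0 : 0 < q) (hq1 : q < 1)
    (hq₁ : q₁ = q ^ (1 / ((N₁ : ℕ) : ℝ))) (hq₂ : q₂ = q ^ (1 / ((N₂ : ℕ) : ℝ)))
    (hQ0 : 0 < Q) (hQ : Q * Real.sqrt (q₁ * q₂) < 1) :
    -- the partition function is well defined
    (∀ lam : YoungDiagram,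
      Summable (fun T : SemistandardYoungTableau lam => tableauWeight q₁ T) ∧
      Summable (fun T : SemistandardYoungTableau lam => tableauWeight q₂ T)) ∧
    Summable (Zterm q q₁ q₂ Q p) ∧
    -- `g` is a well defined element of `GL(∞)`
    IsGLInf (gOp q₁ q₂ Q) ∧
    -- the operators on the right hand sides are well defined
    Op.ExpConverges (flowPlus N₁) ∧
    Op.ExpConverges (flowMinus N₂) ∧
    Op.Composable (Op.exp (flowPlus N₁)) (Op.const Series (gOp q₁ q₂ Q)) ∧
    Op.Composable (Op.const Series (gOp q₁ q₂ Q)) (Op.exp (flowMinus N₂)) ∧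
    -- the two fermionic expressions
    Z q q₁ q₂ Q p = prefactor q q₁ q₂ p *
      vev p (Op.exp (flowPlus N₁) ⊚ Op.const Series (gOp q₁ q₂ Q)) ∧
    Z q q₁ q₂ Q p = prefactor q q₁ q₂ p *
      vev p (Op.const Series (gOp q₁ q₂ Q) ⊚ Op.exp (flowMinus N₂)) ∧
    -- up to the simple factor, `Z` is the tau function of `g` at restricted times
    Z q q₁ q₂ Q p = prefactor q q₁ q₂ p *
      todaTau (gOp q₁ q₂ Q) (restrictedTimes N₁) 0 p ∧
    Z q q₁ q₂ Q p = prefactor q q₁ q₂ p *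
      todaTau (gOp q₁ q₂ Q) 0 (fun j => -restrictedTimes N₂ j) p := by
  obtain ⟨h₁0, h₁1, h₁⟩ := root_spec hq0 hq1 hq₁
  obtain ⟨h₂0, h₂1, h₂⟩ := root_spec hq0 hq1 hq₂
  have hQ' : Q * Real.sqrt (q₂ * q₁) < 1 := by rwa [mul_comm q₂]
  have hZ := hasSum_Zterm hq0 hq1 h₁0 h₁1 h₂0 h₂1 hQ0 hQ h₁ p
  have e1 : Z q q₁ q₂ Q p = prefactor q q₁ q₂ p *
      vev p (Op.exp (flowPlus N₁) ⊚ Op.const Series (gOp q₁ q₂ Q)) := hZ.tsum_eq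
  -- The second expression is the transpose of the first one with `q₁`, `q₂` exchanged.
  have e2 : Z q q₁ q₂ Q p = prefactor q q₁ q₂ p *
      vev p (Op.const Series (gOp q₁ q₂ Q) ⊚ Op.exp (flowMinus N₂)) := by
    rw [Z, Zterm_comm, (hasSum_Zterm hq0 hq1 h₂0 h₂1 h₁0 h₁1 hQ0 hQ' h₂ p).tsum_eq,
      prefactor_comm, vev, vev,
      const_mul_exp_flowMinus (gOp_comm h₁0 h₁1 h₂0 h₂1 hQ0 hQ)]
  refine ⟨fun lam => ⟨(hasSum_tableauWeight h₁0 h₁1 p lam).summable,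
    (hasSum_tableauWeight h₂0 h₂1 p lam).summable⟩, hZ.summable,
    (gOp_spec h₁0 h₁1 h₂0 h₂1 hQ0 hQ).1,
    expConverges (isGraded_flowPlus N₁) (isLowering_flowPlus N₁), ?_,
    (isGraded_flowPlus N₁).exp.composable _, composable_exp_flowMinus _ _, e1, e2, ?_, ?_⟩
  · rw [flowMinus_eq]
    exact expConverges_transpose (isGraded_flowPlus N₂) (isLowering_flowPlus N₂)
  · rw [todaTau_restrictedTimes_left, e1]
  · rw [todaTau_restrictedTimes_right, e2]
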